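/- Let $(M,T^{1,0}M)$ be a CR manifold of hypersurface type: $M$ is a smooth manifold of dimension $2n+1$ ($n\ge 1$) and $T^{1,0}M\subset\mathbb{C}TM$ is a smooth, formally integrable complex subbundle of rank $n$ with $T^{1,0}M\cap\overline{T^{1,0}M}=0$. Let $H(M)=\mathrm{Re}\,T^{1,0}M$ with its complex structure $J_b(Z+\overline Z)=i(Z-\overline Z)$. A pseudo-Hermitian structure is a nowhere vanishing smooth real one-form $\theta$ annihilating $T^{1,0}M$; its Levi form is $\lambda_\theta(Z,\overline W)=\frac i4\theta([Z,\overline W])$. Assume that $M$ is pseudoconvex, i.e. $\lambda_\theta\ge 0$ for some $\theta$, and let $\mathcal N\subseteq T^{1,0}M$ be the null distribution of the Levi form (which does not depend on $\theta$). For a family $\mathcal D$ of complex subspaces $\mathcal D_p\subseteq\mathbb{C}T_pM$ put $S_{\mathcal D}=\{p:\mathcal D_p\ne 0\}$ and $\mathcal D'_p=\mathcal D_p\cap\mathbb{C}T_pS_{\mathcal D}$, where, for $A\subseteq M$, $T_pA$ is the set of $X\in T_pM$ with $Xf=0$ for all $f\in C^\infty(M,\mathbb R)$ vanishing on $A$.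 Put $\mathcal D^{(0)}=\mathcal D$, $\mathcal D^{(\beta+1)}=(\mathcal D^{(\beta)})'$, $\mathcal D^{(\beta)}=\bigcap_{\gamma<\beta}\mathcal D^{(\gamma)}$ for limit ordinals $\beta$, and let $\mathfrak C(\mathcal D)=\mathcal D^{(\omega_1)}$ be the core of $\mathcal D$. A D'Angelo form is a real one-form $\alpha(X)=\theta([T,X-\theta(X)T])$, where $\theta$ is a pseudo-Hermitian structure and $T$ a smooth real vector field with $\theta(T)\equiv 1$; the D'Angelo class $\mathcal A_M$ is the set of all of them. For $\alpha\in\mathcal A_M$ and a distribution $\mathcal D\subseteq\mathcal N$ let $$\mathfrak n(\alpha;\mathcal D)=\inf\{t>0:\ \overline{\alpha_{0,1}}\wedge\alpha_{0,1}<t\,\overline\partial\alpha_{1,0}\ \text{on }\mathcal D\}\in[0,+\infty]$$ (strict inequality of Hermitian forms, i.e. on nonzero vectors; $\inf\emptyset=+\infty$), where, for a section $Z$ of $T^{1,0}M$ with $Z_p\in\mathcal N_p$, at $p$ one has $(\overline{\alpha_{0,1}}\wedge\alpha_{0,1})(Z,\overline Z)=\frac12|\alpha(Z)|^2$ and $\overline\partial\alpha_{1,0}(Z,\overline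 Z)=\frac12\bigl(-\overline Z(\alpha(Z))-\alpha([Z,\overline Z]_{1,0})\bigr)$. Let $\mathfrak n(\mathcal D)=\inf\{\mathfrak n(\alpha;\mathcal D):\alpha\in\mathcal A_M\}$ and, given a Hermitian metric $h$ on $\mathbb{C}TM$ and $K\in(0,+\infty]$, let $\mathfrak n_K(\mathcal D)=\inf\{\mathfrak n(\alpha;\mathcal D):\alpha\in\mathcal A_M,\ \|\alpha\|_{h,\mathcal N}<K\}$, where $\|\alpha\|_{h,\mathcal N}=\sup\{|\alpha(Z)|: Z\in\mathcal N,\ h(Z,Z)=1\}$ and where there is no restriction on $\alpha$ if $K=+\infty$. **Proposition.** Let $\alpha$ be a D'Angelo form on $M$. Suppose that $M$ contains a complex manifold $V$ (a smooth, injectively immersed manifold whose tangent spaces are $J_b$-invariant subspaces of $H(M)$) such that the class $[\alpha|_V]\in H^1_{\mathrm{dR}}(V,\mathbb R)$ is nontrivial, i.e. $\alpha|_V$ is not exact. Then $\mathfrak n(\mathfrak C(\mathcal N))>0$; hence $\mathfrak n_K(\mathfrak C(\mathcal N))>0$ for all $K\in(0,+\infty]$ and every metric $h$. Consequently, if $M$,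 with its CR structure, is the boundary (with the induced CR structure) of a precompact, smoothly bounded, pseudoconvex domain $\Omega$ in a complex manifold of dimension $n+1$, then the Diederich–Fornæss index $$\mathrm{DF}(\Omega)=\sup\{\delta\in(0,1]:\ -(-r)^\delta\text{ is plurisubharmonic on }\Omega\text{ for some smooth defining function } r \text{ of }\Omega\}$$ is strictly less than one. (Here a defining function is a smooth $r:U\to\mathbb R$, with $U$ an open neighbourhood of $\overline\Omega$, such that $\Omega=\{x\in U: r(x)<0\}$ and $dr\ne0$ on $b\Omega$; the supremum is $0$ if there is no such $\delta$.) -/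

import Mathlib

open scoped Manifold ContDiff ENNReal

noncomputable section

namespace CRGeom

/-! ### Complexification of a real vector space -/

/-- The complexification `ℂ ⊗ V` of a real vector space: the pair `(x, y)` stands for `x + i y`. -/
def Complexified (V : Type*) : Type _ := V × V

namespace Complexified

variable {V : Type*}

/-- The vector `x + i y`. -/
def mk (x y : V) : Complexified V := (x, y)

/-- The real part `x` of `x + i y`. -/
def re (z : Complexified V) : V := z.1

/-- The imaginary part `y` of `x + i y`. -/
def im (z : Complexified V) : V := z.2

@[simp] theorem re_mk (x y : V) : (mk x y).re = x := rfl

@[simp] theorem im_mk (x y : V) : (mk x y).im = y := rfl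

@[ext] theorem ext {z w : Complexified V} (h₁ : z.re = w.re) (h₂ : z.im = w.im) : z = w :=
  Prod.ext h₁ h₂

instance [AddCommGroup V] : AddCommGroup (Complexified V) :=
  inferInstanceAs (AddCommGroup (V × V))

section Algebra

variable [AddCommGroup V]

@[simp] theorem re_zero : (0 : Complexified V).re = 0 := rfl

@[simp] theorem im_zero : (0 : Complexified V).im = 0 := rfl

@[simp] theorem re_add (z w : Complexified V) : (z + w).re = z.re + w.re := rfl

@[simp] theorem im_add (z w : Complexified V) : (z + w).im = z.im + w.im := rfl

/-- Complex conjugation on the complexification. -/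
def conj (z : Complexified V) : Complexified V := mk z.re (-z.im)

@[simp] theorem re_conj (z : Complexified V) : z.conj.re = z.re := rfl

@[simp] theorem im_conj (z : Complexified V) : z.conj.im = -z.im := rfl

variable [Module ℝ V]

instance : SMul ℂ (Complexified V) :=
  ⟨fun c z => mk (c.re • z.re - c.im • z.im) (c.re • z.im + c.im • z.re)⟩

@[simp] theorem re_smul (c : ℂ) (z : Complexified V) :
    (c • z).re = c.re • z.re - c.im • z.im := rfl

@[simp] theorem im_smul (c : ℂ) (z : Complexified V) :
    (c • z).im = c.re • z.im + c.im • z.re := rfl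

instance : Module ℂ (Complexified V) where
  one_smul z := by ext <;> simp
  mul_smul a b z := by
    ext <;> simp only [re_smul, im_smul, Complex.mul_re, Complex.mul_im] <;> module
  smul_zero a := by ext <;> simp
  smul_add a z w := by
    ext <;> simp only [re_smul, im_smul, re_add, im_add] <;> module
  add_smul a b z := by
    ext <;> simp only [re_smul, im_smul, re_add, im_add, Complex.add_re, Complex.add_im] <;> module
  zero_smul z := by ext <;> simp

end Algebra

end Complexified

/-- The complex-linear extension of a real covector to the complexification. -/
def cext {V : Type*} [AddCommGroup V] [Module ℝ V] [TopologicalSpace V]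
    (η : V →L[ℝ] ℝ) (z : Complexified V) : ℂ :=
  (η z.re : ℂ) + Complex.I * (η z.im : ℂ)

theorem cext_add {V : Type*} [AddCommGroup V] [Module ℝ V] [TopologicalSpace V]
    (η : V →L[ℝ] ℝ) (z w : Complexified V) : cext η (z + w) = cext η z + cext η w := by
  simp only [cext, Complexified.re_add, Complexified.im_add, map_add, Complex.ofReal_add]
  ring

theorem cext_smul {V : Type*} [AddCommGroup V] [Module ℝ V] [TopologicalSpace V]
    (η : V →L[ℝ] ℝ) (c : ℂ) (z : Complexified V) : cext η (c • z) = c * cext η z := by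
  apply Complex.ext <;> simp [cext]

/-! ### Vector fields and one-forms on a real manifold of dimension `d` -/

section Manifold

variable (d : ℕ) (M : Type*) [TopologicalSpace M] [ChartedSpace (EuclideanSpace ℝ (Fin d)) M]
  [IsManifold (𝓡 d) ∞ M]

/-- Real vector fields (no smoothness). -/
abbrev VField : Type _ := ∀ p : M, TangentSpace (𝓡 d) p

/-- Complex vector fields, i.e. sections of `ℂTM` (no smoothness). -/
abbrev CVField : Type _ := ∀ p : M, Complexified (TangentSpace (𝓡 d) p)

/-- Real one-forms (no smoothness). -/
abbrev OneForm : Type _ := ∀ p : M, TangentSpace (𝓡 d) p →L[ℝ] ℝ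

/-- A complex distribution: a complex subspace of `ℂT_pM` for every point `p`. -/
abbrev CDistribution : Type _ :=
  ∀ p : M, Submodule ℂ (Complexified (TangentSpace (𝓡 d) p))

variable {d M}

/-- Smoothness of a real vector field on a set. -/
def VField.SmoothOn (X : VField d M) (U : Set M) : Prop :=
  ContMDiffOn (𝓡 d) (𝓡 d).tangent ∞ (fun p => (⟨p, X p⟩ : TangentBundle (𝓡 d) M)) U

/-- Smoothness of a real vector field. -/
def VField.Smooth (X : VField d M) : Prop :=
  ContMDiff (𝓡 d) (𝓡 d).tangent ∞ (fun p => (⟨p, X p⟩ : TangentBundle (𝓡 d) M))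

namespace CVField

/-- The real vector field `X`, where `Z = X + i Y`. -/
def re (Z : CVField d M) : VField d M := fun p => (Z p).re

/-- The real vector field `Y`, where `Z = X + i Y`. -/
def im (Z : CVField d M) : VField d M := fun p => (Z p).im

/-- The conjugate vector field. -/
def conj (Z : CVField d M) : CVField d M := fun p => (Z p).conj

/-- Smoothness of a complex vector field on a set. -/
def SmoothOn (Z : CVField d M) (U : Set M) : Prop := Z.re.SmoothOn U ∧ Z.im.SmoothOn U

/-- Smoothness of a complex vector field. -/
def Smooth (Z : CVField d M) : Prop := Z.re.Smooth ∧ Z.im.Smooth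

/-- The complex-bilinear extension of the Lie bracket to complex vector fields. -/
def bracket (Z W : CVField d M) : CVField d M := fun p =>
  Complexified.mk
    (VectorField.mlieBracket (𝓡 d) Z.re W.re p - VectorField.mlieBracket (𝓡 d) Z.im W.im p)
    (VectorField.mlieBracket (𝓡 d) Z.re W.im p + VectorField.mlieBracket (𝓡 d) Z.im W.re p)

/-- The derivative `(Z f)(p)` of a complex-valued function along a complex vector field. -/
def deriv (Z : CVField d M) (f : M → ℂ) (p : M) : ℂ :=
  mvfderiv (𝓡 d) f p (Z.re p) + Complex.I * mvfderiv (𝓡 d) f p (Z.im p)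

end CVField

theorem VField.Smooth.mdiffAt {X : VField d M} (hX : X.Smooth) (p : M) :
    MDifferentiableAt (𝓡 d) (𝓡 d).tangent (fun p => (⟨p, X p⟩ : TangentBundle (𝓡 d) M)) p :=
  (hX p).mdifferentiableAt (by simp)

theorem VField.smooth_zero : VField.Smooth (0 : VField d M) :=
  Bundle.contMDiff_zeroSection ℝ (TangentSpace (𝓡 d) : M → Type _)

theorem VField.Smooth.add {X Y : VField d M} (hX : X.Smooth) (hY : Y.Smooth) :
    VField.Smooth (X + Y) := ContMDiff.add_section hX hY

theorem VField.Smooth.sub {X Y : VField d M} (hX : X.Smooth) (hY : Y.Smooth) :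
    VField.Smooth (X - Y) := ContMDiff.sub_section hX hY

theorem VField.Smooth.const_smul {X : VField d M} (c : ℝ) (hX : X.Smooth) :
    VField.Smooth (c • X) := ContMDiff.const_smul_section hX

theorem CVField.bracket_add_left {Z Z' : CVField d M} (W : CVField d M) (hZ : Z.Smooth)
    (hZ' : Z'.Smooth) (p : M) : CVField.bracket (Z + Z') W p = Z.bracket W p + Z'.bracket W p := by
  have h1 : CVField.re (Z + Z') = Z.re + Z'.re := rfl
  have h2 : CVField.im (Z + Z') = Z.im + Z'.im := rfl
  have e1 := fun Y : VField d M => VectorField.mlieBracket_add_left (W := Y)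
    (hZ.1.mdiffAt p) (hZ'.1.mdiffAt p)
  have e2 := fun Y : VField d M => VectorField.mlieBracket_add_left (W := Y)
    (hZ.2.mdiffAt p) (hZ'.2.mdiffAt p)
  ext1
  · simp only [CVField.bracket, h1, h2, e1, e2, Complexified.re_mk, Complexified.re_add]
    abel
  · simp only [CVField.bracket, h1, h2, e1, e2, Complexified.im_mk, Complexified.im_add]
    abel

theorem CVField.bracket_const_smul_left (c : ℂ) {Z : CVField d M} (W : CVField d M)
    (hZ : Z.Smooth) (p : M) : CVField.bracket (c • Z) W p = c • Z.bracket W p := by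
  have h1 : CVField.re (c • Z) = c.re • Z.re + (-c.im) • Z.im := by
    funext q
    simp [CVField.re, CVField.im, sub_eq_add_neg]
  have h2 : CVField.im (c • Z) = c.re • Z.im + c.im • Z.re := rfl
  have e1 := fun Y : VField d M => VectorField.mlieBracket_add_left (W := Y)
    ((hZ.1.const_smul c.re).mdiffAt p) ((hZ.2.const_smul (-c.im)).mdiffAt p)
  have e2 := fun Y : VField d M => VectorField.mlieBracket_add_left (W := Y)
    ((hZ.2.const_smul c.re).mdiffAt p) ((hZ.1.const_smul c.im).mdiffAt p)
  have e3 := fun (a : ℝ) (Y : VField d M) => VectorField.mlieBracket_const_smul_left (c := a)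
    (W := Y) (hZ.1.mdiffAt p)
  have e4 := fun (a : ℝ) (Y : VField d M) => VectorField.mlieBracket_const_smul_left (c := a)
    (W := Y) (hZ.2.mdiffAt p)
  ext1
  · simp only [CVField.bracket, h1, h2, e1, e2, e3, e4, Complexified.re_mk, Complexified.im_mk,
      Complexified.re_smul]
    module
  · simp only [CVField.bracket, h1, h2, e1, e2, e3, e4, Complexified.re_mk, Complexified.im_mk,
      Complexified.im_smul]
    module

theorem CVField.smooth_zero : CVField.Smooth (0 : CVField d M) :=
  ⟨VField.smooth_zero, VField.smooth_zero⟩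

theorem CVField.Smooth.add {Z Z' : CVField d M} (hZ : Z.Smooth) (hZ' : Z'.Smooth) :
    CVField.Smooth (Z + Z') := ⟨hZ.1.add hZ'.1, hZ.2.add hZ'.2⟩

theorem CVField.Smooth.const_smul (c : ℂ) {Z : CVField d M} (hZ : Z.Smooth) :
    CVField.Smooth (c • Z) :=
  ⟨(hZ.1.const_smul c.re).sub (hZ.2.const_smul c.im),
    (hZ.2.const_smul c.re).add (hZ.1.const_smul c.im)⟩

/-- A real one-form is smooth if it maps smooth vector fields to smooth functions. -/
def OneForm.Smooth (η : OneForm d M) : Prop :=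
  ∀ X : VField d M, X.Smooth → ContMDiff (𝓡 d) 𝓘(ℝ, ℝ) ∞ (fun p => η p (X p))

/-- A one-form `η` is exact if `η = df` for a smooth real-valued function `f`, that is, if
it represents the zero class in the first de Rham cohomology group. -/
def OneForm.IsExact (η : OneForm d M) : Prop :=
  ∃ f : M → ℝ, ContMDiff (𝓡 d) 𝓘(ℝ, ℝ) ∞ f ∧ ∀ p, mvfderiv (𝓡 d) f p = η p

/-- The pull-back `ι^* η` of a one-form. -/
def OneForm.pullback {m : ℕ} {V : Type*} [TopologicalSpace V]
    [ChartedSpace (EuclideanSpace ℝ (Fin m)) V] (η : OneForm d M) (ι : V → M) : OneForm m V :=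
  fun x => (η (ι x)).comp (mfderiv (𝓡 m) (𝓡 d) ι x)

/-! ### Derived distributions and the core -/

/-- The (smooth Zariski) tangent space `T_pA` of an arbitrary subset `A` at `p`: the real tangent
vectors annihilating every smooth real function that vanishes on `A`. -/
def zariskiTangent (A : Set M) (p : M) : Submodule ℝ (TangentSpace (𝓡 d) p) where
  carrier := {v | ∀ f : M → ℝ, ContMDiff (𝓡 d) 𝓘(ℝ, ℝ) ∞ f → (∀ q ∈ A, f q = 0) →
    mvfderiv (𝓡 d) f p v = 0}
  add_mem' := by
    intro v w hv hw f hf hA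
    rw [map_add, hv f hf hA, hw f hf hA, add_zero]
  zero_mem' := by
    intro f _ _
    exact map_zero _
  smul_mem' := by
    intro c v hv f hf hA
    rw [map_smul, hv f hf hA, smul_zero]

/-- The complexified tangent space `ℂT_pA`. -/
def complexZariskiTangent (A : Set M) : CDistribution d M := fun p =>
  { carrier := {z | z.re ∈ zariskiTangent A p ∧ z.im ∈ zariskiTangent A p}
    add_mem' := fun {_ _} hz hw =>
      ⟨Submodule.add_mem _ hz.1 hw.1, Submodule.add_mem _ hz.2 hw.2⟩
    zero_mem' := ⟨Submodule.zero_mem _, Submodule.zero_mem _⟩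
    smul_mem' := fun c _ hz =>
      ⟨Submodule.sub_mem _ (Submodule.smul_mem _ c.re hz.1) (Submodule.smul_mem _ c.im hz.2),
        Submodule.add_mem _ (Submodule.smul_mem _ c.re hz.2) (Submodule.smul_mem _ c.im hz.1)⟩ }

namespace CDistribution

/-- The support: the set of points with a non-zero fibre. -/
def support (D : CDistribution d M) : Set M := {p | D p ≠ ⊥}

/-- The derived distribution `D' = D ∩ ℂT S_D`, where `S_D` is the support of `D`. -/
def derived (D : CDistribution d M) : CDistribution d M :=
  fun p => D p ⊓ complexZariskiTangent D.support p

/-- The iterated derived distributions `D^(o)`, by transfinite recursion on the ordinal `o`. -/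
def iterDerived (D : CDistribution d M) (o : Ordinal.{0}) : CDistribution d M :=
  Ordinal.limitRecOn (motive := fun _ => CDistribution d M) o D (fun _ E => E.derived)
    (fun o _ E => fun p => ⨅ (b : Ordinal.{0}) (hb : b < o), E b hb p)

/-- The core of a distribution: its iterated derived distribution at the first uncountable
ordinal. -/
def core (D : CDistribution d M) : CDistribution d M := D.iterDerived (Ordinal.omega 1)

end CDistribution

/-- A smooth Hermitian metric on the complexified tangent bundle. -/
structure HermitianMetric (d : ℕ) (M : Type*) [TopologicalSpace M]
    [ChartedSpace (EuclideanSpace ℝ (Fin d)) M] [IsManifold (𝓡 d) ∞ M] where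
  /-- The value `h_p(z, w)`, linear in `z` and conjugate-linear in `w`. -/
  val : ∀ p : M, Complexified (TangentSpace (𝓡 d) p) → Complexified (TangentSpace (𝓡 d) p) → ℂ
  add_left : ∀ p z z' w, val p (z + z') w = val p z w + val p z' w
  smul_left : ∀ p (c : ℂ) z w, val p (c • z) w = c * val p z w
  conj_symm : ∀ p z w, val p w z = (starRingEnd ℂ) (val p z w)
  pos : ∀ p z, z ≠ 0 → 0 < (val p z z).re
  smooth : ∀ Z W : CVField d M, Z.Smooth → W.Smooth →
    ContMDiff (𝓡 d) 𝓘(ℝ, ℂ) ∞ (fun p => val p (Z p) (W p))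

/-- The `(h, D)`-size of a one-form: the supremum of `|η(z)|` over all `h`-unit vectors `z`
of `D`. -/
def OneForm.size (h : HermitianMetric d M) (D : CDistribution d M) (η : OneForm d M) : ℝ≥0∞ :=
  ⨆ (p : M) (z : Complexified (TangentSpace (𝓡 d) p)) (_ : z ∈ D p) (_ : h.val p z z = 1),
    ENNReal.ofReal ‖cext (η p) z‖

end Manifold

/-! ### CR manifolds of hypersurface type -/

/-- A CR structure of hypersurface type on a real manifold `M` of dimension `2n+1`: a smooth
formally integrable complex subbundle `T^{1,0}M` of rank `n` of `ℂTM` which meets its conjugate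
only in the zero section. -/
structure CRStructure (n : ℕ) (M : Type*) [TopologicalSpace M]
    [ChartedSpace (EuclideanSpace ℝ (Fin (2 * n + 1))) M] [IsManifold (𝓡 (2 * n + 1)) ∞ M] where
  /-- The bundle `T^{1,0}M`. -/
  T10 : CDistribution (2 * n + 1) M
  finrank_eq : ∀ p, Module.finrank ℂ (T10 p) = n
  exists_local_frame : ∀ p₀ : M, ∃ U : Set M, IsOpen U ∧ p₀ ∈ U ∧
    ∃ Z : Fin n → CVField (2 * n + 1) M, (∀ i, (Z i).SmoothOn U) ∧
      (∀ q ∈ U, ∀ i, Z i q ∈ T10 q) ∧ ∀ q ∈ U, LinearIndependent ℂ (fun i => Z i q)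
  eq_zero_of_conj_mem : ∀ p, ∀ z ∈ T10 p, z.conj ∈ T10 p → z = 0
  integrable : ∀ Z W : CVField (2 * n + 1) M, Z.Smooth → W.Smooth →
    (∀ p, Z p ∈ T10 p) → (∀ p, W p ∈ T10 p) → ∀ p, Z.bracket W p ∈ T10 p

namespace CRStructure

variable {n : ℕ} {M : Type*} [TopologicalSpace M]
  [ChartedSpace (EuclideanSpace ℝ (Fin (2 * n + 1))) M] [IsManifold (𝓡 (2 * n + 1)) ∞ M]
  (S : CRStructure n M)

/-- Smooth global sections of `T^{1,0}M`. -/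
def IsSection (Z : CVField (2 * n + 1) M) : Prop := Z.Smooth ∧ ∀ p, Z p ∈ S.T10 p

/-- The relation "`X ∈ H_p(M)` and `J_b X = X'`", where `H(M)` is the space of real parts of vectors
of `T^{1,0}M` and `J_b(Z + conj Z) = i (Z - conj Z)`: it says that `X - i X'` is in `T^{1,0}M`. -/
def IsJb (p : M) (X X' : TangentSpace (𝓡 (2 * n + 1)) p) : Prop :=
  Complexified.mk X (-X') ∈ S.T10 p

/-- Pseudo-Hermitian structures: smooth nowhere vanishing real one-forms annihilating
`T^{1,0}M`. -/
structure IsPseudoHermitian (θ : OneForm (2 * n + 1) M) : Prop where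
  smooth : θ.Smooth
  ne_zero : ∀ p, θ p ≠ 0
  vanishes : ∀ p, ∀ z ∈ S.T10 p, cext (θ p) z = 0

/-- The Levi form `λ_θ(Z, conj W) = (i/4) θ([Z, conj W])`, for sections `Z, W` of `T^{1,0}M`. -/
def leviForm (θ : OneForm (2 * n + 1) M) (Z W : CVField (2 * n + 1) M) (p : M) : ℂ :=
  Complex.I / 4 * cext (θ p) (Z.bracket W.conj p)

/-- Pseudoconvexity: some pseudo-Hermitian structure has a nonnegative Levi form (the real number
`λ_θ(Z, conj Z)` is written as the real part of a complex one). -/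
def IsPseudoconvex : Prop :=
  ∃ θ, S.IsPseudoHermitian θ ∧ ∀ Z, S.IsSection Z → ∀ p, 0 ≤ (leviForm θ Z Z p).re

theorem leviForm_add_left (θ : OneForm (2 * n + 1) M) {Z Z' : CVField (2 * n + 1) M}
    (W : CVField (2 * n + 1) M) (hZ : Z.Smooth) (hZ' : Z'.Smooth) (p : M) :
    leviForm θ (Z + Z') W p = leviForm θ Z W p + leviForm θ Z' W p := by
  rw [leviForm, CVField.bracket_add_left _ hZ hZ', cext_add, mul_add]
  rfl

theorem leviForm_const_smul_left (θ : OneForm (2 * n + 1) M) (c : ℂ)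
    {Z : CVField (2 * n + 1) M} (W : CVField (2 * n + 1) M) (hZ : Z.Smooth) (p : M) :
    leviForm θ (c • Z) W p = c * leviForm θ Z W p := by
  rw [leviForm, CVField.bracket_const_smul_left _ _ hZ, cext_smul, leviForm]
  ring

theorem leviForm_zero_left (θ : OneForm (2 * n + 1) M) (W : CVField (2 * n + 1) M) (p : M) :
    leviForm θ 0 W p = 0 := by
  have h := leviForm_const_smul_left θ 0 W (CVField.smooth_zero (d := 2 * n + 1) (M := M)) p
  rwa [zero_smul, zero_mul] at h

/-- The Levi distribution `N`, the null distribution of the Levi forms `λ_θ`: the vectors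
`z` of `T^{1,0}_pM` with `λ_θ(z, conj w) = 0` for all `w` in `T^{1,0}_pM`. The value of
`λ_θ` at `p` is computed by extending vectors to smooth sections of `T^{1,0}M`. -/
def leviDistribution : CDistribution (2 * n + 1) M := fun p =>
  { carrier := {z | ∃ Z, S.IsSection Z ∧ Z p = z ∧
      ∀ θ, S.IsPseudoHermitian θ → ∀ W, S.IsSection W → leviForm θ Z W p = 0}
    add_mem' := by
      rintro _ _ ⟨Z, hZ, rfl, h⟩ ⟨Z', hZ', rfl, h'⟩
      refine ⟨Z + Z', ⟨hZ.1.add hZ'.1, fun q => Submodule.add_mem _ (hZ.2 q) (hZ'.2 q)⟩, rfl, ?_⟩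
      intro θ hθ W hW
      rw [leviForm_add_left θ W hZ.1 hZ'.1, h θ hθ W hW, h' θ hθ W hW, add_zero]
    zero_mem' :=
      ⟨0, ⟨CVField.smooth_zero, fun q => Submodule.zero_mem _⟩, rfl,
        fun θ _ W _ => leviForm_zero_left θ W p⟩
    smul_mem' := by
      rintro c _ ⟨Z, hZ, rfl, h⟩
      refine ⟨c • Z, ⟨hZ.1.const_smul c, fun q => Submodule.smul_mem _ c (hZ.2 q)⟩, rfl, ?_⟩
      intro θ hθ W hW
      rw [leviForm_const_smul_left θ c W hZ.1, h θ hθ W hW, mul_zero] }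

/-- The Levi core `C(N)`. -/
def leviCore : CDistribution (2 * n + 1) M := S.leviDistribution.core

/-! ### D'Angelo forms -/

/-- `α` is a D'Angelo form: for some pseudo-Hermitian structure `θ` and some smooth real vector
field `T` with `θ(T) = 1`, one has `α(X) = θ([T, X - θ(X) T])` for all smooth vector fields `X`
(real vector fields suffice by complex linearity). The set of all D'Angelo forms is the
D'Angelo class. -/
def IsDAngeloForm (α : OneForm (2 * n + 1) M) : Prop :=
  ∃ (θ : OneForm (2 * n + 1) M) (T : VField (2 * n + 1) M), S.IsPseudoHermitian θ ∧ T.Smooth ∧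
    (∀ p, θ p (T p) = 1) ∧
    ∀ X : VField (2 * n + 1) M, X.Smooth → ∀ p,
      α p (X p) = θ p (VectorField.mlieBracket (𝓡 (2 * n + 1)) T (fun q => X q - θ q (X q) • T q) p)

open Classical in
/-- The component in `T^{1,0}_pM` of a vector of the direct sum of `T^{1,0}_pM` and its
conjugate (zero for the other vectors). -/
def oneZeroPart (p : M) (z : Complexified (TangentSpace (𝓡 (2 * n + 1)) p)) :
    Complexified (TangentSpace (𝓡 (2 * n + 1)) p) :=
  if h : ∃ a ∈ S.T10 p, (z - a).conj ∈ S.T10 p then h.choose else 0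

/-- The value at `p` of the Hermitian form induced by `∂bar α_{1,0}` on the Levi distribution,
`∂bar α_{1,0}(Z, conj W) = (1/2) (- conj W (α(Z)) - α([Z, conj W]_{1,0}))`, where `Z, W` are sections
of `T^{1,0}M` whose values at `p` are in the Levi distribution, so that `[Z, conj W]` at `p`
is in the direct sum of `T^{1,0}M` and its conjugate. -/
def dbarForm (α : OneForm (2 * n + 1) M) (Z W : CVField (2 * n + 1) M) (p : M) : ℂ :=
  (1 / 2) * (-(W.conj.deriv (fun q => cext (α q) (Z q)) p)
    - cext (α p) (S.oneZeroPart p (Z.bracket W.conj p)))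

/-- The strict inequality of Hermitian forms `conj α_{0,1} ∧ α_{0,1} < t ∂bar α_{1,0}` on a
sub-distribution `D` of the Levi distribution. By the usual convention for the wedge product,
`(conj α_{0,1} ∧ α_{0,1})(z, conj z) = |α(z)|^2 / 2`; the number `∂bar α_{1,0}(z, conj z)` is real
for D'Angelo forms on pseudoconvex manifolds. -/
def FormIneq (α : OneForm (2 * n + 1) M) (D : CDistribution (2 * n + 1) M) (t : ℝ) : Prop :=
  ∀ Z, S.IsSection Z → ∀ p, Z p ∈ D p → Z p ≠ 0 →
    (1 / 2) * ‖cext (α p) (Z p)‖ ^ 2 < t * (S.dbarForm α Z Z p).re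

/-- `n(α; D)`, the infimum (`∞` if there is none) of the `t > 0` such that
`conj α_{0,1} ∧ α_{0,1} < t ∂bar α_{1,0}` on `D`. -/
def formNorm (α : OneForm (2 * n + 1) M) (D : CDistribution (2 * n + 1) M) : ℝ≥0∞ :=
  ⨅ (t : ℝ) (_ : 0 < t) (_ : S.FormIneq α D t), ENNReal.ofReal t

/-- `n_K(D)`, the infimum of `n(α; D)` over the D'Angelo forms `α` with `(h, N)`-size less than
`K`; there is no restriction on the size if `K = ∞`. -/
def dangeloNormK (h : HermitianMetric (2 * n + 1) M) (K : ℝ≥0∞) (D : CDistribution (2 * n + 1) M) :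
    ℝ≥0∞ :=
  ⨅ (α : OneForm (2 * n + 1) M) (_ : S.IsDAngeloForm α)
    (_ : K = ⊤ ∨ α.size h S.leviDistribution < K), S.formNorm α D

/-- `n(D) = n_∞(D)`, the infimum of `n(α; D)` over all the D'Angelo forms `α`. -/
def dangeloNorm (D : CDistribution (2 * n + 1) M) : ℝ≥0∞ :=
  ⨅ (α : OneForm (2 * n + 1) M) (_ : S.IsDAngeloForm α), S.formNorm α D

/-- The image of the injective immersion `ι : V → M` is a complex manifold contained in `M`: its
tangent spaces are `J_b`-invariant subspaces of `H(M)`. -/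
structure IsComplexSubmanifold (m : ℕ) {V : Type*} [TopologicalSpace V]
    [ChartedSpace (EuclideanSpace ℝ (Fin m)) V] [IsManifold (𝓡 m) ∞ V] (ι : V → M) : Prop where
  contMDiff : ContMDiff (𝓡 m) (𝓡 (2 * n + 1)) ∞ ι
  injective : Function.Injective ι
  mfderiv_injective : ∀ x, Function.Injective (mfderiv (𝓡 m) (𝓡 (2 * n + 1)) ι x)
  jb_invariant : ∀ (x : V) (v : TangentSpace (𝓡 m) x), ∃ w : TangentSpace (𝓡 m) x,
    S.IsJb (ι x) (mfderiv (𝓡 m) (𝓡 (2 * n + 1)) ι x v) (mfderiv (𝓡 m) (𝓡 (2 * n + 1)) ι x w)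

end CRStructure

/-! ### Domains in complex manifolds and the Diederich-Fornaess index -/

section Domain

variable {N : ℕ} {X : Type*} [TopologicalSpace X] [ChartedSpace (EuclideanSpace ℂ (Fin N)) X]

/-- Four times the complex Hessian `∂ ∂bar u (v, conj v)` of a real function on a complex manifold of
dimension `N`, computed in the preferred holomorphic chart at `x`. The real tangent space at
`x` is `ℂ^N` via this chart, and the complex structure is the multiplication by `i`. -/
def complexHessian (u : X → ℝ) (x : X)
    (v : TangentSpace 𝓘(ℝ, EuclideanSpace ℂ (Fin N)) x) : ℝ :=
  let g : EuclideanSpace ℂ (Fin N) → ℝ :=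
    u ∘ (extChartAt 𝓘(ℝ, EuclideanSpace ℂ (Fin N)) x).symm
  let y : EuclideanSpace ℂ (Fin N) := extChartAt 𝓘(ℝ, EuclideanSpace ℂ (Fin N)) x x
  let a : EuclideanSpace ℂ (Fin N) := v
  fderiv ℝ (fderiv ℝ g) y a a + fderiv ℝ (fderiv ℝ g) y (Complex.I • a) (Complex.I • a)

/-- Smooth plurisubharmonic functions on an open set. -/
def IsSmoothPsh (u : X → ℝ) (O : Set X) : Prop :=
  ContMDiffOn 𝓘(ℝ, EuclideanSpace ℂ (Fin N)) 𝓘(ℝ, ℝ) ∞ u O ∧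
    ∀ x ∈ O, ∀ v : TangentSpace 𝓘(ℝ, EuclideanSpace ℂ (Fin N)) x, 0 ≤ complexHessian u x v

variable (N) in
/-- `r`, considered on the open set `U`, is a defining function of `Ω`. -/
structure IsDefiningFunction (Ω U : Set X) (r : X → ℝ) : Prop where
  isOpen : IsOpen U
  isCompact_closure : IsCompact (closure Ω)
  closure_subset : closure Ω ⊆ U
  contMDiffOn : ContMDiffOn 𝓘(ℝ, EuclideanSpace ℂ (Fin N)) 𝓘(ℝ, ℝ) ∞ r U
  eq_sublevel : Ω = {x ∈ U | r x < 0}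
  differential_ne_zero : ∀ x ∈ frontier Ω,
    mvfderiv 𝓘(ℝ, EuclideanSpace ℂ (Fin N)) r x ≠ 0

variable (N) in
/-- Precompact, smoothly bounded, pseudoconvex domains: some (equivalently every) defining
function has a nonnegative Levi form on the complex tangent spaces of the boundary, that is, on
the vectors `v` with `dr(v) = dr(iv) = 0`. -/
structure IsPseudoconvexDomain (Ω : Set X) : Prop where
  isOpen : IsOpen Ω
  isConnected : IsConnected Ω
  isCompact_closure : IsCompact (closure Ω)
  exists_defining : ∃ (U : Set X) (r : X → ℝ), IsDefiningFunction N Ω U r ∧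
    ∀ x ∈ frontier Ω, ∀ v : EuclideanSpace ℂ (Fin N),
      mvfderiv 𝓘(ℝ, EuclideanSpace ℂ (Fin N)) r x v = 0 →
      mvfderiv 𝓘(ℝ, EuclideanSpace ℂ (Fin N)) r x (Complex.I • v) = 0 →
      0 ≤ complexHessian (N := N) r x v

variable (N) in
/-- The Diederich-Fornaess index of `Ω`: the supremum of the `δ` in `(0, 1]` such that
`-(-r)^δ` is plurisubharmonic on `Ω` for some defining function `r` of `Ω` (zero if there is no such
`δ`). -/
def dfIndex (Ω : Set X) : ℝ :=
  sSup {δ : ℝ | 0 < δ ∧ δ ≤ 1 ∧ ∃ (U : Set X) (r : X → ℝ), IsDefiningFunction N Ω U r ∧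
    IsSmoothPsh (N := N) (fun x => -((-r x) ^ δ)) Ω}

/-- The differential of a smooth map from a real manifold to a complex one, with values in the
complex vector space `ℂ^N`, which is the tangent space of `X` in the preferred chart. -/
def embDeriv {d : ℕ} {M : Type*} [TopologicalSpace M]
    [ChartedSpace (EuclideanSpace ℝ (Fin d)) M] (j : M → X) (p : M)
    (v : TangentSpace (𝓡 d) p) : EuclideanSpace ℂ (Fin N) :=
  mfderiv (𝓡 d) 𝓘(ℝ, EuclideanSpace ℂ (Fin N)) j p v

/-- The smooth embedding `j` identifies the CR manifold `(M, T^{1,0}M)` with the boundary of `Ω`, with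
its induced CR structure: a complex tangent vector `z = x + i y` of `M` is in `T^{1,0}M` if
and only if `dj(z)` is in `T^{1,0}X`, that is, `dj(y) = - J dj(x)`. -/
structure CRStructure.IsBoundary {n : ℕ} {M : Type*} [TopologicalSpace M]
    [ChartedSpace (EuclideanSpace ℝ (Fin (2 * n + 1))) M] [IsManifold (𝓡 (2 * n + 1)) ∞ M]
    (S : CRStructure n M) {X : Type*} [TopologicalSpace X]
    [ChartedSpace (EuclideanSpace ℂ (Fin (n + 1))) X] (Ω : Set X) (j : M → X) : Prop where
  isEmbedding : Topology.IsEmbedding j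
  contMDiff : ContMDiff (𝓡 (2 * n + 1)) 𝓘(ℝ, EuclideanSpace ℂ (Fin (n + 1))) ∞ j
  mfderiv_injective : ∀ p, Function.Injective
    (mfderiv (𝓡 (2 * n + 1)) 𝓘(ℝ, EuclideanSpace ℂ (Fin (n + 1))) j p)
  range_eq : Set.range j = frontier Ω
  mem_T10_iff : ∀ (p : M) (z : Complexified (TangentSpace (𝓡 (2 * n + 1)) p)),
    z ∈ S.T10 p ↔
      embDeriv (N := n + 1) j p z.im = -(Complex.I • embDeriv (N := n + 1) j p z.re)

end Domain

end CRGeom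

end

/-!
Let `V` be a complex submanifold of the CR manifold `M`, and `α` a D'Angelo form.

*The class of `α` on `V`.* On Levi-null vectors, two D'Angelo forms differ by an exact form
`d log |g|`, where `g` is the quotient of the two pseudo-Hermitian structures
(`CRStructure.IsDAngeloForm.exists_add_mvfderiv_eq`). Since `V` is tangent to `ker θ` and the Levi
form is semidefinite, the `(1,0)`-vectors tangent to `V` are Levi-null; hence `V` is contained in
all the successive supports which define the core, and these vectors lie in the Levi core
(`CRStructure.IsComplexSubmanifold.mem_leviCore`).

*The estimate.* Suppose that the norm of the core is zero. Then there are D'Angelo forms `α_k`, and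
constants `t_k > 0` with `∑ t_k < ∞`, such that `|α_k(Z)|² ≤ 2 t_k Re ∂bar (α_k)_{1,0}(Z, conj Z)`
along `V`; and `α_k = α + df_k` on `V`. In a chart of `V` the right-hand side is `-t_k` times a
divergence in `α_k`, up to terms of order zero (`DbarIneqAt`). Multiplication by a cut-off function
and integration by parts, as in Caccioppoli's inequality, give that `α_k` is of size `t_k` in `L²`,
locally (`exists_integral_sq_le`). So `∑ |α + df_k|` is integrable, and the integrals of `α + df_k`
over almost every segment tend to zero: up to additive constants, `-f_k` converges almost everywhere
to a local primitive of `α` (`exists_primitive_of_tsum_lintegral_ne_top`). The local primitives are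
limits of the same sequence, so that their discrepancies are a coboundary of constants, and they can
be glued (`exists_glue`): the restriction of `α` to `V` is exact
(`OneForm.isExact_of_dbarIneqAt`, `CRStructure.IsComplexSubmanifold.isExact_pullback`). As the
infimum in the norm with a bound `K` is over fewer forms, that norm is positive too.

*The Diederich–Fornæss index.* If the index is not less than one, there are defining functions `r_k`
such that `-(-r_k)^(1 - τ_k)` is plurisubharmonic, with `τ_k` as small as desired. The forms
`θ_k = dr_k ∘ J` are pseudo-Hermitian structures on the boundary. At a boundary point, the
plurisubharmonicity is tested on vectors `A + ε (c₁ + i c₂) N`, where `A` is tangent to `V`, at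
distance `ε` from the boundary in the normal direction `N`; the limit as `ε → 0`
(`boundary_inequality`), optimised over `c₁` and `c₂`, is the inequality `DbarIneqAt` with constant
`τ_k / (1 - τ_k)` for the D'Angelo form given by `θ_k` (`dbarIneqAt_of_psh`). This uses that, along
`V`, the latter is `d log |h| - (d arg h) ∘ J`, where `h` is the complex normal derivative of `r_k`
(`dbarOp_eq_of_log`). The estimate above applies again, and `α` is exact on `V`.
-/

noncomputable section

open MeasureTheory Set Filter Topology

namespace CRGeom

/-! ### An `L²` estimate by integration by parts -/

section Caccioppoli

variable {m : ℕ}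

/-- The divergence of a vector field on Euclidean space. -/
def euclideanDiv (Y : EuclideanSpace ℝ (Fin m) → EuclideanSpace ℝ (Fin m))
    (x : EuclideanSpace ℝ (Fin m)) : ℝ :=
  ∑ j, fderiv ℝ Y x (EuclideanSpace.single j 1) j

theorem continuous_euclideanDiv {Y : EuclideanSpace ℝ (Fin m) → EuclideanSpace ℝ (Fin m)}
    (hY : ContDiff ℝ 1 Y) : Continuous (euclideanDiv Y) := by
  have h := hY.continuous_fderiv one_ne_zero
  unfold euclideanDiv
  fun_prop

theorem integral_fderiv_apply_eq_zero {f : EuclideanSpace ℝ (Fin m) → ℝ} (hf : ContDiff ℝ 1 f)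
    (hfc : HasCompactSupport f) (v : EuclideanSpace ℝ (Fin m)) :
    ∫ x, fderiv ℝ f x v = 0 := by
  have hD : Continuous (fun x => fderiv ℝ f x v) :=
    (hf.continuous_fderiv one_ne_zero).clm_apply continuous_const
  have hDc : HasCompactSupport (fun x => fderiv ℝ f x v) := hfc.fderiv_apply (𝕜 := ℝ) v
  have h := integral_mul_fderiv_eq_neg_fderiv_mul_of_integrable (μ := volume) (v := v)
    (f := fun _ : EuclideanSpace ℝ (Fin m) => (1 : ℝ)) (g := f) (by simp)
    (by simpa using hD.integrable_of_hasCompactSupport hDc)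
    (by simpa using hf.continuous.integrable_of_hasCompactSupport hfc)
    (fun x _ => by fun_prop) (fun x _ => (hf.differentiable one_ne_zero) x)
  simpa using h

theorem _root_.HasCompactSupport.sq {X : Type*} [TopologicalSpace X] {f : X → ℝ}
    (hf : HasCompactSupport f) : HasCompactSupport (fun x => f x ^ 2) := by
  simp only [pow_two]
  exact hf.mul_right

theorem sum_coord_smul_single (w : EuclideanSpace ℝ (Fin m)) :
    ∑ j, w j • EuclideanSpace.single j (1 : ℝ) = w := by
  ext i
  simp [Pi.single_apply]

theorem integrable_fderiv_add_mul_div {f : EuclideanSpace ℝ (Fin m) → ℝ} (hf : ContDiff ℝ 1 f)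
    (hfc : HasCompactSupport f) {Y : EuclideanSpace ℝ (Fin m) → EuclideanSpace ℝ (Fin m)}
    (hY : ContDiff ℝ 1 Y) :
    Integrable (fun x => fderiv ℝ f x (Y x) + f x * euclideanDiv Y x) := by
  have hD : Continuous (fun x => fderiv ℝ f x (Y x)) :=
    (hf.continuous_fderiv one_ne_zero).clm_apply hY.continuous
  have hDc : HasCompactSupport (fun x => fderiv ℝ f x (Y x)) :=
    (hfc.fderiv (𝕜 := ℝ)).mono' (subset_tsupport _ |>.trans' fun x hx => by
      contrapose! hx
      simp only [Function.mem_support, not_not] at hx ⊢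
      simp [hx])
  exact (hD.integrable_of_hasCompactSupport hDc).add
    ((hf.continuous.mul (continuous_euclideanDiv hY)).integrable_of_hasCompactSupport
      hfc.mul_right)

/-- The divergence theorem for the compactly supported field `f Y`. -/
theorem integral_fderiv_add_mul_div {f : EuclideanSpace ℝ (Fin m) → ℝ} (hf : ContDiff ℝ 1 f)
    (hfc : HasCompactSupport f) {Y : EuclideanSpace ℝ (Fin m) → EuclideanSpace ℝ (Fin m)}
    (hY : ContDiff ℝ 1 Y) :
    ∫ x, (fderiv ℝ f x (Y x) + f x * euclideanDiv Y x) = 0 := by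
  have hYj : ∀ j, ContDiff ℝ 1 (fun x => Y x j) := fun j => by fun_prop
  have hdY : ∀ x j v, fderiv ℝ (fun x => Y x j) x v = fderiv ℝ Y x v j := by
    intro x j v
    have h1 : HasFDerivAt Y (fderiv ℝ Y x) x := (hY.differentiable one_ne_zero x).hasFDerivAt
    have h2 := ((EuclideanSpace.proj j : EuclideanSpace ℝ (Fin m) →L[ℝ] ℝ).hasFDerivAt).comp x h1
    have h3 : fderiv ℝ (fun x => Y x j) x = _ := h2.fderiv
    rw [h3]
    rfl
  have key : ∀ x, fderiv ℝ f x (Y x) + f x * euclideanDiv Y x =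
      ∑ j, fderiv ℝ (fun x => f x * Y x j) x (EuclideanSpace.single j 1) := by
    intro x
    have e1 : ∀ j, fderiv ℝ (fun x => f x * Y x j) x (EuclideanSpace.single j 1) =
        f x * fderiv ℝ Y x (EuclideanSpace.single j 1) j
          + Y x j * fderiv ℝ f x (EuclideanSpace.single j 1) := by
      intro j
      rw [fderiv_fun_mul (hf.differentiable one_ne_zero x) ((hYj j).differentiable one_ne_zero x)]
      simp [hdY]
    simp only [e1, Finset.sum_add_distrib, ← Finset.mul_sum]
    rw [add_comm, euclideanDiv]
    congr 1
    conv_lhs => rw [← sum_coord_smul_single (Y x)]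
    simp
  simp only [key]
  rw [integral_finsetSum]
  · exact Finset.sum_eq_zero fun j _ => integral_fderiv_apply_eq_zero (hf.mul (hYj j))
      hfc.mul_right _
  · intro j _
    have hc : ContDiff ℝ 1 (fun x => f x * Y x j) := hf.mul (hYj j)
    exact ((hc.continuous_fderiv one_ne_zero).clm_apply
      continuous_const).integrable_of_hasCompactSupport
      ((HasCompactSupport.mul_right hfc).fderiv_apply (𝕜 := ℝ) _)

/-- A Caccioppoli estimate: the inequality `|β|² ≤ -t div β` (up to terms of order zero) forces
`β` to be of size `t` in `L²`. -/
theorem exists_integral_sq_le {ι : Type*} [Fintype ι] {χ : EuclideanSpace ℝ (Fin m) → ℝ}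
    (hχ : ContDiff ℝ 1 χ) (hχc : HasCompactSupport χ)
    {Y : ι → EuclideanSpace ℝ (Fin m) → EuclideanSpace ℝ (Fin m)} (hY : ∀ a, ContDiff ℝ 1 (Y a))
    {c : ι → EuclideanSpace ℝ (Fin m) → ℝ} (hc : ∀ a, Continuous (c a)) :
    ∃ C : ℝ, ∀ (β : EuclideanSpace ℝ (Fin m) → EuclideanSpace ℝ (Fin m) →L[ℝ] ℝ) (t : ℝ),
      ContDiff ℝ 1 β → 0 < t →
      (∀ x, χ x ≠ 0 → ∑ a, β x (Y a x) ^ 2 ≤ -t * ∑ a,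
        (fderiv ℝ (fun z => β z (Y a z)) x (Y a x) + c a x * β x (Y a x))) →
      ∫ x, χ x ^ 2 * ∑ a, β x (Y a x) ^ 2 ≤ C * t ^ 2 := by
  -- `χ κ_a β(Y_a)` is what remains of `χ² (Y_a (β(Y_a)) + c_a β(Y_a))` apart from the divergence
  -- of `χ² β(Y_a) Y_a`, up to sign
  set κ : ι → EuclideanSpace ℝ (Fin m) → ℝ := fun a x =>
    2 * fderiv ℝ χ x (Y a x) + χ x * euclideanDiv (Y a) x - χ x * c a x with hκ
  have hDχ := hχ.continuous_fderiv one_ne_zero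
  have hκc : ∀ a, Continuous (κ a) := fun a => by
    have h1 := (hY a).continuous
    have h2 := continuous_euclideanDiv (hY a)
    have h3 := hχ.continuous
    have h4 := hc a
    fun_prop
  have hκs : ∀ a, HasCompactSupport (κ a) := fun a => by
    have h1 : HasCompactSupport (fun x => 2 * fderiv ℝ χ x (Y a x)) :=
      (hχc.fderiv (𝕜 := ℝ)).mono' (subset_tsupport _ |>.trans' fun x hx => by
        contrapose! hx
        simp only [Function.mem_support, not_not] at hx ⊢
        simp [hx])
    exact (h1.add hχc.mul_right).sub hχc.mul_right
  have hκi : Integrable (fun x => ∑ a, κ a x ^ 2) := by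
    refine integrable_finsetSum _ fun a _ => ?_
    exact ((hκc a).pow 2).integrable_of_hasCompactSupport
      (hκs a).sq
  refine ⟨∫ x, ∑ a, κ a x ^ 2, fun β t hβ ht h => ?_⟩
  have hq : ∀ a, ContDiff ℝ 1 (fun x => β x (Y a x)) := fun a => hβ.clm_apply (hY a)
  have hf : ∀ a, ContDiff ℝ 1 (fun x => χ x ^ 2 * β x (Y a x)) := fun a => (hχ.pow 2).mul (hq a)
  have hχ2 : HasCompactSupport (fun x => χ x ^ 2) :=
    hχc.sq
  have hfc : ∀ a, HasCompactSupport (fun x => χ x ^ 2 * β x (Y a x)) := fun a => hχ2.mul_right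
  have hdf : ∀ a x, fderiv ℝ (fun x => χ x ^ 2 * β x (Y a x)) x (Y a x) =
      χ x ^ 2 * fderiv ℝ (fun x => β x (Y a x)) x (Y a x)
        + β x (Y a x) * (2 * χ x * fderiv ℝ χ x (Y a x)) := by
    intro a x
    have hχx := hχ.differentiable one_ne_zero x
    have hχx2 : DifferentiableAt ℝ (fun x => χ x ^ 2) x := hχx.pow 2
    rw [fderiv_fun_mul hχx2 ((hq a).differentiable one_ne_zero x), fderiv_fun_pow 2 hχx]
    simp [nsmul_eq_mul]
  -- half of the left-hand side absorbs the terms in `κ`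
  have hpt : ∀ x, (1 / 2) * (χ x ^ 2 * ∑ a, β x (Y a x) ^ 2) ≤
      -t * ∑ a, (fderiv ℝ (fun x => χ x ^ 2 * β x (Y a x)) x (Y a x)
        + χ x ^ 2 * β x (Y a x) * euclideanDiv (Y a) x) + t ^ 2 / 2 * ∑ a, κ a x ^ 2 := by
    intro x
    have h1 : χ x ^ 2 * ∑ a, β x (Y a x) ^ 2 ≤ χ x ^ 2 * (-t * ∑ a,
        (fderiv ℝ (fun z => β z (Y a z)) x (Y a x) + c a x * β x (Y a x))) := by
      by_cases h0 : χ x = 0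
      · simp [h0]
      · exact mul_le_mul_of_nonneg_left (h x h0) (sq_nonneg _)
    have h2 : χ x ^ 2 * (-t * ∑ a,
        (fderiv ℝ (fun z => β z (Y a z)) x (Y a x) + c a x * β x (Y a x))) =
        -t * ∑ a, (fderiv ℝ (fun x => χ x ^ 2 * β x (Y a x)) x (Y a x)
        + χ x ^ 2 * β x (Y a x) * euclideanDiv (Y a) x)
        + ∑ a, (χ x * β x (Y a x)) * (t * κ a x) := by
      simp only [Finset.mul_sum, ← Finset.sum_add_distrib]
      refine Finset.sum_congr rfl fun a _ => ?_
      rw [hdf, hκ]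
      ring
    have h3 : ∑ a, (χ x * β x (Y a x)) * (t * κ a x) ≤
        (1 / 2) * (χ x ^ 2 * ∑ a, β x (Y a x) ^ 2) + t ^ 2 / 2 * ∑ a, κ a x ^ 2 := by
      simp only [Finset.mul_sum, ← Finset.sum_add_distrib]
      refine Finset.sum_le_sum fun a _ => ?_
      nlinarith [sq_nonneg (χ x * β x (Y a x) - t * κ a x)]
    linarith
  have hI : ∀ a, Integrable (fun x => fderiv ℝ (fun x => χ x ^ 2 * β x (Y a x)) x (Y a x)
        + χ x ^ 2 * β x (Y a x) * euclideanDiv (Y a) x) :=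
    fun a => integrable_fderiv_add_mul_div (hf a) (hfc a) (hY a)
  have hL : Integrable (fun x => χ x ^ 2 * ∑ a, β x (Y a x) ^ 2) := by
    refine Continuous.integrable_of_hasCompactSupport ?_ hχ2.mul_right
    have h1 := hχ.continuous
    have h2 := fun a => (hq a).continuous
    fun_prop
  have hmono := integral_mono (hL.const_mul (1 / 2))
    (((integrable_finsetSum Finset.univ fun a _ => hI a).const_mul (-t)).add
      (hκi.const_mul (t ^ 2 / 2))) hpt
  rw [integral_const_mul] at hmono
  simp only [Pi.add_apply] at hmono
  rw [integral_add ((integrable_finsetSum Finset.univ fun a _ => hI a).const_mul (-t))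
    (hκi.const_mul (t ^ 2 / 2)), integral_const_mul, integral_const_mul,
    integral_finsetSum _ fun a _ => hI a] at hmono
  simp only [integral_fderiv_add_mul_div (hf _) (hfc _) (hY _), Finset.sum_const_zero] at hmono
  nlinarith

end Caccioppoli

/-! ### Integrals over almost every segment -/

section Segments

variable {E : Type*} [NormedAddCommGroup E] [NormedSpace ℝ E] [FiniteDimensional ℝ E]
  [MeasurableSpace E] [BorelSpace E] (μ : Measure E) [μ.IsAddHaarMeasure]

theorem lintegral_comp_smul_add {S : E → ℝ≥0∞} (hS : Measurable S) {c : ℝ} (hc : c ≠ 0) (w : E) :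
    ∫⁻ b, S (c • b + w) ∂μ =
      ENNReal.ofReal |(c ^ Module.finrank ℝ E)⁻¹| * ∫⁻ b, S b ∂μ := by
  have h := lintegral_map (μ := μ) (f := fun z => S (z + w)) (g := fun b : E => c • b)
    (by fun_prop) (by fun_prop)
  rw [Measure.map_addHaar_smul μ hc, lintegral_smul_measure, lintegral_add_right_eq_self] at h
  exact h.symm

/-- Points on segments are distributed with bounded density, as long as they keep away from the
endpoint that is held fixed. -/
theorem setLIntegral_segment_le {S : E → ℝ≥0∞} (hS : Measurable S) (x₀ : E) (r : ℝ) {a : E}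
    (ha : a ∈ Metric.ball x₀ r) {c : ℝ} (hc : 1 / 2 ≤ c) (hc1 : c ≤ 1) :
    ∫⁻ b in Metric.ball x₀ r, S (c • b + (1 - c) • a) ∂μ ≤
      ENNReal.ofReal (2 ^ Module.finrank ℝ E) * ∫⁻ b in Metric.ball x₀ r, S b ∂μ := by
  have hB : MeasurableSet (Metric.ball x₀ r) := measurableSet_ball
  have hc0 : 0 < c := by linarith
  calc ∫⁻ b in Metric.ball x₀ r, S (c • b + (1 - c) • a) ∂μ
      ≤ ∫⁻ b in Metric.ball x₀ r, (Metric.ball x₀ r).indicator S (c • b + (1 - c) • a) ∂μ := by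
        refine setLIntegral_mono' hB fun b hb => ?_
        rw [indicator_of_mem]
        exact (convex_ball x₀ r) hb ha hc0.le (by linarith) (by ring)
    _ ≤ ∫⁻ b, (Metric.ball x₀ r).indicator S (c • b + (1 - c) • a) ∂μ :=
        setLIntegral_le_lintegral _ _
    _ = ENNReal.ofReal |(c ^ Module.finrank ℝ E)⁻¹| * ∫⁻ b, (Metric.ball x₀ r).indicator S b ∂μ :=
        lintegral_comp_smul_add μ (hS.indicator hB) hc0.ne' _
    _ ≤ _ := by
        rw [lintegral_indicator hB]
        gcongr
        rw [abs_of_pos (by positivity), ← inv_pow]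
        gcongr
        rw [inv_le_comm₀ hc0 two_pos]
        linarith

/-- An integrable function is integrable on almost every segment. -/
theorem ae_lintegral_segment_lt_top {S : E → ℝ≥0∞} (hS : Measurable S) (x₀ : E) (r : ℝ)
    (hfin : ∫⁻ b in Metric.ball x₀ r, S b ∂μ ≠ ⊤) :
    ∀ᵐ a ∂(μ.restrict (Metric.ball x₀ r)), ∀ᵐ b ∂(μ.restrict (Metric.ball x₀ r)),
      ∫⁻ s in Icc (0 : ℝ) 1, S (b + s • (a - b)) < ⊤ := by
  set B := Metric.ball x₀ r
  set ν := μ.restrict B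
  have hνB : ν univ < ⊤ := by
    rw [Measure.restrict_apply_univ]
    exact measure_ball_lt_top
  have : IsFiniteMeasure ν := ⟨hνB⟩
  have hm : Measurable (fun p : (E × E) × ℝ => S (p.1.2 + p.2 • (p.1.1 - p.1.2))) := by
    fun_prop
  set K := ENNReal.ofReal (2 ^ Module.finrank ℝ E) * ∫⁻ b in B, S b ∂μ with hK
  have hKfin : K < ⊤ := ENNReal.mul_lt_top ENNReal.ofReal_lt_top hfin.lt_top
  have hslice : ∀ s ∈ Icc (0 : ℝ) 1,
      ∫⁻ a, ∫⁻ b, S (b + s • (a - b)) ∂ν ∂ν ≤ K * ν univ := by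
    intro s hs
    have hm2 : Measurable (fun p : E × E => S (p.2 + s • (p.1 - p.2))) := by fun_prop
    have hB : ∀ᵐ a ∂ν, a ∈ B := ae_restrict_mem measurableSet_ball
    rcases le_total s (1 / 2) with h | h
    -- the endpoint farther from the point is held fixed: `a` here, and `b` for `s ≥ 1 / 2`
    · rw [← lintegral_const]
      refine lintegral_mono_ae (hB.mono fun a ha => ?_)
      have h1 := setLIntegral_segment_le μ hS x₀ r ha (c := 1 - s) (by linarith)
        (by linarith [hs.1])
      refine le_trans (le_of_eq ?_) h1
      refine lintegral_congr fun b => ?_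
      congr 1
      module
    · rw [lintegral_lintegral_swap hm2.aemeasurable, ← lintegral_const]
      refine lintegral_mono_ae (hB.mono fun b hb => ?_)
      have h1 := setLIntegral_segment_le μ hS x₀ r hb (c := s) (by linarith) hs.2
      refine le_trans (le_of_eq ?_) h1
      refine lintegral_congr fun a => ?_
      congr 1
      module
  have hma : Measurable (fun p : E × E => ∫⁻ s in Icc (0 : ℝ) 1, S (p.2 + s • (p.1 - p.2))) :=
    hm.lintegral_prod_right'
  have htot : ∫⁻ a, ∫⁻ b, ∫⁻ s in Icc (0 : ℝ) 1, S (b + s • (a - b)) ∂volume ∂ν ∂ν < ⊤ := by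
    have e1 : ∫⁻ a, ∫⁻ b, ∫⁻ s in Icc (0 : ℝ) 1, S (b + s • (a - b)) ∂volume ∂ν ∂ν =
        ∫⁻ s in Icc (0 : ℝ) 1, ∫⁻ p, S (p.2 + s • (p.1 - p.2)) ∂(ν.prod ν) := by
      rw [← lintegral_lintegral_swap (f := fun (p : E × E) (s : ℝ) => S (p.2 + s • (p.1 - p.2)))
        hm.aemeasurable, lintegral_prod _ hma.aemeasurable]
    rw [e1]
    refine lt_of_le_of_lt (setLIntegral_mono' measurableSet_Icc (g := fun _ => K * ν univ)
      fun s hs => ?_) ?_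
    · have hm2 : Measurable (fun p : E × E => S (p.2 + s • (p.1 - p.2))) := by fun_prop
      rw [lintegral_prod _ hm2.aemeasurable]
      exact hslice s hs
    · simpa using ENNReal.mul_lt_top hKfin hνB
  have h1 := ae_lt_top (hma.lintegral_prod_right') htot.ne
  refine h1.mono fun a ha => ?_
  exact ae_lt_top (hma.comp measurable_prodMk_left) ha.ne

end Segments

/-! ### Primitives of limits of exact forms -/

section Primitive

variable {E : Type*} [NormedAddCommGroup E] [NormedSpace ℝ E]

theorem continuous_curveIntegral_segment {B : E → E →L[ℝ] ℝ} (hB : Continuous B) :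
    Continuous (fun p : E × E => ∫ᶜ x in .segment p.1 p.2, B x) := by
  simp only [curveIntegral_segment, AffineMap.lineMap_apply_module]
  apply intervalIntegral.continuous_parametric_intervalIntegral_of_continuous'
  fun_prop

/-- The fundamental theorem of calculus on the segment from `b` to `a`, applied to `B + Du`. -/
theorem enorm_sub_add_curveIntegral_segment_le {B : E → E →L[ℝ] ℝ} (hB : Continuous B)
    {u : E → ℝ} (hu : ContDiff ℝ 1 u) (a b : E) :
    ‖u a - u b + ∫ᶜ x in .segment b a, B x‖ₑ ≤
      ‖a - b‖ₑ * ∫⁻ s in Icc (0 : ℝ) 1, ‖B (b + s • (a - b)) + fderiv ℝ u (b + s • (a - b))‖ₑ := by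
  have hline : ∀ s : ℝ, AffineMap.lineMap b a s = b + s • (a - b) := fun s => by
    rw [AffineMap.lineMap_apply_module', add_comm]
  have hDu := hu.continuous_fderiv one_ne_zero
  have hFTC : ∫ s in (0 : ℝ)..1, fderiv ℝ u (b + s • (a - b)) (a - b) = u a - u b := by
    have hd : ∀ s ∈ uIcc (0 : ℝ) 1, HasDerivAt (fun s : ℝ => u (b + s • (a - b)))
        (fderiv ℝ u (b + s • (a - b)) (a - b)) s := by
      intro s _
      have h1 : HasDerivAt (fun s : ℝ => b + s • (a - b)) (a - b) s := by
        simpa using ((hasDerivAt_id s).smul_const (a - b)).const_add b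
      exact (hu.differentiable one_ne_zero _).hasFDerivAt.comp_hasDerivAt s h1
    rw [intervalIntegral.integral_eq_sub_of_hasDerivAt hd]
    · simp
    · apply Continuous.intervalIntegrable
      fun_prop
  rw [curveIntegral_segment, ← hFTC, ← intervalIntegral.integral_add
    (Continuous.intervalIntegrable (by fun_prop) _ _)
    (Continuous.intervalIntegrable (by simp only [hline]; fun_prop) _ _),
    intervalIntegral.integral_of_le zero_le_one]
  refine (enorm_integral_le_lintegral_enorm _).trans ?_
  have hm : Continuous fun s : ℝ => B (b + s • (a - b)) + fderiv ℝ u (b + s • (a - b)) := by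
    fun_prop
  rw [mul_comm, ← lintegral_mul_const _ hm.enorm.measurable]
  refine (lintegral_mono fun s => ?_).trans (lintegral_mono_set Ioc_subset_Icc_self)
  rw [hline, add_comm, ← add_apply]
  exact ContinuousLinearMap.le_opENorm _ _

variable [FiniteDimensional ℝ E] [MeasurableSpace E] [BorelSpace E] (μ : Measure E)
  [μ.IsAddHaarMeasure]

/-- If `B + Du_k` tends to zero in `L¹` of a ball, and fast enough, then `B` is exact on the ball,
and `-u_k` converges almost everywhere to a primitive of `B`, up to additive constants. -/
theorem exists_primitive_of_tsum_lintegral_ne_top {B : E → E →L[ℝ] ℝ} (hB : Continuous B)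
    {u : ℕ → E → ℝ} (hu : ∀ k, ContDiff ℝ 1 (u k)) (x₀ : E) {r : ℝ} (hr : 0 < r)
    (hfin : ∑' k, ∫⁻ x in Metric.ball x₀ r, ‖B x + fderiv ℝ (u k) x‖ₑ ∂μ ≠ ⊤) :
    ∃ b₀ ∈ Metric.ball x₀ r, ∃ g : E → ℝ,
      (∀ a ∈ Metric.ball x₀ r, HasFDerivAt g (B a) a) ∧
      ∀ᵐ a ∂(μ.restrict (Metric.ball x₀ r)),
        Tendsto (fun k => u k a - u k b₀) atTop (𝓝 (-(g a - g b₀))) := by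
  -- `I b a` is the integral of `B` over the segment from `b` to `a`
  set U := Metric.ball x₀ r with hU
  have hUo : IsOpen U := Metric.isOpen_ball
  set I : E → E → ℝ := fun b a => ∫ᶜ x in .segment b a, B x with hI
  have hIc : Continuous (fun p : E × E => I p.1 p.2) := continuous_curveIntegral_segment hB
  have hDu := fun k => (hu k).continuous_fderiv one_ne_zero
  have hSk : ∀ k, Measurable (fun x => ‖B x + fderiv ℝ (u k) x‖ₑ) := fun k => by
    have := hDu k
    exact (by fun_prop : Continuous fun x => B x + fderiv ℝ (u k) x).enorm.measurable
  rw [← lintegral_tsum fun k => (hSk k).aemeasurable] at hfin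
  have hae := ae_lintegral_segment_lt_top μ (Measurable.tsum hSk) x₀ r hfin
  have hconv : ∀ᵐ a ∂(μ.restrict U), ∀ᵐ b ∂(μ.restrict U),
      Tendsto (fun k => u k a - u k b) atTop (𝓝 (-I b a)) := by
    refine hae.mono fun a ha => ha.mono fun b hb => ?_
    have hmb : Measurable fun s : ℝ => b + s • (a - b) := by fun_prop
    have hmk : ∀ k, Measurable fun s : ℝ =>
        ‖B (b + s • (a - b)) + fderiv ℝ (u k) (b + s • (a - b))‖ₑ := fun k => (hSk k).comp hmb
    rw [lintegral_tsum fun k => (hmk k).aemeasurable] at hb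
    have h0 := ENNReal.tendsto_atTop_zero_of_tsum_ne_top hb.ne
    have h1 : Tendsto (fun k => ‖a - b‖ₑ * ∫⁻ s in Icc (0 : ℝ) 1,
        ‖B (b + s • (a - b)) + fderiv ℝ (u k) (b + s • (a - b))‖ₑ) atTop (𝓝 0) := by
      simpa using ENNReal.Tendsto.const_mul h0 (Or.inr enorm_ne_top)
    have h2 : Tendsto (fun k => u k a - u k b + I b a) atTop (𝓝 0) := by
      rw [tendsto_zero_iff_enorm_tendsto_zero]
      exact tendsto_of_tendsto_of_tendsto_of_le_of_le tendsto_const_nhds h1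
        (fun _ => zero_le) fun k => enorm_sub_add_curveIntegral_segment_le hB (hu k) a b
    simpa using h2.sub_const (I b a)
  have hne : (ae (μ.restrict U)).NeBot := by
    rw [ae_neBot, Ne, Measure.restrict_eq_zero]
    exact (hUo.measure_pos μ ⟨x₀, Metric.mem_ball_self hr⟩).ne'
  obtain ⟨a₀, ha₀, ha₀U⟩ := (hconv.and (ae_restrict_mem hUo.measurableSet)).exists
  -- the segment integrals are additive almost everywhere, as limits of coboundaries, hence
  -- everywhere by continuity
  have hadd : ∀ a ∈ U, ∀ b ∈ U, I b a₀ - I a a₀ = I b a := by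
    have h1 : ∀ᵐ a ∂(μ.restrict U), ∀ b ∈ U, I b a₀ - I a a₀ = I b a := by
      filter_upwards [hconv, ha₀] with a ha ha'
      have h2 : (fun b => I b a₀ - I a a₀) =ᵐ[μ.restrict U] fun b => I b a := by
        filter_upwards [ha, ha₀] with b hb hb'
        have h3 := hb'.sub ha'
        have h4 := tendsto_nhds_unique (hb.congr fun k => by ring) h3
        linarith
      exact Measure.eqOn_open_of_ae_eq h2 hUo (by fun_prop) (by fun_prop)
    intro a ha b hb
    have h2 : (fun a => I b a₀ - I a a₀) =ᵐ[μ.restrict U] fun a => I b a :=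
      h1.mono fun a ha => ha b hb
    exact Measure.eqOn_open_of_ae_eq h2 hUo (by fun_prop) (by fun_prop) ha
  have hself : ∀ b ∈ U, I b b = 0 := fun b hb => by rw [← hadd b hb b hb, sub_self]
  refine ⟨a₀, ha₀U, fun a => -I a a₀, fun a ha => ?_, ?_⟩
  · have h1 : HasFDerivAt (fun z => I a z) (B a) a := HasFDerivAt.curveIntegral_segment_source hB
    refine (h1.const_add (-I a a₀)).congr_of_eventuallyEq ?_
    filter_upwards [hUo.mem_nhds ha] with z hz
    rw [← hadd z hz a ha]
    ring
  · refine ha₀.mono fun a ha => ?_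
    have h1 := ha.neg
    simpa [hself a₀ ha₀U] using h1

end Primitive

/-! ### The inequality for one-forms on Euclidean space -/

section Flat

variable {m : ℕ}

/-- A function that is smooth near a closed ball agrees on the ball of half the radius with a
function that is smooth on the whole space. -/
theorem exists_contDiff_eqOn_ball {E F : Type*} [NormedAddCommGroup E] [InnerProductSpace ℝ E]
    [FiniteDimensional ℝ E] [NormedAddCommGroup F] [NormedSpace ℝ F] {O : Set E} (hO : IsOpen O)
    {x₀ : E} {r : ℝ} (hr : 0 < r) (hrO : Metric.closedBall x₀ (2 * r) ⊆ O) {f : E → F}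
    (hf : ContDiffOn ℝ ∞ f O) :
    ∃ f' : E → F, ContDiff ℝ ∞ f' ∧ EqOn f' f (Metric.ball x₀ r) := by
  let φ : ContDiffBump x₀ := ⟨r, 2 * r, hr, by linarith⟩
  refine ⟨fun x => φ x • f x, ?_, fun x hx => ?_⟩
  · rw [contDiff_iff_contDiffAt]
    intro x
    by_cases hx : x ∈ O
    · exact φ.contDiff.contDiffAt.smul (hf.contDiffAt (hO.mem_nhds hx))
    · have h1 : x ∉ tsupport φ := fun h => hx (hrO (by rwa [φ.tsupport_eq] at h))
      refine (contDiffAt_const (c := (0 : F))).congr_of_eventuallyEq ?_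
      filter_upwards [(isClosed_tsupport φ).isOpen_compl.mem_nhds h1] with y hy
      rw [image_eq_zero_of_notMem_tsupport hy, zero_smul]
  · have h1 : φ x = 1 := φ.one_of_mem_closedBall (Metric.ball_subset_closedBall hx)
    simp [h1]

/-- The inequality `|β(Z)|² ≤ 2t Re ∂bar β_{1,0}(Z, conj Z)` at the point `y`, in real terms: here
`Z = v - i J v` for constant vectors `v`, and `[v, J v] = D(J v) v`. -/
def DbarIneqAt {E : Type*} [NormedAddCommGroup E] [NormedSpace ℝ E] (J : E → E →L[ℝ] E)
    (β : E → E →L[ℝ] ℝ) (t : ℝ) (y : E) : Prop :=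
  ∀ v : E, β y v ^ 2 + β y (J y v) ^ 2 ≤ -t * (fderiv ℝ (fun z => β z v) y v
    + fderiv ℝ (fun z => β z (J z v)) y (J y v) + β y (J y (fderiv ℝ (fun z => J z v) y v)))

theorem DbarIneqAt.congr {E : Type*} [NormedAddCommGroup E] [NormedSpace ℝ E]
    {J J' : E → E →L[ℝ] E} {β β' : E → E →L[ℝ] ℝ} {t : ℝ} {y : E} (h : DbarIneqAt J β t y)
    (hJ : J' =ᶠ[𝓝 y] J) (hβ : β' =ᶠ[𝓝 y] β) : DbarIneqAt J' β' t y := by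
  intro v
  have e1 : (fun z => β' z v) =ᶠ[𝓝 y] fun z => β z v := hβ.mono fun z hz => by
    simp only [hz]
  have e2 : (fun z => β' z (J' z v)) =ᶠ[𝓝 y] fun z => β z (J z v) := by
    filter_upwards [hβ, hJ] with z hz hz'
    simp only [hz, hz']
  have e3 : (fun z => J' z v) =ᶠ[𝓝 y] fun z => J z v := hJ.mono fun z hz => by
    simp only [hz]
  rw [e1.fderiv_eq, e2.fderiv_eq, e3.fderiv_eq, hJ.self_of_nhds, hβ.self_of_nhds]
  exact h v

theorem norm_le_sum_abs_single (β : EuclideanSpace ℝ (Fin m) →L[ℝ] ℝ) :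
    ‖β‖ ≤ ∑ i, |β (EuclideanSpace.single i 1)| := by
  refine β.opNorm_le_bound (Finset.sum_nonneg fun i _ => abs_nonneg _) fun v => ?_
  conv_lhs => rw [← sum_coord_smul_single v]
  rw [map_sum, Finset.sum_mul]
  refine (norm_sum_le _ _).trans (Finset.sum_le_sum fun i _ => ?_)
  rw [map_smul, norm_smul, mul_comm, Real.norm_eq_abs]
  gcongr
  exact PiLp.norm_apply_le v i

/-- The Caccioppoli estimate for `DbarIneqAt`, in `L¹`. -/
theorem exists_lintegral_enorm_le {J : EuclideanSpace ℝ (Fin m) →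
      EuclideanSpace ℝ (Fin m) →L[ℝ] EuclideanSpace ℝ (Fin m)} (hJ : ContDiff ℝ ∞ J)
    (x₀ : EuclideanSpace ℝ (Fin m)) {r : ℝ} (hr : 0 < r) :
    ∃ C : ℝ, ∀ (β : EuclideanSpace ℝ (Fin m) → EuclideanSpace ℝ (Fin m) →L[ℝ] ℝ) (t : ℝ),
      ContDiff ℝ 1 β → 0 < t → (∀ x ∈ Metric.ball x₀ (2 * r), DbarIneqAt J β t x) →
      ∫⁻ x in Metric.ball x₀ r, ‖β x‖ₑ ≤ ENNReal.ofReal (C * t) := by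
  let χ : ContDiffBump x₀ := ⟨r, 2 * r, hr, by linarith⟩
  -- summing the inequality over the coordinate vectors `e_i` gives the situation of
  -- `exists_integral_sq_le` for the fields `e_i` and `J e_i`
  set e : Fin m → EuclideanSpace ℝ (Fin m) := fun i => EuclideanSpace.single i 1 with he
  set Y : Fin m ⊕ Fin m → EuclideanSpace ℝ (Fin m) → EuclideanSpace ℝ (Fin m) :=
    Sum.elim (fun i _ => e i) (fun i x => J x (e i)) with hYdef
  have hJe : ∀ v, ContDiff ℝ ∞ (fun x => J x v) := fun v => hJ.clm_apply contDiff_const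
  have hY : ∀ a, ContDiff ℝ 1 (Y a) := by
    rintro (i | i)
    · exact contDiff_const
    · exact (hJe (e i)).of_le (by simp)
  set W : EuclideanSpace ℝ (Fin m) → EuclideanSpace ℝ (Fin m) := fun x =>
    ∑ i, J x (fderiv ℝ (fun z => J z (e i)) x (e i)) with hW
  have hWc : Continuous W := by
    refine continuous_finsetSum _ fun i _ => hJ.continuous.clm_apply ?_
    exact ((hJe (e i)).continuous_fderiv (by simp)).clm_apply continuous_const
  set c : Fin m ⊕ Fin m → EuclideanSpace ℝ (Fin m) → ℝ :=
    Sum.elim (fun j x => W x j) (fun _ _ => 0) with hcdef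
  have hc : ∀ a, Continuous (c a) := by
    rintro (j | j)
    · exact (EuclideanSpace.proj j : EuclideanSpace ℝ (Fin m) →L[ℝ] ℝ).continuous.comp hWc
    · exact continuous_const
  obtain ⟨C, hC⟩ := exists_integral_sq_le (χ.contDiff (n := 1)) χ.hasCompactSupport hY hc
  refine ⟨(C + m * volume.real (Metric.ball x₀ r)) / 2, fun β t hβ ht h => ?_⟩
  have hβW : ∀ x, β x (W x) = ∑ j, W x j * β x (e j) := by
    intro x
    conv_lhs => rw [← sum_coord_smul_single (W x)]
    simp [he]
  have hineq : ∫ x, χ x ^ 2 * ∑ a, β x (Y a x) ^ 2 ≤ C * t ^ 2 := by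
    refine hC β t hβ ht fun x hx => ?_
    have hx' : x ∈ Metric.ball x₀ (2 * r) := by
      have : x ∈ Function.support χ := hx
      rwa [χ.support_eq] at this
    have h1 := Finset.sum_le_sum (s := Finset.univ) fun i _ => h x hx' (e i)
    rw [← Finset.mul_sum] at h1
    simp only [Finset.sum_add_distrib] at h1
    have h2 : ∑ i, β x (J x (fderiv ℝ (fun z => J z (e i)) x (e i))) = ∑ j, W x j * β x (e j) := by
      rw [← hβW, hW, map_sum]
    simp only [Fintype.sum_sum_type, hYdef, hcdef, Sum.elim_inl, Sum.elim_inr,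
      Finset.sum_add_distrib]
    rw [h2] at h1
    refine h1.trans (le_of_eq ?_)
    simp only [zero_mul, Finset.sum_const_zero]
    ring
  have hβYc : ∀ a, Continuous (fun x => β x (Y a x)) := fun a =>
    hβ.continuous.clm_apply (hY a).continuous
  set G : EuclideanSpace ℝ (Fin m) → ℝ := fun x => χ x ^ 2 * ∑ a, β x (Y a x) ^ 2 with hG
  have hGc : Continuous G := by
    have h1 := χ.continuous
    fun_prop
  have hG0 : ∀ x, 0 ≤ G x := fun x =>
    mul_nonneg (sq_nonneg _) (Finset.sum_nonneg fun a _ => sq_nonneg _)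
  have hGi : Integrable G := hGc.integrable_of_hasCompactSupport χ.hasCompactSupport.sq.mul_right
  have hpt : ∀ x ∈ Metric.ball x₀ r, ‖β x‖ ≤ G x / (2 * t) + m * t / 2 := by
    intro x hx
    have h1 : χ x = 1 := χ.one_of_mem_closedBall (Metric.ball_subset_closedBall hx)
    have h2 : ∑ i, β x (e i) ^ 2 ≤ G x := by
      simp only [hG, h1, one_pow, one_mul, Fintype.sum_sum_type, hYdef, Sum.elim_inl, Sum.elim_inr]
      exact le_add_of_nonneg_right (Finset.sum_nonneg fun a _ => sq_nonneg _)
    -- the weights `1 / t` and `t` turn the bound `C t²` in `L²` into a bound of order `t` in `L¹`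
    have h3 : ∑ i, |β x (e i)| ≤ ∑ i, (β x (e i) ^ 2 / (2 * t) + t / 2) := by
      refine Finset.sum_le_sum fun i _ => ?_
      rw [← sq_abs, ← sub_nonneg]
      have : |β x (e i)| ^ 2 / (2 * t) + t / 2 - |β x (e i)| =
          (|β x (e i)| - t) ^ 2 / (2 * t) := by
        field_simp
        ring
      rw [this]
      positivity
    rw [Finset.sum_add_distrib, ← Finset.sum_div] at h3
    calc ‖β x‖ ≤ ∑ i, |β x (e i)| := norm_le_sum_abs_single _
      _ ≤ (∑ i, β x (e i) ^ 2) / (2 * t) + ∑ _i : Fin m, t / 2 := h3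
      _ ≤ G x / (2 * t) + m * t / 2 := by
        rw [Finset.sum_const, Finset.card_univ, Fintype.card_fin, nsmul_eq_mul]
        have h4 := div_le_div_of_nonneg_right h2 (by positivity : 0 ≤ 2 * t)
        linarith
  have hfin : volume (Metric.ball x₀ r) ≠ ⊤ := measure_ball_lt_top.ne
  have hβi : IntegrableOn β (Metric.ball x₀ r) :=
    (hβ.continuous.continuousOn.integrableOn_compact (isCompact_closedBall x₀ r)).mono_set
      Metric.ball_subset_closedBall
  rw [← ofReal_integral_norm_eq_lintegral_enorm hβi]
  refine ENNReal.ofReal_le_ofReal ?_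
  calc ∫ x in Metric.ball x₀ r, ‖β x‖ ≤ ∫ x in Metric.ball x₀ r, (G x / (2 * t) + m * t / 2) :=
        setIntegral_mono_on hβi.norm ((hGi.integrableOn.div_const _).add
          (integrableOn_const hfin)) measurableSet_ball hpt
    _ = (∫ x in Metric.ball x₀ r, G x) / (2 * t)
          + volume.real (Metric.ball x₀ r) * (m * t / 2) := by
        rw [integral_add (hGi.integrableOn.div_const _) (integrableOn_const hfin),
          integral_div, setIntegral_const, smul_eq_mul]
    _ ≤ (C * t ^ 2) / (2 * t) + volume.real (Metric.ball x₀ r) * (m * t / 2) := by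
        gcongr
        exact (setIntegral_le_integral hGi (ae_of_all _ hG0)).trans hineq
    _ = _ := by
        field_simp

/-- The flat case of the main analytic result: if `B + Du_k` satisfies `DbarIneqAt` with rapidly
decreasing constants `t_k`, then `B` is locally exact, and the `-u_k` converge almost everywhere
to a local primitive, up to additive constants. -/
theorem exists_primitive_of_dbarIneqAt {O : Set (EuclideanSpace ℝ (Fin m))} (hO : IsOpen O)
    {x₀ : EuclideanSpace ℝ (Fin m)} (hx₀ : x₀ ∈ O)
    {J : EuclideanSpace ℝ (Fin m) → EuclideanSpace ℝ (Fin m) →L[ℝ] EuclideanSpace ℝ (Fin m)}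
    (hJ : ContDiffOn ℝ ∞ J O)
    {B : EuclideanSpace ℝ (Fin m) → EuclideanSpace ℝ (Fin m) →L[ℝ] ℝ} (hB : ContDiffOn ℝ ∞ B O)
    {u : ℕ → EuclideanSpace ℝ (Fin m) → ℝ} (hu : ∀ k, ContDiffOn ℝ ∞ (u k) O)
    {t : ℕ → ℝ} (ht : ∀ k, 0 < t k) (hts : Summable t)
    (h : ∀ k, ∀ x ∈ O, DbarIneqAt J (fun y => B y + fderiv ℝ (u k) y) (t k) x) :
    ∃ r > 0, Metric.ball x₀ r ⊆ O ∧ ∃ b₀ ∈ Metric.ball x₀ r, ∃ g : EuclideanSpace ℝ (Fin m) → ℝ,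
      ContDiffOn ℝ ∞ g (Metric.ball x₀ r) ∧
      (∀ a ∈ Metric.ball x₀ r, HasFDerivAt g (B a) a) ∧
      ∀ᵐ a ∂(volume.restrict (Metric.ball x₀ r)),
        Tendsto (fun k => u k a - u k b₀) atTop (𝓝 (-(g a - g b₀))) := by
  obtain ⟨R, hR, hRO⟩ := Metric.isOpen_iff.1 hO x₀ hx₀
  -- the closed ball of radius `4 r` is contained in `O`; the functions are extended from the ball
  -- of radius `2 r`, and the cut-off of the Caccioppoli estimate is supported there
  set r := R / 5 with hr
  have hr0 : 0 < r := by positivity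
  have hsub : Metric.closedBall x₀ (2 * (2 * r)) ⊆ O :=
    (Metric.closedBall_subset_ball (by rw [hr]; linarith)).trans hRO
  have h2r : (0 : ℝ) < 2 * r := by positivity
  obtain ⟨J', hJ', hJe⟩ := exists_contDiff_eqOn_ball hO h2r hsub hJ
  obtain ⟨B', hB', hBe⟩ := exists_contDiff_eqOn_ball hO h2r hsub hB
  choose u' hu' hue using fun k => exists_contDiff_eqOn_ball hO h2r hsub (hu k)
  have hrr : Metric.ball x₀ r ⊆ Metric.ball x₀ (2 * r) := Metric.ball_subset_ball (by linarith)
  have hrO : Metric.ball x₀ (2 * r) ⊆ O :=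
    (Metric.ball_subset_closedBall.trans (Metric.closedBall_subset_closedBall (by linarith))).trans
      hsub
  have hev : ∀ x ∈ Metric.ball x₀ (2 * r), ∀ᶠ y in 𝓝 x, y ∈ Metric.ball x₀ (2 * r) :=
    fun x hx => Metric.isOpen_ball.mem_nhds hx
  have hdu : ∀ k, ∀ x ∈ Metric.ball x₀ (2 * r), fderiv ℝ (u' k) x = fderiv ℝ (u k) x :=
    fun k x hx => EventuallyEq.fderiv_eq (show u' k =ᶠ[𝓝 x] u k from
      (hev x hx).mono fun y hy => hue k hy)
  obtain ⟨C, hC⟩ := exists_lintegral_enorm_le hJ' x₀ hr0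
  have hdc : ∀ k, ContDiff ℝ 1 (fun x => B' x + fderiv ℝ (u' k) x) := fun k =>
    (hB'.of_le (by simp)).add ((hu' k).fderiv_right (m := 1) (by norm_cast))
  have hk : ∀ k, ∫⁻ x in Metric.ball x₀ r, ‖B' x + fderiv ℝ (u' k) x‖ₑ ≤
      ENNReal.ofReal (C * t k) := fun k => by
    refine hC _ _ (hdc k) (ht k) fun x hx => (h k x (hrO hx)).congr ?_ ?_
    · exact (hev x hx).mono fun y hy => hJe hy
    · exact (hev x hx).mono fun y hy => by simp only [hBe hy, hdu k y hy]
  have hfin : ∑' k, ∫⁻ x in Metric.ball x₀ r, ‖B' x + fderiv ℝ (u' k) x‖ₑ ≠ ⊤ :=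
    ne_top_of_le_ne_top (hts.mul_left C).tsum_ofReal_ne_top (ENNReal.tsum_le_tsum hk)
  obtain ⟨b₀, hb₀, g, hg, hlim⟩ := exists_primitive_of_tsum_lintegral_ne_top volume
    hB'.continuous (fun k => (hu' k).of_le (by simp)) x₀ hr0 hfin
  have hg' : ∀ a ∈ Metric.ball x₀ r, HasFDerivAt g (B a) a := fun a ha => by
    rw [← hBe (hrr ha)]
    exact hg a ha
  refine ⟨r, hr0, hrr.trans hrO, b₀, hb₀, g, ?_, hg', ?_⟩
  · rw [contDiffOn_infty_iff_fderiv_of_isOpen Metric.isOpen_ball]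
    refine ⟨fun a ha => (hg' a ha).differentiableAt.differentiableWithinAt, ?_⟩
    exact (hB.mono (hrr.trans hrO)).congr fun a ha => (hg' a ha).fderiv
  · filter_upwards [hlim, ae_restrict_mem measurableSet_ball] with a ha haU
    refine ha.congr fun k => ?_
    rw [hue k (hrr haU), hue k (hrr hb₀)]

end Flat

/-! ### Gluing local primitives on a manifold -/

section Gluing

theorem mvfderiv_congr {E H F M : Type*} [NormedAddCommGroup E] [NormedSpace ℝ E]
    [TopologicalSpace H] {I : ModelWithCorners ℝ E H} [TopologicalSpace M] [ChartedSpace H M]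
    [NormedAddCommGroup F] [NormedSpace ℝ F] {f g : M → F} {p : M} (h : f =ᶠ[𝓝 p] g) :
    mvfderiv I f p = mvfderiv I g p := by
  have h1 := h.mfderiv_eq (I := I) (I' := 𝓘(ℝ, F))
  ext v
  exact congrArg (fun L : TangentSpace I p →L[ℝ] TangentSpace 𝓘(ℝ, F) (f p) => L v) h1

/-- Local functions `g x`, defined near `x`, are glued to a function `F` with the same differences,
provided that their discrepancies are limits of the coboundaries `f_k (p y) - f_k (p x)`. -/
theorem exists_glue {V : Type*} [TopologicalSpace V] (f : ℕ → V → ℝ) (p : V → V)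
    (g : V → V → ℝ)
    (h : ∀ x, ∀ᶠ y in 𝓝 x, Tendsto (fun k => f k (p y) - f k (p x)) atTop
      (𝓝 (-g x y + g y y + g x (p x) - g y (p y)))) :
    ∃ F : V → ℝ, ∀ x, ∀ᶠ y in 𝓝 x, F y = F x + (g x y - g x x) := by
  -- on a class of the equivalence relation "`f_k (p x) - f_k (p y)` converges", the constants are
  -- normalised by the limits with respect to a representative; nearby points are equivalent
  let R : Setoid V :=
    { r := fun x y => ∃ l, Tendsto (fun k => f k (p x) - f k (p y)) atTop (𝓝 l)
      iseqv := by
        refine ⟨fun x => ⟨0, by simp⟩, ?_, ?_⟩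
        · rintro x y ⟨l, hl⟩
          exact ⟨-l, hl.neg.congr fun k => by ring⟩
        · rintro x y z ⟨l, hl⟩ ⟨l', hl'⟩
          exact ⟨l + l', (hl.add hl').congr fun k => by ring⟩ }
  let rep : V → V := fun x => (Quotient.mk R x).out
  have hrep : ∀ x, ∃ l, Tendsto (fun k => f k (p (rep x)) - f k (p x)) atTop (𝓝 l) := fun x =>
    Quotient.mk_out (s := R) x
  choose l hl using hrep
  refine ⟨fun x => l x + g x x - g x (p x), fun x => (h x).mono fun y hy => ?_⟩
  have hxy : rep y = rep x := by
    have : Quotient.mk R y = Quotient.mk R x := Quotient.sound (s := R) ⟨_, hy⟩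
    simp only [rep, this]
  have h1 := hl y
  rw [hxy] at h1
  have h2 := tendsto_nhds_unique (h1.congr fun k => by ring) ((hl x).sub hy)
  simp only [h2]
  ring

variable {m : ℕ} {V : Type*} [TopologicalSpace V] [ChartedSpace (EuclideanSpace ℝ (Fin m)) V]

/-- The expression of a one-form in the preferred chart at `x`. -/
def OneForm.inChart (β : OneForm m V) (x : V) (y : EuclideanSpace ℝ (Fin m)) :
    EuclideanSpace ℝ (Fin m) →L[ℝ] ℝ :=
  (β ((extChartAt (𝓡 m) x).symm y)).comp
    (mfderiv 𝓘(ℝ, EuclideanSpace ℝ (Fin m)) (𝓡 m) (extChartAt (𝓡 m) x).symm y)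

variable [IsManifold (𝓡 m) ∞ V]

/-- A primitive of `β` in a chart is a primitive of `β` on the manifold. -/
theorem mvfderiv_comp_extChartAt_eq (β : OneForm m V) (x q : V)
    (hq : q ∈ (extChartAt (𝓡 m) x).source) {g : EuclideanSpace ℝ (Fin m) → ℝ}
    (hg : HasFDerivAt g (β.inChart x (extChartAt (𝓡 m) x q)) (extChartAt (𝓡 m) x q)) :
    mvfderiv (𝓡 m) (g ∘ extChartAt (𝓡 m) x) q = β q := by
  have hφ : MDifferentiableAt (𝓡 m) 𝓘(ℝ, EuclideanSpace ℝ (Fin m)) (extChartAt (𝓡 m) x) q :=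
    mdifferentiableAt_extChartAt (by rwa [extChartAt_source] at hq)
  have hψ : MDifferentiableAt 𝓘(ℝ, EuclideanSpace ℝ (Fin m)) (𝓡 m) (extChartAt (𝓡 m) x).symm
      (extChartAt (𝓡 m) x q) :=
    (contMDiffOn_extChartAt_symm (n := ∞) x).contMDiffAt
      ((isOpen_extChartAt_target x).mem_nhds ((extChartAt (𝓡 m) x).map_source hq))
      |>.mdifferentiableAt (by simp)
  have hid : mfderiv (𝓡 m) (𝓡 m) ((extChartAt (𝓡 m) x).symm ∘ extChartAt (𝓡 m) x) q
      = ContinuousLinearMap.id ℝ _ := by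
    have h1 : (extChartAt (𝓡 m) x).symm ∘ extChartAt (𝓡 m) x =ᶠ[𝓝 q] id := by
      filter_upwards [(isOpen_extChartAt_source x).mem_nhds hq] with z hz
      exact (extChartAt (𝓡 m) x).left_inv hz
    rw [h1.mfderiv_eq, mfderiv_id]
  rw [mfderiv_comp q hψ hφ] at hid
  have hgm : MDifferentiableAt 𝓘(ℝ, EuclideanSpace ℝ (Fin m)) 𝓘(ℝ, ℝ) g
      (extChartAt (𝓡 m) x q) := hg.differentiableAt.mdifferentiableAt
  rw [mvfderiv_comp q hgm hφ]
  ext v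
  have h2 : mvfderiv 𝓘(ℝ, EuclideanSpace ℝ (Fin m)) g (extChartAt (𝓡 m) x q) =
      β.inChart x (extChartAt (𝓡 m) x q) := by
    rw [← hg.fderiv, ← mfderiv_eq_fderiv]
    rfl
  rw [h2]
  have h3 : (extChartAt (𝓡 m) x).symm (extChartAt (𝓡 m) x q) = q := (extChartAt (𝓡 m) x).left_inv hq
  have h4 := congrArg (fun L => L v) hid
  have h5 : ∀ q', q' = q → ∀ w : TangentSpace (𝓡 m) q', ∀ w' : TangentSpace (𝓡 m) q,
    (w : EuclideanSpace ℝ (Fin m)) = w' → β q' w = β q w' := by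
    rintro q' rfl w w' rfl
    rfl
  exact h5 _ h3 _ _ h4

/-- A one-form `β` is exact if there are exact forms `df_k` such that the `β + df_k` satisfy
`DbarIneqAt` in charts, with summable constants and with almost complex structures that do not
depend on `k`: then `-f_k` converges almost everywhere to a primitive of `β`, after the subtraction
of locally constant functions. -/
theorem OneForm.isExact_of_dbarIneqAt (β : OneForm m V) {f : ℕ → V → ℝ}
    (hf : ∀ k, ContMDiff (𝓡 m) 𝓘(ℝ, ℝ) ∞ (f k)) {t : ℕ → ℝ} (ht : ∀ k, 0 < t k)
    (hts : Summable t)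
    (hloc : ∀ x : V, ∃ O ⊆ (extChartAt (𝓡 m) x).target, IsOpen O ∧ extChartAt (𝓡 m) x x ∈ O ∧
      ∃ J : EuclideanSpace ℝ (Fin m) → EuclideanSpace ℝ (Fin m) →L[ℝ] EuclideanSpace ℝ (Fin m),
        ContDiffOn ℝ ∞ J O ∧ ContDiffOn ℝ ∞ (β.inChart x) O ∧ ∀ k, ∀ y ∈ O,
          DbarIneqAt J (fun z => β.inChart x z + fderiv ℝ (f k ∘ (extChartAt (𝓡 m) x).symm) z)
            (t k) y) :
    β.IsExact := by
  have hψ : ∀ x : V, ContMDiffOn 𝓘(ℝ, EuclideanSpace ℝ (Fin m)) (𝓡 m) ∞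
      (extChartAt (𝓡 m) x).symm (extChartAt (𝓡 m) x).target :=
    fun x => contMDiffOn_extChartAt_symm x
  have hflat : ∀ x : V, ∃ r > 0, Metric.ball (extChartAt (𝓡 m) x x) r ⊆ (extChartAt (𝓡 m) x).target
      ∧ ∃ b ∈ Metric.ball (extChartAt (𝓡 m) x x) r, ∃ g : EuclideanSpace ℝ (Fin m) → ℝ,
      ContDiffOn ℝ ∞ g (Metric.ball (extChartAt (𝓡 m) x x) r) ∧
      (∀ a ∈ Metric.ball (extChartAt (𝓡 m) x x) r, HasFDerivAt g (β.inChart x a) a) ∧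
      ∀ᵐ a ∂(volume.restrict (Metric.ball (extChartAt (𝓡 m) x x) r)),
        Tendsto (fun k => f k ((extChartAt (𝓡 m) x).symm a) - f k ((extChartAt (𝓡 m) x).symm b))
          atTop (𝓝 (-(g a - g b))) := by
    intro x
    obtain ⟨O, hOt, hO, hxO, J, hJ, hB, h⟩ := hloc x
    obtain ⟨r, hr, hrO, hrest⟩ := exists_primitive_of_dbarIneqAt hO hxO hJ hB
      (u := fun k => f k ∘ (extChartAt (𝓡 m) x).symm)
      (fun k => contMDiffOn_iff_contDiffOn.1 ((hf k).comp_contMDiffOn ((hψ x).mono hOt))) ht hts h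
    exact ⟨r, hr, hrO.trans hOt, hrest⟩
  choose r hr hrt b hb g hgs hg hlim using hflat
  -- the open neighbourhood of `x` on which everything is defined
  set N : V → Set V := fun x => (extChartAt (𝓡 m) x).source ∩
    extChartAt (𝓡 m) x ⁻¹' Metric.ball (extChartAt (𝓡 m) x x) (r x) with hN
  have hNo : ∀ x, IsOpen (N x) := fun x =>
    (continuousOn_extChartAt x).isOpen_inter_preimage (isOpen_extChartAt_source x)
      Metric.isOpen_ball
  have hxN : ∀ x, x ∈ N x := fun x =>
    ⟨mem_extChartAt_source x, Metric.mem_ball_self (hr x)⟩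
  set G : V → V → ℝ := fun x => g x ∘ extChartAt (𝓡 m) x with hG
  set p : V → V := fun x => (extChartAt (𝓡 m) x).symm (b x) with hp
  have hGd : ∀ x, ∀ q ∈ N x, mvfderiv (𝓡 m) (G x) q = β q := fun x q hq =>
    mvfderiv_comp_extChartAt_eq β x q hq.1 (hg x _ hq.2)
  have hGs : ∀ x, ContMDiffOn (𝓡 m) 𝓘(ℝ, ℝ) ∞ (G x) (N x) := fun x =>
    (contMDiffOn_iff_contDiffOn.2 (hgs x)).comp
      ((contMDiffOn_extChartAt (x := x)).mono fun q hq => by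
        rw [← extChartAt_source (𝓡 m)]
        exact hq.1) fun q hq => hq.2
  have hGψ : ∀ x, ∀ a ∈ Metric.ball (extChartAt (𝓡 m) x x) (r x),
      G x ((extChartAt (𝓡 m) x).symm a) = g x a := fun x a ha => by
    simp only [hG, Function.comp_apply, (extChartAt (𝓡 m) x).right_inv (hrt x ha)]
  have key : ∀ x, ∀ y ∈ N x, Tendsto (fun k => f k (p y) - f k (p x)) atTop
      (𝓝 (-G x y + G y y + G x (p x) - G y (p y))) := by
    intro x y hy
    set c := extChartAt (𝓡 m) y y with hc
    have hψc : ContinuousAt (extChartAt (𝓡 m) y).symm c := continuousAt_extChartAt_symm y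
    have hψcy : (extChartAt (𝓡 m) y).symm c = y := extChartAt_to_inv y
    obtain ⟨ρ, hρ, hρs⟩ : ∃ ρ > 0, Metric.ball c ρ ⊆
        Metric.ball c (r y) ∩ (extChartAt (𝓡 m) y).symm ⁻¹' (N x ∩ N y) := by
      refine Metric.mem_nhds_iff.1 (inter_mem (Metric.ball_mem_nhds c (hr y)) (hψc ?_))
      rw [hψcy]
      exact inter_mem ((hNo x).mem_nhds hy) ((hNo y).mem_nhds (hxN y))
    -- the two primitives differ by a constant near `y`
    have hconst : ∀ z ∈ Metric.ball c ρ, G x ((extChartAt (𝓡 m) y).symm z)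
        - G y ((extChartAt (𝓡 m) y).symm z) = G x y - G y y := by
      have hder : ∀ w, ∀ z ∈ Metric.ball c ρ, (extChartAt (𝓡 m) y).symm z ∈ N w →
          HasFDerivAt (G w ∘ (extChartAt (𝓡 m) y).symm) (β.inChart y z) z := by
        intro w z hz hw
        have h1 : MDifferentiableAt 𝓘(ℝ, EuclideanSpace ℝ (Fin m)) (𝓡 m)
            (extChartAt (𝓡 m) y).symm z :=
          ((hψ y).contMDiffAt ((isOpen_extChartAt_target y).mem_nhds
            (hrt y (hρs hz).1))).mdifferentiableAt (by simp)
        have h2 : MDifferentiableAt (𝓡 m) 𝓘(ℝ, ℝ) (G w) ((extChartAt (𝓡 m) y).symm z) :=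
          ((hGs w).contMDiffAt ((hNo w).mem_nhds hw)).mdifferentiableAt (by simp)
        have h3 : DifferentiableAt ℝ (G w ∘ (extChartAt (𝓡 m) y).symm) z :=
          (h2.comp z h1).differentiableAt
        have h4 : fderiv ℝ (G w ∘ (extChartAt (𝓡 m) y).symm) z = β.inChart y z := by
          have h5 := mvfderiv_comp z h2 h1
          rw [hGd w _ hw] at h5
          rw [← mfderiv_eq_fderiv]
          exact h5
        rw [← h4]
        exact h3.hasFDerivAt
      intro z hz
      have h1 : ∀ z ∈ Metric.ball c ρ, HasFDerivAt (fun z => G x ((extChartAt (𝓡 m) y).symm z)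
          - G y ((extChartAt (𝓡 m) y).symm z)) (0 : EuclideanSpace ℝ (Fin m) →L[ℝ] ℝ) z := by
        intro z hz
        have h2 := (hder x z hz (hρs hz).2.1).sub (hder y z hz (hρs hz).2.2)
        rw [sub_self] at h2
        exact h2
      have h3 := (convex_ball c ρ).is_const_of_fderivWithin_eq_zero (𝕜 := ℝ)
        (fun z hz => (h1 z hz).differentiableAt.differentiableWithinAt)
        (fun z hz => by
          rw [fderivWithin_of_isOpen Metric.isOpen_ball hz]
          exact (h1 z hz).fderiv) hz (Metric.mem_ball_self hρ)
      simpa only [hψcy] using h3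
    -- almost every point near `y` is good for `x`, as null sets are preserved by chart changes
    set bad : Set (EuclideanSpace ℝ (Fin m)) := {w | w ∈ Metric.ball (extChartAt (𝓡 m) x x) (r x) ∧
      (extChartAt (𝓡 m) x).symm w ∈ (extChartAt (𝓡 m) y).source ∧
      ¬ Tendsto (fun k => f k ((extChartAt (𝓡 m) x).symm w) - f k (p x)) atTop
        (𝓝 (-(g x w - g x (b x))))} with hbad
    have hbad0 : volume bad = 0 := by
      have h1 := (ae_restrict_iff' measurableSet_ball).1 (hlim x)
      rw [ae_iff] at h1
      refine measure_mono_null (fun w hw => ?_) h1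
      exact fun hw' => hw.2.2 (hw' hw.1)
    have himg : volume ((extChartAt (𝓡 m) y ∘ (extChartAt (𝓡 m) x).symm) '' bad) = 0 := by
      refine addHaar_image_eq_zero_of_differentiableOn_of_addHaar_eq_zero _ (fun w hw => ?_) hbad0
      have h1 : MDifferentiableAt 𝓘(ℝ, EuclideanSpace ℝ (Fin m)) (𝓡 m)
          (extChartAt (𝓡 m) x).symm w :=
        ((hψ x).contMDiffAt ((isOpen_extChartAt_target x).mem_nhds
          (hrt x hw.1))).mdifferentiableAt (by simp)
      have h2 : MDifferentiableAt (𝓡 m) 𝓘(ℝ, EuclideanSpace ℝ (Fin m)) (extChartAt (𝓡 m) y)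
          ((extChartAt (𝓡 m) x).symm w) :=
        mdifferentiableAt_extChartAt (by simpa only [extChartAt_source] using hw.2.1)
      exact (h2.comp w h1).differentiableAt.differentiableWithinAt
    have hne : (ae (volume.restrict (Metric.ball c ρ))).NeBot := by
      rw [ae_neBot, Ne, Measure.restrict_eq_zero]
      exact (Metric.measure_ball_pos volume c hρ).ne'
    have hgoody : ∀ᵐ z ∂(volume.restrict (Metric.ball c ρ)),
        Tendsto (fun k => f k ((extChartAt (𝓡 m) y).symm z) - f k (p y))
          atTop (𝓝 (-(g y z - g y (b y)))) :=
      ae_restrict_of_ae_restrict_of_subset (fun z hz => (hρs hz).1) (hlim y)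
    have hgoodx : ∀ᵐ z ∂(volume.restrict (Metric.ball c ρ)),
        z ∉ (extChartAt (𝓡 m) y ∘ (extChartAt (𝓡 m) x).symm) '' bad :=
      ae_restrict_of_ae (compl_mem_ae_iff.2 himg)
    obtain ⟨z, ⟨hz1, hz2⟩, hz⟩ :=
      ((hgoody.and hgoodx).and (ae_restrict_mem measurableSet_ball)).exists
    have hzN := (hρs hz).2.1
    have hzt := hrt y (hρs hz).1
    have hx : Tendsto (fun k => f k ((extChartAt (𝓡 m) y).symm z) - f k (p x)) atTop
        (𝓝 (-(G x ((extChartAt (𝓡 m) y).symm z) - g x (b x)))) := by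
      by_contra hcon
      refine hz2 ⟨extChartAt (𝓡 m) x ((extChartAt (𝓡 m) y).symm z), ⟨hzN.2, ?_, ?_⟩, ?_⟩
      · rw [(extChartAt (𝓡 m) x).left_inv hzN.1]
        exact (extChartAt (𝓡 m) y).map_target hzt
      · rwa [(extChartAt (𝓡 m) x).left_inv hzN.1]
      · simp only [Function.comp_apply]
        rw [(extChartAt (𝓡 m) x).left_inv hzN.1, (extChartAt (𝓡 m) y).right_inv hzt]
    have h1 := hx.sub hz1
    have h2 := hconst z hz
    rw [hGψ y z (hρs hz).1] at h2
    have h3 : Tendsto (fun k => f k (p y) - f k (p x)) atTop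
        (𝓝 (-(G x ((extChartAt (𝓡 m) y).symm z) - g x (b x)) - -(g y z - g y (b y)))) :=
      h1.congr fun k => by ring
    convert h3 using 2
    rw [show G x (p x) = g x (b x) from hGψ x _ (hb x),
      show G y (p y) = g y (b y) from hGψ y _ (hb y)]
    linarith
  obtain ⟨F, hF⟩ := exists_glue f p G fun x => by
    filter_upwards [(hNo x).mem_nhds (hxN x)] with y hy using key x y hy
  have hFG : ∀ x, F =ᶠ[𝓝 x] fun y => G x y + (F x - G x x) := fun x =>
    (hF x).mono fun y hy => by
      rw [hy]
      ring
  have hGx : ∀ x, ContMDiffAt (𝓡 m) 𝓘(ℝ, ℝ) ∞ (G x) x := fun x =>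
    (hGs x).contMDiffAt ((hNo x).mem_nhds (hxN x))
  refine ⟨F, fun x => ?_, fun x => ?_⟩
  · exact ((hGx x).add contMDiffAt_const).congr_of_eventuallyEq (hFG x)
  · have h1 : mvfderiv (𝓡 m) F x = mvfderiv (𝓡 m) (fun y => G x y + (F x - G x x)) x :=
      mvfderiv_congr (hFG x)
    rw [h1, mvfderiv_fun_add ((hGx x).mdifferentiableAt (by simp)) mdifferentiableAt_const,
      mvfderiv_const, add_zero, hGd x x (hxN x)]

end Gluing

/-! ### Vector fields in charts -/

section VectorFields

variable {d : ℕ} {M : Type*} [TopologicalSpace M] [ChartedSpace (EuclideanSpace ℝ (Fin d)) M]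
  [IsManifold (𝓡 d) ∞ M]
  {F : Type*} [NormedAddCommGroup F] [NormedSpace ℝ F]

/-- Smoothness of a real vector field at a point. -/
def VField.SmoothAt (X : VField d M) (p : M) : Prop :=
  ContMDiffAt (𝓡 d) (𝓡 d).tangent ∞ (fun p => (⟨p, X p⟩ : TangentBundle (𝓡 d) M)) p

theorem VField.Smooth.smoothAt {X : VField d M} (hX : X.Smooth) (p : M) : X.SmoothAt p := hX p

/-- The coordinates of a vector field in the preferred chart at `x₀`. -/
def VField.coord (x₀ : M) (X : VField d M) (q : M) : EuclideanSpace ℝ (Fin d) :=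
  mvfderiv (𝓡 d) (extChartAt (𝓡 d) x₀) q (X q)

theorem VField.smoothAt_iff {X : VField d M} {x₀ q : M} (hq : q ∈ (extChartAt (𝓡 d) x₀).source) :
    X.SmoothAt q ↔ ContMDiffAt (𝓡 d) 𝓘(ℝ, EuclideanSpace ℝ (Fin d)) ∞ (X.coord x₀) q := by
  rw [extChartAt_source] at hq
  have h1 := Bundle.Trivialization.contMDiffAt_section_iff (IB := 𝓡 d) (n := ∞) (s := X) (x₀ := q)
    (trivializationAt (EuclideanSpace ℝ (Fin d)) (TangentSpace (𝓡 d) : M → Type _) x₀)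
    (by simpa using hq)
  refine h1.trans (Filter.EventuallyEq.contMDiffAt_iff ?_)
  filter_upwards [(chartAt (EuclideanSpace ℝ (Fin d)) x₀).open_source.mem_nhds hq] with z hz
  have h2 := TangentBundle.continuousLinearMapAt_trivializationAt (I := 𝓡 d) hz
  have h3 := congrArg (fun L : TangentSpace (𝓡 d) z →L[ℝ] EuclideanSpace ℝ (Fin d) => L (X z)) h2
  refine Eq.trans ?_ h3
  exact (congrFun (Bundle.Trivialization.coe_linearMapAt_of_mem (R := ℝ) _ (by simpa using hz))
    (X z)).symm

/-- The differential of a vector-valued map, in the preferred chart at `x₀`. -/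
theorem mvfderiv_eq_fderiv_chart {Φ : M → F} {x₀ q : M} (hq : q ∈ (extChartAt (𝓡 d) x₀).source)
    (hΦ : MDifferentiableAt (𝓡 d) 𝓘(ℝ, F) Φ q) (v : TangentSpace (𝓡 d) q) :
    mvfderiv (𝓡 d) Φ q v = fderiv ℝ (Φ ∘ (extChartAt (𝓡 d) x₀).symm) (extChartAt (𝓡 d) x₀ q)
      (mvfderiv (𝓡 d) (extChartAt (𝓡 d) x₀) q v) := by
  have hφ : MDifferentiableAt (𝓡 d) 𝓘(ℝ, EuclideanSpace ℝ (Fin d)) (extChartAt (𝓡 d) x₀) q :=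
    mdifferentiableAt_extChartAt (by rwa [extChartAt_source] at hq)
  have hψ : MDifferentiableAt 𝓘(ℝ, EuclideanSpace ℝ (Fin d)) (𝓡 d) (extChartAt (𝓡 d) x₀).symm
      (extChartAt (𝓡 d) x₀ q) :=
    (contMDiffOn_extChartAt_symm (n := ∞) x₀).contMDiffAt
      ((isOpen_extChartAt_target x₀).mem_nhds ((extChartAt (𝓡 d) x₀).map_source hq))
      |>.mdifferentiableAt (by simp)
  have h0 : (extChartAt (𝓡 d) x₀).symm (extChartAt (𝓡 d) x₀ q) = q :=
    (extChartAt (𝓡 d) x₀).left_inv hq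
  have hΦ' : MDifferentiableAt 𝓘(ℝ, EuclideanSpace ℝ (Fin d)) 𝓘(ℝ, F)
      (Φ ∘ (extChartAt (𝓡 d) x₀).symm) (extChartAt (𝓡 d) x₀ q) :=
    MDifferentiableAt.comp _ (by rwa [h0]) hψ
  have h1 : Φ =ᶠ[𝓝 q] (Φ ∘ (extChartAt (𝓡 d) x₀).symm) ∘ extChartAt (𝓡 d) x₀ := by
    filter_upwards [(isOpen_extChartAt_source x₀).mem_nhds hq] with z hz
    simp only [Function.comp_apply, (extChartAt (𝓡 d) x₀).left_inv hz]
  rw [mvfderiv_congr h1]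
  have h2 := mfderiv_comp q hΦ' hφ
  rw [mfderiv_eq_fderiv] at h2
  exact congrArg (fun L : TangentSpace (𝓡 d) q →L[ℝ] F => L v) h2

theorem contDiffAt_comp_extChartAt_symm {Φ : M → F} {x₀ q : M}
    (hq : q ∈ (extChartAt (𝓡 d) x₀).source) (hΦ : ContMDiffAt (𝓡 d) 𝓘(ℝ, F) ∞ Φ q) :
    ContDiffAt ℝ ∞ (Φ ∘ (extChartAt (𝓡 d) x₀).symm) (extChartAt (𝓡 d) x₀ q) := by
  have hψ : ContMDiffAt 𝓘(ℝ, EuclideanSpace ℝ (Fin d)) (𝓡 d) ∞ (extChartAt (𝓡 d) x₀).symm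
      (extChartAt (𝓡 d) x₀ q) :=
    (contMDiffOn_extChartAt_symm (n := ∞) x₀).contMDiffAt
      ((isOpen_extChartAt_target x₀).mem_nhds ((extChartAt (𝓡 d) x₀).map_source hq))
  exact (ContMDiffAt.comp _ (by rwa [(extChartAt (𝓡 d) x₀).left_inv hq]) hψ).contDiffAt

theorem contMDiffAt_extChartAt_of_mem {x₀ q : M} (hq : q ∈ (extChartAt (𝓡 d) x₀).source) :
    ContMDiffAt (𝓡 d) 𝓘(ℝ, EuclideanSpace ℝ (Fin d)) ∞ (extChartAt (𝓡 d) x₀) q :=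
  contMDiffAt_extChartAt' (by rwa [extChartAt_source] at hq)

theorem VField.SmoothAt.contMDiffAt_mvfderiv {Φ : M → F} {X : VField d M} {q : M}
    (hX : X.SmoothAt q) (hΦ : ContMDiffAt (𝓡 d) 𝓘(ℝ, F) ∞ Φ q) :
    ContMDiffAt (𝓡 d) 𝓘(ℝ, F) ∞ (fun z => mvfderiv (𝓡 d) Φ z (X z)) q := by
  have hq := mem_extChartAt_source (I := 𝓡 d) q
  have hX' := (VField.smoothAt_iff hq).1 hX
  have h1 : ContDiffAt ℝ ∞ (fderiv ℝ (Φ ∘ (extChartAt (𝓡 d) q).symm)) (extChartAt (𝓡 d) q q) :=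
    (contDiffAt_comp_extChartAt_symm hq hΦ).fderiv_right (by simp)
  have h2 : ContMDiffAt (𝓡 d) 𝓘(ℝ, EuclideanSpace ℝ (Fin d) →L[ℝ] F) ∞
      (fun z => fderiv ℝ (Φ ∘ (extChartAt (𝓡 d) q).symm) (extChartAt (𝓡 d) q z)) q :=
    h1.contMDiffAt.comp q (contMDiffAt_extChartAt_of_mem hq)
  refine (h2.clm_apply hX').congr_of_eventuallyEq ?_
  filter_upwards [(isOpen_extChartAt_source q).mem_nhds hq,
    (contMDiffAt_iff_contMDiffAt_nhds (n := 1) (by simp)).1 (hΦ.of_le (by simp))] with z hz hz'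
  exact mvfderiv_eq_fderiv_chart hz (hz'.mdifferentiableAt (by simp)) _

theorem isInvertible_mvfderiv_extChartAt {x₀ q : M} (hq : q ∈ (extChartAt (𝓡 d) x₀).source) :
    (mfderiv (𝓡 d) 𝓘(ℝ, EuclideanSpace ℝ (Fin d)) (extChartAt (𝓡 d) x₀) q).IsInvertible :=
  isInvertible_mfderiv_extChartAt hq

/-- The vector field with prescribed coordinates in the preferred chart at `x₀`. -/
def VField.ofCoord (x₀ : M) (G : M → EuclideanSpace ℝ (Fin d)) : VField d M := fun q =>
  (mfderiv (𝓡 d) 𝓘(ℝ, EuclideanSpace ℝ (Fin d)) (extChartAt (𝓡 d) x₀) q).inverse (G q)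

theorem VField.coord_ofCoord (x₀ : M) (G : M → EuclideanSpace ℝ (Fin d)) {q : M}
    (hq : q ∈ (extChartAt (𝓡 d) x₀).source) : (VField.ofCoord x₀ G).coord x₀ q = G q :=
  (isInvertible_mvfderiv_extChartAt hq).self_apply_inverse (G q)

theorem injective_mvfderiv_extChartAt {x₀ q : M} (hq : q ∈ (extChartAt (𝓡 d) x₀).source) :
    Function.Injective (mvfderiv (𝓡 d) (extChartAt (𝓡 d) x₀) q) :=
  (isInvertible_mvfderiv_extChartAt hq).injective

theorem VField.smoothAt_ofCoord {x₀ : M} {G : M → EuclideanSpace ℝ (Fin d)} {q : M}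
    (hq : q ∈ (extChartAt (𝓡 d) x₀).source)
    (hG : ContMDiffAt (𝓡 d) 𝓘(ℝ, EuclideanSpace ℝ (Fin d)) ∞ G q) :
    (VField.ofCoord x₀ G).SmoothAt q := by
  refine (VField.smoothAt_iff hq).2 (hG.congr_of_eventuallyEq ?_)
  filter_upwards [(isOpen_extChartAt_source x₀).mem_nhds hq] with z hz
  exact VField.coord_ofCoord x₀ G hz

/-- In the preferred chart at `p`, the Lie bracket is the commutator of derivatives. -/
theorem mvfderiv_extChartAt_mlieBracket (X Y : VField d M) (p : M) :
    mvfderiv (𝓡 d) (extChartAt (𝓡 d) p) p (VectorField.mlieBracket (𝓡 d) X Y p) =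
      VectorField.lieBracket ℝ (X.coord p ∘ (extChartAt (𝓡 d) p).symm)
        (Y.coord p ∘ (extChartAt (𝓡 d) p).symm) (extChartAt (𝓡 d) p p) := by
  have hX : ∀ X : VField d M, VectorField.mpullbackWithin 𝓘(ℝ, EuclideanSpace ℝ (Fin d)) (𝓡 d)
      (extChartAt (𝓡 d) p).symm X (range (𝓡 d)) =ᶠ[𝓝 (extChartAt (𝓡 d) p p)]
      X.coord p ∘ (extChartAt (𝓡 d) p).symm := by
    intro X
    filter_upwards [(isOpen_extChartAt_target p).mem_nhds (mem_extChartAt_target p)] with y hy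
    have h1 := mfderivWithin_extChartAt_symm_comp_mfderiv_extChartAt (I := 𝓡 d) hy
    have h2 : (extChartAt (𝓡 d) p).symm y ∈ (extChartAt (𝓡 d) p).source :=
      (extChartAt (𝓡 d) p).map_target hy
    have h3 := isInvertible_mfderivWithin_extChartAt_symm (I := 𝓡 d) hy
    refine h3.injective ?_
    rw [VectorField.mpullbackWithin_apply, h3.self_apply_inverse]
    exact (congrArg (fun L => L (X ((extChartAt (𝓡 d) p).symm y))) h1).symm
  have h := VectorField.mlieBracketWithin_apply (I := 𝓡 d) (V := X) (W := Y) (s := univ) (x₀ := p)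
  refine (congrArg (mvfderiv (𝓡 d) (extChartAt (𝓡 d) p) p) h).trans ?_
  refine ((isInvertible_mvfderiv_extChartAt
    (mem_extChartAt_source p)).self_apply_inverse _).trans ?_
  have hu : ∀ {A B A' B' : EuclideanSpace ℝ (Fin d) → EuclideanSpace ℝ (Fin d)}
      {s : Set (EuclideanSpace ℝ (Fin d))} {y : EuclideanSpace ℝ (Fin d)}, s = univ →
      A =ᶠ[𝓝 y] A' → B =ᶠ[𝓝 y] B' →
      VectorField.lieBracketWithin ℝ A B s y = VectorField.lieBracket ℝ A' B' y := by
    intro A B A' B' s y hs hA hB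
    rw [hs, VectorField.lieBracketWithin_univ]
    exact hA.lieBracket_vectorField_eq hB
  exact hu (by simp) (hX X) (hX Y)

/-- The differential of a vector-valued map intertwines the Lie bracket with the commutator of
the derivations. -/
theorem mvfderiv_mlieBracket {Φ : M → F} {X Y : VField d M} {p : M}
    (hΦ : ContMDiffAt (𝓡 d) 𝓘(ℝ, F) ∞ Φ p) (hX : X.SmoothAt p) (hY : Y.SmoothAt p) :
    mvfderiv (𝓡 d) Φ p (VectorField.mlieBracket (𝓡 d) X Y p) =
      mvfderiv (𝓡 d) (fun q => mvfderiv (𝓡 d) Φ q (Y q)) p (X p) -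
      mvfderiv (𝓡 d) (fun q => mvfderiv (𝓡 d) Φ q (X q)) p (Y p) := by
  have hp := mem_extChartAt_source (I := 𝓡 d) p
  have hΦ' := contDiffAt_comp_extChartAt_symm hp hΦ
  have hc : ∀ {X : VField d M}, X.SmoothAt p → DifferentiableAt ℝ
      (X.coord p ∘ (extChartAt (𝓡 d) p).symm) (extChartAt (𝓡 d) p p) := fun hX =>
    (contDiffAt_comp_extChartAt_symm hp ((VField.smoothAt_iff hp).1 hX)).differentiableAt (by simp)
  have hD : DifferentiableAt ℝ (fderiv ℝ (Φ ∘ (extChartAt (𝓡 d) p).symm))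
      (extChartAt (𝓡 d) p p) :=
    (hΦ'.fderiv_right (m := ∞) (by simp)).differentiableAt (by simp)
  have key : ∀ {X Y : VField d M}, X.SmoothAt p → Y.SmoothAt p →
      mvfderiv (𝓡 d) (fun q => mvfderiv (𝓡 d) Φ q (Y q)) p (X p) =
      fderiv ℝ (fderiv ℝ (Φ ∘ (extChartAt (𝓡 d) p).symm)) (extChartAt (𝓡 d) p p) (X.coord p p)
        (Y.coord p p) + fderiv ℝ (Φ ∘ (extChartAt (𝓡 d) p).symm) (extChartAt (𝓡 d) p p)
        (fderiv ℝ (Y.coord p ∘ (extChartAt (𝓡 d) p).symm) (extChartAt (𝓡 d) p p)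
          (X.coord p p)) := by
    intro X Y hX hY
    rw [mvfderiv_eq_fderiv_chart hp ((hY.contMDiffAt_mvfderiv hΦ).mdifferentiableAt (by simp))]
    have h1 : (fun q => mvfderiv (𝓡 d) Φ q (Y q)) ∘ (extChartAt (𝓡 d) p).symm
        =ᶠ[𝓝 (extChartAt (𝓡 d) p p)] fun y => fderiv ℝ (Φ ∘ (extChartAt (𝓡 d) p).symm) y
          ((Y.coord p ∘ (extChartAt (𝓡 d) p).symm) y) := by
      have h2 : ∀ᶠ z in 𝓝 p, ContMDiffAt (𝓡 d) 𝓘(ℝ, F) 1 Φ z :=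
        (contMDiffAt_iff_contMDiffAt_nhds (n := 1) (by simp)).1 (hΦ.of_le (by simp))
      have h3 := (continuousAt_extChartAt_symm (I := 𝓡 d) p)
      rw [ContinuousAt, extChartAt_to_inv] at h3
      filter_upwards [(isOpen_extChartAt_target p).mem_nhds (mem_extChartAt_target p),
        h3.eventually h2] with y hy hy2
      have h4 := mvfderiv_eq_fderiv_chart ((extChartAt (𝓡 d) p).map_target hy)
        (hy2.mdifferentiableAt (by simp)) (Y ((extChartAt (𝓡 d) p).symm y))
      rw [(extChartAt (𝓡 d) p).right_inv hy] at h4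
      exact h4
    rw [h1.fderiv_eq, fderiv_clm_apply hD (hc hY)]
    simp only [add_apply, ContinuousLinearMap.comp_apply,
      ContinuousLinearMap.flip_apply, Function.comp_apply, extChartAt_to_inv]
    rw [add_comm]
    rfl
  rw [key hX hY, key hY hX, mvfderiv_eq_fderiv_chart hp (hΦ.mdifferentiableAt (by simp)),
    mvfderiv_extChartAt_mlieBracket, VectorField.lieBracket_eq, map_sub]
  have hs : IsSymmSndFDerivAt ℝ (Φ ∘ (extChartAt (𝓡 d) p).symm) (extChartAt (𝓡 d) p p) :=
    hΦ'.isSymmSndFDerivAt (by simpa using WithTop.coe_le_coe.2 (le_top (a := (2 : ℕ∞))))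
  rw [hs.eq (X.coord p p)]
  simp only [Function.comp_apply, extChartAt_to_inv]
  abel

end VectorFields

/-! ### One-forms in charts -/

section OneForms

variable {d : ℕ} {M : Type*} [TopologicalSpace M] [ChartedSpace (EuclideanSpace ℝ (Fin d)) M]

theorem exists_smooth_cutoff [IsManifold (𝓡 d) ∞ M] [T2Space M] {p : M} {U : Set M} (hU : U ∈ 𝓝 p) :
    ∃ ψ : M → ℝ, ContMDiff (𝓡 d) 𝓘(ℝ, ℝ) ∞ ψ ∧ ψ =ᶠ[𝓝 p] 1 ∧ tsupport ψ ⊆ U := by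
  obtain ⟨f, -, hf⟩ := (SmoothBumpFunction.nhds_basis_tsupport (I := 𝓡 d) p).mem_iff.1 hU
  exact ⟨f, f.contMDiff, f.eventuallyEq_one, hf⟩

variable [IsManifold (𝓡 d) ∞ M]

theorem VField.SmoothOn.smooth_smul {X : VField d M} {U : Set M} (hX : X.SmoothOn U)
    (hU : IsOpen U) {ψ : M → ℝ} (hψ : ContMDiff (𝓡 d) 𝓘(ℝ, ℝ) ∞ ψ) (hψU : tsupport ψ ⊆ U) :
    VField.Smooth (ψ • X : VField d M) :=
  ContMDiffOn.smul_section_of_tsupport hψ.contMDiffOn hU hψU hX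

theorem VField.SmoothOn.smoothAt {X : VField d M} {U : Set M} (hX : X.SmoothOn U)
    (hU : IsOpen U) {p : M} (hp : p ∈ U) : X.SmoothAt p :=
  ContMDiffOn.contMDiffAt hX (hU.mem_nhds hp)

theorem VField.smoothOn_of_smoothAt {X : VField d M} {U : Set M} (h : ∀ p ∈ U, X.SmoothAt p) :
    X.SmoothOn U := fun p hp => (h p hp).contMDiffWithinAt

theorem VField.SmoothAt.mlieBracket {X Y : VField d M} {p : M} (hX : X.SmoothAt p)
    (hY : Y.SmoothAt p) :
    VField.SmoothAt (VectorField.mlieBracket (𝓡 d) X Y : VField d M) p := by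
  have : IsManifold (𝓡 d) (((⊤ : ℕ∞) : WithTop ℕ∞) + 1) M := by simpa
  have : IsManifold (𝓡 d) (minSmoothness ℝ 2) M :=
    IsManifold.of_le (n := ∞) (by simpa using WithTop.coe_le_coe.2 (le_top (a := (2 : ℕ∞))))
  exact ContMDiffAt.mlieBracket_vectorField (m := ⊤) (n := ⊤) hX hY (by simp)

theorem OneForm.Smooth.contMDiffAt [T2Space M] {η : OneForm d M} (hη : η.Smooth) {X : VField d M}
    {U : Set M} (hX : X.SmoothOn U) (hU : IsOpen U) {p : M} (hp : p ∈ U) :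
    ContMDiffAt (𝓡 d) 𝓘(ℝ, ℝ) ∞ (fun q => η q (X q)) p := by
  obtain ⟨ψ, hψ, hψ1, hψU⟩ := exists_smooth_cutoff (d := d) (hU.mem_nhds hp)
  refine (hη _ (hX.smooth_smul hU hψ hψU) p).congr_of_eventuallyEq ?_
  filter_upwards [hψ1] with q hq
  simp [hq]

theorem OneForm.Smooth.contDiffOn_inChart [T2Space M] {η : OneForm d M} (hη : η.Smooth) (x₀ : M) :
    ContDiffOn ℝ ∞ (η.inChart x₀) (extChartAt (𝓡 d) x₀).target := by
  rw [contDiffOn_clm_apply]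
  intro v y hy
  have hs : (VField.ofCoord x₀ (fun _ => v) : VField d M).SmoothOn (extChartAt (𝓡 d) x₀).source :=
    VField.smoothOn_of_smoothAt fun q hq => VField.smoothAt_ofCoord hq contMDiffAt_const
  have h1 := hη.contMDiffAt hs (isOpen_extChartAt_source x₀)
    ((extChartAt (𝓡 d) x₀).map_target hy)
  have h2 := contDiffAt_comp_extChartAt_symm ((extChartAt (𝓡 d) x₀).map_target hy) h1
  rw [(extChartAt (𝓡 d) x₀).right_inv hy] at h2
  refine (h2.congr_of_eventuallyEq ?_).contDiffWithinAt
  filter_upwards [(isOpen_extChartAt_target x₀).mem_nhds hy] with z hz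
  refine congrArg (η ((extChartAt (𝓡 d) x₀).symm z)) ?_
  refine injective_mvfderiv_extChartAt ((extChartAt (𝓡 d) x₀).map_target hz) ?_
  refine Eq.trans ?_ (VField.coord_ofCoord x₀ (fun _ => v)
    ((extChartAt (𝓡 d) x₀).map_target hz)).symm
  have h3 := mfderiv_extChartAt_comp_mfderivWithin_extChartAt_symm (I := 𝓡 d) hz
  rw [ModelWithCorners.range_eq_univ, mfderivWithin_univ] at h3
  exact congrArg (fun L => L v) h3

/-- The expression of a one-form in a chart, evaluated on the coordinates of a vector. -/
theorem OneForm.inChart_mvfderiv (η : OneForm d M) {x₀ q : M}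
    (hq : q ∈ (extChartAt (𝓡 d) x₀).source) (v : TangentSpace (𝓡 d) q) :
    η.inChart x₀ (extChartAt (𝓡 d) x₀ q) (mvfderiv (𝓡 d) (extChartAt (𝓡 d) x₀) q v) = η q v := by
  have h3 := mfderivWithin_extChartAt_symm_comp_mfderiv_extChartAt' (I := 𝓡 d) hq
  rw [ModelWithCorners.range_eq_univ, mfderivWithin_univ] at h3
  have h0 : (extChartAt (𝓡 d) x₀).symm (extChartAt (𝓡 d) x₀ q) = q :=
    (extChartAt (𝓡 d) x₀).left_inv hq
  unfold OneForm.inChart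
  have h4 : ∀ {q' : M} (h : q' = q) (L : TangentSpace (𝓡 d) q →L[ℝ] TangentSpace (𝓡 d) q'),
      (∀ w : EuclideanSpace ℝ (Fin d), (L w : EuclideanSpace ℝ (Fin d)) = w) →
      η q' (L v) = η q v := by
    rintro q' rfl L hL
    exact congrArg (η q') (hL v)
  exact h4 h0 ((mfderiv 𝓘(ℝ, EuclideanSpace ℝ (Fin d)) (𝓡 d) (extChartAt (𝓡 d) x₀).symm
    (extChartAt (𝓡 d) x₀ q)).comp
      (mfderiv (𝓡 d) 𝓘(ℝ, EuclideanSpace ℝ (Fin d)) (extChartAt (𝓡 d) x₀) q))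
    fun w => congrArg (fun L => L w) h3

/-- A smooth one-form is smooth on vector fields which are smooth at a point. -/
theorem OneForm.Smooth.contMDiffAt' [T2Space M] {η : OneForm d M} (hη : η.Smooth) {X : VField d M}
    {p : M} (hX : X.SmoothAt p) : ContMDiffAt (𝓡 d) 𝓘(ℝ, ℝ) ∞ (fun q => η q (X q)) p := by
  have hp := mem_extChartAt_source (I := 𝓡 d) p
  have h1 : ContMDiffAt (𝓡 d) 𝓘(ℝ, EuclideanSpace ℝ (Fin d) →L[ℝ] ℝ) ∞
      (fun q => η.inChart p (extChartAt (𝓡 d) p q)) p :=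
    ((hη.contDiffOn_inChart p).contDiffAt ((isOpen_extChartAt_target p).mem_nhds
      (mem_extChartAt_target p))).contMDiffAt.comp p (contMDiffAt_extChartAt_of_mem hp)
  refine (h1.clm_apply ((VField.smoothAt_iff hp).1 hX)).congr_of_eventuallyEq ?_
  filter_upwards [(isOpen_extChartAt_source p).mem_nhds hp] with q hq
  exact (η.inChart_mvfderiv hq _).symm

variable {m : ℕ}

local notation "𝔼" => EuclideanSpace ℝ (Fin m)

/-- The chain rule for the preferred chart at `p` along a map `κ` into the manifold. -/
theorem mvfderiv_extChartAt_mfderiv {κ : 𝔼 → M} {p : M} {y : 𝔼}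
    (hy : κ y ∈ (extChartAt (𝓡 d) p).source) (hκ : MDifferentiableAt 𝓘(ℝ, 𝔼) (𝓡 d) κ y) (v : 𝔼) :
    mvfderiv (𝓡 d) (extChartAt (𝓡 d) p) (κ y) (mfderiv 𝓘(ℝ, 𝔼) (𝓡 d) κ y v) =
      fderiv ℝ (extChartAt (𝓡 d) p ∘ κ) y v := by
  have h1 := mfderiv_comp y (mdifferentiableAt_extChartAt (I := 𝓡 d) (x := p)
    (by rwa [extChartAt_source] at hy)) hκ
  rw [← mfderiv_eq_fderiv]
  exact (congrArg (fun L => L v) h1).symm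

theorem contDiffAt_extChartAt_comp {κ : 𝔼 → M} {p : M} {y : 𝔼}
    (hy : κ y ∈ (extChartAt (𝓡 d) p).source) (hκ : ContMDiffAt 𝓘(ℝ, 𝔼) (𝓡 d) ∞ κ y) :
    ContDiffAt ℝ ∞ (extChartAt (𝓡 d) p ∘ κ) y :=
  ((contMDiffAt_extChartAt_of_mem hy).comp y hκ).contDiffAt

/-- The pull-back of a smooth one-form to a vector space is smooth. -/
theorem OneForm.Smooth.contDiffAt_comp_mfderiv [T2Space M] {η : OneForm d M} (hη : η.Smooth)
    {κ : 𝔼 → M} {U : Set 𝔼} (hU : IsOpen U) (hκ : ContMDiffOn 𝓘(ℝ, 𝔼) (𝓡 d) ∞ κ U)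
    {y : 𝔼} (hy : y ∈ U) :
    ContDiffAt ℝ ∞ (fun z => ((η (κ z)).comp (mfderiv 𝓘(ℝ, 𝔼) (𝓡 d) κ z) : 𝔼 →L[ℝ] ℝ)) y := by
  have hp := mem_extChartAt_source (I := 𝓡 d) (κ y)
  have hκy := hκ.contMDiffAt (hU.mem_nhds hy)
  have h1 : ContDiffAt ℝ ∞ (fun z => η.inChart (κ y) ((extChartAt (𝓡 d) (κ y) ∘ κ) z)) y :=
    ContDiffAt.comp y ((hη.contDiffOn_inChart (κ y)).contDiffAt
      ((isOpen_extChartAt_target (κ y)).mem_nhds (mem_extChartAt_target (κ y))))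
      (contDiffAt_extChartAt_comp hp hκy)
  have h2 : ContDiffAt ℝ ∞ (fderiv ℝ (extChartAt (𝓡 d) (κ y) ∘ κ)) y :=
    (contDiffAt_extChartAt_comp hp hκy).fderiv_right (by simp)
  refine (h1.clm_comp h2).congr_of_eventuallyEq ?_
  filter_upwards [hU.mem_nhds hy,
    hκy.continuousAt.preimage_mem_nhds ((isOpen_extChartAt_source (κ y)).mem_nhds hp)] with z hz hz'
  ext v
  refine (η.inChart_mvfderiv hz' (mfderiv 𝓘(ℝ, 𝔼) (𝓡 d) κ z v)).symm.trans ?_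
  rw [mvfderiv_extChartAt_mfderiv hz' ((hκ.contMDiffAt (hU.mem_nhds hz)).mdifferentiableAt
    (by simp))]
  rfl

/-- The expression of a pull-back in a chart is the pull-back by the inverse of the chart. -/
theorem OneForm.inChart_pullback (η : OneForm d M) {V : Type*} [TopologicalSpace V]
    [ChartedSpace 𝔼 V] [IsManifold (𝓡 m) ∞ V] {ι : V → M} (hι : ContMDiff (𝓡 m) (𝓡 d) ∞ ι)
    {x : V} {y : 𝔼} (hy : y ∈ (extChartAt (𝓡 m) x).target) :
    (η.pullback ι : OneForm m V).inChart x y = (η ((ι ∘ (extChartAt (𝓡 m) x).symm) y)).comp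
      (mfderiv 𝓘(ℝ, 𝔼) (𝓡 d) (ι ∘ (extChartAt (𝓡 m) x).symm) y) := by
  have hψ : MDifferentiableAt 𝓘(ℝ, 𝔼) (𝓡 m) (extChartAt (𝓡 m) x).symm y :=
    (contMDiffOn_extChartAt_symm (n := ∞) x).contMDiffAt
      ((isOpen_extChartAt_target x).mem_nhds hy) |>.mdifferentiableAt (by simp)
  rw [mfderiv_comp y (hι.mdifferentiableAt (by simp)) hψ]
  rfl

theorem VField.SmoothAt.smul {X : VField d M} {p : M} (hX : X.SmoothAt p) {f : M → ℝ}
    (hf : ContMDiffAt (𝓡 d) 𝓘(ℝ, ℝ) ∞ f p) : VField.SmoothAt (f • X : VField d M) p :=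
  ContMDiffAt.smul_section hf hX

theorem VField.SmoothAt.sub {X Y : VField d M} {p : M} (hX : X.SmoothAt p) (hY : Y.SmoothAt p) :
    VField.SmoothAt (X - Y : VField d M) p := ContMDiffAt.sub_section hX hY

end OneForms

/-- A D'Angelo form is smooth, by its formula on smooth vector fields. -/
theorem CRStructure.IsDAngeloForm.smooth {n : ℕ} {M : Type*} [TopologicalSpace M] [T2Space M]
    [ChartedSpace (EuclideanSpace ℝ (Fin (2 * n + 1))) M] [IsManifold (𝓡 (2 * n + 1)) ∞ M]
    {S : CRStructure n M} {α : OneForm (2 * n + 1) M} (hα : S.IsDAngeloForm α) : α.Smooth := by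
  obtain ⟨θ, T, hθ, hT, -, h⟩ := hα
  intro X hX p
  refine ContMDiffAt.congr_of_eventuallyEq ?_ (Eventually.of_forall fun q => h X hX q)
  exact hθ.smooth.contMDiffAt' ((hT.smoothAt p).mlieBracket
    ((hX.smoothAt p).sub ((hT.smoothAt p).smul (hθ.smooth.contMDiffAt' (hX.smoothAt p)))))

/-! ### Smooth left inverses -/

section Linear

variable {E G H : Type*} [NormedAddCommGroup E] [NormedSpace ℝ E]
  [NormedAddCommGroup G] [NormedSpace ℝ G] [FiniteDimensional ℝ G]
  [NormedAddCommGroup H] [NormedSpace ℝ H] [FiniteDimensional ℝ H]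

omit [FiniteDimensional ℝ G] in
theorem exists_clm_leftInverse {A : G →L[ℝ] H} (hA : Function.Injective A) :
    ∃ B : H →L[ℝ] G, B.comp A = ContinuousLinearMap.id ℝ G := by
  obtain ⟨B, hB⟩ := LinearMap.exists_leftInverse_of_injective (A : G →ₗ[ℝ] H)
    (LinearMap.ker_eq_bot.2 hA)
  refine ⟨LinearMap.toContinuousLinearMap B, ?_⟩
  ext v
  exact congrArg (fun L => L v) hB

theorem isOpen_setOf_isInvertible :
    IsOpen {L : G →L[ℝ] G | L.IsInvertible} := by
  have := FiniteDimensional.complete ℝ G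
  exact ContinuousLinearEquiv.isOpen

/-- A smooth family of injective linear maps has a smooth family of left inverses, locally. -/
theorem exists_contDiffOn_leftInverse {A : E → G →L[ℝ] H} {U : Set E} (hU : IsOpen U)
    (hA : ContDiffOn ℝ ∞ A U) {x : E} (hx : x ∈ U) (hinj : Function.Injective (A x)) :
    ∃ O ⊆ U, IsOpen O ∧ x ∈ O ∧ ∃ C : E → H →L[ℝ] G, ContDiffOn ℝ ∞ C O ∧
      ∀ y ∈ O, ∀ v, C y (A y v) = v := by
  have := FiniteDimensional.complete ℝ G
  obtain ⟨B, hB⟩ := exists_clm_leftInverse hinj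
  have h1 : ContDiffOn ℝ ∞ (fun y => B.comp (A y)) U := contDiffOn_const.clm_comp hA
  refine ⟨U ∩ (fun y => B.comp (A y)) ⁻¹' {L : G →L[ℝ] G | L.IsInvertible}, inter_subset_left,
    h1.continuousOn.isOpen_inter_preimage hU isOpen_setOf_isInvertible, ⟨hx, ?_⟩,
    fun y => (B.comp (A y)).inverse.comp B, ?_, ?_⟩
  · simp only [mem_preimage, hB, mem_ofPred_eq]
    exact ⟨ContinuousLinearEquiv.refl ℝ G, rfl⟩
  · intro y hy
    have h2 : ContDiffAt ℝ ∞ ContinuousLinearMap.inverse (B.comp (A y)) :=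
      ContinuousLinearMap.IsInvertible.contDiffAt_map_inverse hy.2
    have h3 : ContDiffAt ℝ ∞ (fun z => (B.comp (A z)).inverse) y :=
      ContDiffAt.comp (g := ContinuousLinearMap.inverse) y h2 (h1.contDiffAt (hU.mem_nhds hy.1))
    exact (h3.clm_comp contDiffAt_const).contDiffWithinAt
  · intro y hy v
    exact ContinuousLinearMap.IsInvertible.inverse_apply_self hy.2 v

/-- An immersion between vector spaces has a smooth local left inverse. -/
theorem exists_contDiffOn_retraction {F : G → H} {U : Set G} (hU : IsOpen U)
    (hF : ContDiffOn ℝ ∞ F U) {x : G} (hx : x ∈ U) (hinj : Function.Injective (fderiv ℝ F x)) :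
    ∃ O ⊆ U, IsOpen O ∧ x ∈ O ∧ ∃ (W : Set H) (π : H → G), IsOpen W ∧ ContDiffOn ℝ ∞ π W ∧
      MapsTo π W U ∧ ∀ y ∈ O, F y ∈ W ∧ π (F y) = y := by
  have := FiniteDimensional.complete ℝ G
  obtain ⟨B, hB⟩ := exists_clm_leftInverse hinj
  have hf : ContDiffOn ℝ ∞ (fun y => B (F y)) U := B.contDiff.comp_contDiffOn hF
  have hd : ∀ y ∈ U, HasFDerivAt (fun y => B (F y)) (B.comp (fderiv ℝ F y)) y := fun y hy =>
    B.hasFDerivAt.comp y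
      ((hF.contDiffAt (hU.mem_nhds hy)).differentiableAt (by simp)).hasFDerivAt
  have hx' : HasFDerivAt (fun y => B (F y))
      ((ContinuousLinearEquiv.refl ℝ G : G ≃L[ℝ] G) : G →L[ℝ] G)
      x := by
    have := hd x hx
    rwa [hB] at this
  let e := (hf.contDiffAt (hU.mem_nhds hx)).toOpenPartialHomeomorph (fun y => B (F y)) hx' (by simp)
  have he : ∀ y, e y = B (F y) := fun y => rfl
  have hxe : x ∈ e.source := ContDiffAt.mem_toOpenPartialHomeomorph_source _ hx' (by simp)
  have hc : ContinuousOn (fun y => B.comp (fderiv ℝ F y)) U :=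
    (contDiffOn_const.clm_comp (hF.fderiv_of_isOpen hU (m := ∞) (by simp))).continuousOn
  let U' := U ∩ (fun y => B.comp (fderiv ℝ F y)) ⁻¹' {L : G →L[ℝ] G | L.IsInvertible}
  have hU' : IsOpen U' := hc.isOpen_inter_preimage hU isOpen_setOf_isInvertible
  have hxU' : x ∈ U' := ⟨hx, by
    simp only [mem_preimage, hB, mem_ofPred_eq]
    exact ⟨ContinuousLinearEquiv.refl ℝ G, rfl⟩⟩
  have hO : IsOpen (e.source ∩ U') := e.open_source.inter hU'
  refine ⟨e.source ∩ U', fun y hy => hy.2.1, hO, ⟨hxe, hxU'⟩,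
    B ⁻¹' (e.target ∩ e.symm ⁻¹' U'), fun z => e.symm (B z),
    (e.symm.isOpen_inter_preimage hU').preimage B.continuous, ?_, ?_, ?_⟩
  · intro z hz
    obtain ⟨e', he'⟩ := hz.2.2
    have h1 : ContDiffAt ℝ ∞ e.symm (B z) := by
      refine e.contDiffAt_symm (f₀' := e') hz.1 ?_ (hf.contDiffAt (hU.mem_nhds hz.2.1))
      rw [he']
      exact hd _ hz.2.1
    exact (h1.comp z B.contDiff.contDiffAt).contDiffWithinAt
  · exact fun z hz => hz.2.1
  · intro y hy
    have h1 : e.symm (B (F y)) = y := e.left_inv hy.1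
    refine ⟨⟨e.map_source hy.1, ?_⟩, h1⟩
    simp only [mem_preimage, h1]
    exact hy.2

end Linear

/-! ### Frames of `T^{1,0}M` and charts of complex submanifolds -/

section Frame

variable {n : ℕ} {M : Type*} [TopologicalSpace M]
  [ChartedSpace (EuclideanSpace ℝ (Fin (2 * n + 1))) M] [IsManifold (𝓡 (2 * n + 1)) ∞ M]
  {S : CRStructure n M}

local notation "𝔼M" => EuclideanSpace ℝ (Fin (2 * n + 1))

/-- The coordinates of the real part of the complex combination `∑ cᵢ Zᵢ` of complex vector
fields, as a real-linear function of `c`. -/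
def frameMap (p₀ : M) (Z : Fin n → CVField (2 * n + 1) M) (q : M) : (Fin n → ℂ) →L[ℝ] 𝔼M :=
  ∑ i, ((Complex.reCLM.comp (ContinuousLinearMap.proj (R := ℝ) (φ := fun _ : Fin n => ℂ)
      i)).smulRight ((Z i).re.coord p₀ q) -
    (Complex.imCLM.comp (ContinuousLinearMap.proj (R := ℝ) (φ := fun _ : Fin n => ℂ)
      i)).smulRight ((Z i).im.coord p₀ q))

theorem Complexified.re_sum {V ι : Type*} [AddCommGroup V] (s : Finset ι) (f : ι → Complexified V) :
    (∑ i ∈ s, f i).re = ∑ i ∈ s, (f i).re :=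
  map_sum (⟨⟨Complexified.re, rfl⟩, fun _ _ => rfl⟩ : Complexified V →+ V) f s

theorem frameMap_apply (p₀ : M) (Z : Fin n → CVField (2 * n + 1) M) (q : M) (c : Fin n → ℂ) :
    frameMap p₀ Z q c = mvfderiv (𝓡 (2 * n + 1)) (extChartAt (𝓡 (2 * n + 1)) p₀) q
      (∑ i, c i • Z i q).re := by
  rw [Complexified.re_sum, map_sum, frameMap, sum_apply]
  refine Finset.sum_congr rfl fun i _ => ?_
  rw [Complexified.re_smul, map_sub, map_smul, map_smul]
  rfl

theorem frameMap_I_smul (p₀ : M) (Z : Fin n → CVField (2 * n + 1) M) (q : M) (c : Fin n → ℂ) :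
    frameMap p₀ Z q (Complex.I • c) = -mvfderiv (𝓡 (2 * n + 1)) (extChartAt (𝓡 (2 * n + 1)) p₀) q
      (∑ i, c i • Z i q).im := by
  rw [frameMap_apply, ← map_neg]
  congr 1
  have : ∑ i, (Complex.I • c) i • Z i q = Complex.I • ∑ i, c i • Z i q := by
    rw [Finset.smul_sum]
    exact Finset.sum_congr rfl fun i _ => by rw [Pi.smul_apply, smul_eq_mul, mul_smul]
  rw [this]
  simp

/-- A vector of `T^{1,0}M` is determined by its real part: a purely imaginary one is the negative of
its conjugate. -/
theorem CRStructure.eq_zero_of_re_eq_zero (S : CRStructure n M) {p : M}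
    {z : Complexified (TangentSpace (𝓡 (2 * n + 1)) p)} (hz : z ∈ S.T10 p) (h : z.re = 0) :
    z = 0 := by
  refine S.eq_zero_of_conj_mem p z hz ?_
  have : z.conj = -z := by
    ext1
    · change z.re = -z.re
      rw [h, neg_zero]
    · rfl
  rw [this]
  exact Submodule.neg_mem _ hz

theorem frameMap_injective {p₀ q : M} {Z : Fin n → CVField (2 * n + 1) M}
    (hq : q ∈ (extChartAt (𝓡 (2 * n + 1)) p₀).source) (hZ : ∀ i, Z i q ∈ S.T10 q)
    (hli : LinearIndependent ℂ (fun i => Z i q)) : Function.Injective (frameMap p₀ Z q) := by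
  rw [injective_iff_map_eq_zero]
  intro c hc
  rw [frameMap_apply, ← map_zero (mvfderiv (𝓡 (2 * n + 1)) (extChartAt (𝓡 (2 * n + 1)) p₀) q)] at hc
  have h1 := injective_mvfderiv_extChartAt hq hc
  have h2 := S.eq_zero_of_re_eq_zero
    (Submodule.sum_mem _ fun i _ => Submodule.smul_mem _ (c i) (hZ i)) h1
  exact funext (Fintype.linearIndependent_iff.1 hli c h2)

/-- `n` independent vectors of `T^{1,0}M` span it. -/
theorem exists_frame_coefficients (hn : 1 ≤ n) {q : M} {Z : Fin n → CVField (2 * n + 1) M}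
    (hZ : ∀ i, Z i q ∈ S.T10 q) (hli : LinearIndependent ℂ (fun i => Z i q))
    {z : Complexified (TangentSpace (𝓡 (2 * n + 1)) q)} (hz : z ∈ S.T10 q) :
    ∃ c : Fin n → ℂ, ∑ i, c i • Z i q = z := by
  have h1 : Submodule.span ℂ (range fun i => Z i q) = S.T10 q := by
    have h0 := S.finrank_eq q
    have : Module.Finite ℂ (S.T10 q) := Module.finite_of_finrank_pos (lt_of_lt_of_eq hn h0.symm)
    refine Submodule.eq_of_le_of_finrank_eq (Submodule.span_le.2 ?_) ?_
    · rintro _ ⟨i, rfl⟩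
      exact hZ i
    · rw [finrank_span_eq_card hli, h0, Fintype.card_fin]
  rw [← h1] at hz
  exact (Submodule.mem_span_range_iff_exists_fun ℂ).1 hz

variable {m : ℕ} {V : Type*} [TopologicalSpace V] [ChartedSpace (EuclideanSpace ℝ (Fin m)) V]
  [IsManifold (𝓡 m) ∞ V] {ι : V → M}

local notation "𝔼" => EuclideanSpace ℝ (Fin m)

/-- The parametrisation of the image of `ι` by the inverse of the preferred chart at `x₀`. -/
abbrev chartMap (ι : V → M) (x₀ : V) : 𝔼 → M := ι ∘ (extChartAt (𝓡 m) x₀).symm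

theorem CRStructure.IsComplexSubmanifold.contMDiffOn_chartMap (hV : S.IsComplexSubmanifold m ι)
    (x₀ : V) : ContMDiffOn 𝓘(ℝ, 𝔼) (𝓡 (2 * n + 1)) ∞ (chartMap ι x₀)
      (extChartAt (𝓡 m) x₀).target :=
  hV.contMDiff.comp_contMDiffOn (contMDiffOn_extChartAt_symm x₀)

theorem mfderiv_chartMap (hι : ContMDiff (𝓡 m) (𝓡 (2 * n + 1)) ∞ ι) {x₀ : V} {y : 𝔼}
    (hy : y ∈ (extChartAt (𝓡 m) x₀).target) :
    mfderiv 𝓘(ℝ, 𝔼) (𝓡 (2 * n + 1)) (chartMap ι x₀) y =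
      (mfderiv (𝓡 m) (𝓡 (2 * n + 1)) ι ((extChartAt (𝓡 m) x₀).symm y)).comp
        (mfderiv 𝓘(ℝ, 𝔼) (𝓡 m) (extChartAt (𝓡 m) x₀).symm y) :=
  mfderiv_comp y (hι.mdifferentiableAt (by simp))
    ((contMDiffOn_extChartAt_symm (n := ∞) x₀).contMDiffAt
      ((isOpen_extChartAt_target x₀).mem_nhds hy) |>.mdifferentiableAt (by simp))

theorem isInvertible_mfderiv_extChartAt_symm' {x₀ : V} {y : 𝔼}
    (hy : y ∈ (extChartAt (𝓡 m) x₀).target) :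
    (mfderiv 𝓘(ℝ, 𝔼) (𝓡 m) (extChartAt (𝓡 m) x₀).symm y).IsInvertible := by
  have := isInvertible_mfderivWithin_extChartAt_symm (I := 𝓡 m) hy
  rwa [ModelWithCorners.range_eq_univ, mfderivWithin_univ] at this

theorem CRStructure.IsComplexSubmanifold.injective_mfderiv_chartMap
    (hV : S.IsComplexSubmanifold m ι) {x₀ : V} {y : 𝔼} (hy : y ∈ (extChartAt (𝓡 m) x₀).target) :
    Function.Injective (mfderiv 𝓘(ℝ, 𝔼) (𝓡 (2 * n + 1)) (chartMap ι x₀) y) := by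
  rw [mfderiv_chartMap hV.contMDiff hy]
  exact (hV.mfderiv_injective _).comp (isInvertible_mfderiv_extChartAt_symm' hy).injective

theorem CRStructure.IsComplexSubmanifold.exists_isJb_chartMap
    (hV : S.IsComplexSubmanifold m ι) {x₀ : V} {y : 𝔼} (hy : y ∈ (extChartAt (𝓡 m) x₀).target)
    (v : 𝔼) : ∃ w : 𝔼, S.IsJb (chartMap ι x₀ y)
      (mfderiv 𝓘(ℝ, 𝔼) (𝓡 (2 * n + 1)) (chartMap ι x₀) y v)
      (mfderiv 𝓘(ℝ, 𝔼) (𝓡 (2 * n + 1)) (chartMap ι x₀) y w) := by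
  obtain ⟨w, hw⟩ := hV.jb_invariant ((extChartAt (𝓡 m) x₀).symm y)
    (mfderiv 𝓘(ℝ, 𝔼) (𝓡 m) (extChartAt (𝓡 m) x₀).symm y v)
  obtain ⟨u, rfl⟩ := (isInvertible_mfderiv_extChartAt_symm' hy).bijective.2 w
  refine ⟨u, ?_⟩
  rw [mfderiv_chartMap hV.contMDiff hy]
  exact hw

end Frame

/-! ### Extension of tangent vectors to sections of `T^{1,0}M` -/

section Sections

variable {n : ℕ} {M : Type*} [TopologicalSpace M]
  [ChartedSpace (EuclideanSpace ℝ (Fin (2 * n + 1))) M] [IsManifold (𝓡 (2 * n + 1)) ∞ M]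
  {S : CRStructure n M}
  {m : ℕ} {V : Type*} [TopologicalSpace V] [ChartedSpace (EuclideanSpace ℝ (Fin m)) V]
  [IsManifold (𝓡 m) ∞ V] {ι : V → M}

local notation "𝔼M" => EuclideanSpace ℝ (Fin (2 * n + 1))
local notation "𝔼" => EuclideanSpace ℝ (Fin m)

theorem contMDiffAt_frameMap {p₀ q : M} {Z : Fin n → CVField (2 * n + 1) M}
    (hq : q ∈ (extChartAt (𝓡 (2 * n + 1)) p₀).source)
    (hZ : ∀ i, (Z i).re.SmoothAt q ∧ (Z i).im.SmoothAt q) :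
    ContMDiffAt (𝓡 (2 * n + 1)) 𝓘(ℝ, (Fin n → ℂ) →L[ℝ] 𝔼M) ∞ (frameMap p₀ Z) q := by
  have h1 : ∀ (L : (Fin n → ℂ) →L[ℝ] ℝ) {X : VField (2 * n + 1) M}, X.SmoothAt q →
      ContMDiffAt (𝓡 (2 * n + 1)) 𝓘(ℝ, (Fin n → ℂ) →L[ℝ] 𝔼M) ∞
      (fun z => L.smulRight (X.coord p₀ z)) q := fun L X hX =>
    (ContinuousLinearMap.smulRightL ℝ (Fin n → ℂ) 𝔼M L).contMDiff.contMDiffAt.comp q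
      ((VField.smoothAt_iff hq).1 hX)
  have h2 : frameMap p₀ Z = fun z => ∑ i, _ := rfl
  rw [h2]
  exact ContMDiffAt.sum fun i _ => (h1 _ (hZ i).1).sub (h1 _ (hZ i).2)

/-- A combination of a local frame with smooth coefficients, cut off, is a global section. -/
theorem isSection_smul_sum {p₀ : M} {Z : Fin n → CVField (2 * n + 1) M} {U : Set M} (hU : IsOpen U)
    (hUs : U ⊆ (extChartAt (𝓡 (2 * n + 1)) p₀).source)
    (hZs : ∀ q ∈ U, ∀ i, (Z i).re.SmoothAt q ∧ (Z i).im.SmoothAt q)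
    (hZm : ∀ q ∈ U, ∀ i, Z i q ∈ S.T10 q) {c : M → Fin n → ℂ}
    (hc : ∀ q ∈ U, ContMDiffAt (𝓡 (2 * n + 1)) 𝓘(ℝ, Fin n → ℂ) ∞ c q) {ψ : M → ℝ}
    (hψ : ContMDiff (𝓡 (2 * n + 1)) 𝓘(ℝ, ℝ) ∞ ψ) (hψU : tsupport ψ ⊆ U) :
    S.IsSection (fun q => (ψ q : ℂ) • ∑ i, c q i • Z i q) := by
  let iC : (Fin n → ℂ) →L[ℝ] (Fin n → ℂ) := ContinuousLinearMap.lsmul ℝ ℂ Complex.I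
  have hfs : ∀ q ∈ U, ∀ {c : M → Fin n → ℂ},
      ContMDiffAt (𝓡 (2 * n + 1)) 𝓘(ℝ, Fin n → ℂ) ∞ c q →
      ContMDiffAt (𝓡 (2 * n + 1)) 𝓘(ℝ, 𝔼M) ∞ (fun q => frameMap p₀ Z q (c q)) q :=
    fun q hq c hc => (contMDiffAt_frameMap (hUs hq) (hZs q hq)).clm_apply hc
  let Y : CVField (2 * n + 1) M := fun q => ∑ i, c q i • Z i q
  have hY : Y.SmoothOn U := by
    constructor
    · refine VField.smoothOn_of_smoothAt fun q hq => (VField.smoothAt_iff (hUs hq)).2 ?_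
      refine (hfs q hq (hc q hq)).congr_of_eventuallyEq (Eventually.of_forall fun z => ?_)
      exact (frameMap_apply p₀ Z z (c z)).symm
    · refine VField.smoothOn_of_smoothAt fun q hq => (VField.smoothAt_iff (hUs hq)).2 ?_
      have h1 : ContMDiffAt (𝓡 (2 * n + 1)) 𝓘(ℝ, Fin n → ℂ) ∞ (fun z => Complex.I • c z) q :=
        iC.contMDiff.contMDiffAt.comp q (hc q hq)
      refine (hfs q hq h1).neg.congr_of_eventuallyEq (Eventually.of_forall fun z => ?_)
      have := frameMap_I_smul p₀ Z z (c z)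
      simp only [this, neg_neg]
      rfl
  refine ⟨⟨?_, ?_⟩, fun q => ?_⟩
  · have := hY.1.smooth_smul hU hψ hψU
    refine this.congr fun q => ?_
    congr 1
    simp only [CVField.re, Complexified.re_smul, Complex.ofReal_re, Complex.ofReal_im, zero_smul,
      sub_zero]
    rfl
  · have := hY.2.smooth_smul hU hψ hψU
    refine this.congr fun q => ?_
    congr 1
    simp only [CVField.im, Complexified.im_smul, Complex.ofReal_re, Complex.ofReal_im, zero_smul,
      add_zero]
    rfl
  · by_cases hq : q ∈ U
    · exact Submodule.smul_mem _ _ (Submodule.sum_mem _ fun i _ =>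
        Submodule.smul_mem _ _ (hZm q hq i))
    · have : ψ q = 0 := image_eq_zero_of_notMem_tsupport fun h => hq (hψU h)
      simp [this]

/-- Every vector of `T^{1,0}M` extends to a global section. -/
theorem CRStructure.exists_section [T2Space M] (S : CRStructure n M) (hn : 1 ≤ n) {p : M}
    {z : Complexified (TangentSpace (𝓡 (2 * n + 1)) p)} (hz : z ∈ S.T10 p) :
    ∃ W : CVField (2 * n + 1) M, S.IsSection W ∧ W p = z := by
  obtain ⟨U, hU, hpU, Z, hZs, hZm, hZi⟩ := S.exists_local_frame p
  obtain ⟨c, hc⟩ := exists_frame_coefficients hn (hZm p hpU) (hZi p hpU) hz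
  have hU' : IsOpen (U ∩ (extChartAt (𝓡 (2 * n + 1)) p).source) :=
    hU.inter (isOpen_extChartAt_source p)
  obtain ⟨ψ, hψ, hψ1, hψU⟩ := exists_smooth_cutoff (d := 2 * n + 1)
    (hU'.mem_nhds ⟨hpU, mem_extChartAt_source p⟩)
  refine ⟨_, isSection_smul_sum hU' inter_subset_right
    (fun q hq i => ⟨(hZs i).1.smoothAt hU hq.1, (hZs i).2.smoothAt hU hq.1⟩)
    (fun q hq => hZm q hq.1) (c := fun _ => c) (fun q _ => contMDiffAt_const) hψ hψU, ?_⟩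
  have h1 : ψ p = 1 := hψ1.self_of_nhds
  simp only [h1, Complex.ofReal_one, one_smul, hc]

/-- Near a point of a complex submanifold, the complex structure `J` of the submanifold is smooth
in a chart, and the constant vector fields `v` of the chart extend to sections `Z` of `T^{1,0}M`
with `Z = v - i J v` along the submanifold. -/
theorem CRStructure.IsComplexSubmanifold.exists_sections [T2Space M] (hn : 1 ≤ n)
    (hV : S.IsComplexSubmanifold m ι) (x₀ : V) :
    ∃ O ⊆ (extChartAt (𝓡 m) x₀).target, IsOpen O ∧ extChartAt (𝓡 m) x₀ x₀ ∈ O ∧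
      ∃ J : 𝔼 → 𝔼 →L[ℝ] 𝔼, ContDiffOn ℝ ∞ J O ∧
        ∀ v : 𝔼, ∃ Z : CVField (2 * n + 1) M, S.IsSection Z ∧ ∀ y ∈ O, Z (chartMap ι x₀ y) =
          Complexified.mk (mfderiv 𝓘(ℝ, 𝔼) (𝓡 (2 * n + 1)) (chartMap ι x₀) y v)
            (-mfderiv 𝓘(ℝ, 𝔼) (𝓡 (2 * n + 1)) (chartMap ι x₀) y (J y v)) := by
  set κ : 𝔼 → M := chartMap ι x₀ with hκ
  set p₀ := ι x₀ with hp₀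
  set T := (extChartAt (𝓡 m) x₀).target with hT
  set c₀ := extChartAt (𝓡 m) x₀ x₀ with hc₀
  set φ := extChartAt (𝓡 (2 * n + 1)) p₀ with hφ
  have hTo : IsOpen T := isOpen_extChartAt_target x₀
  have hcT : c₀ ∈ T := mem_extChartAt_target x₀
  have hκc : κ c₀ = p₀ := by simp [hκ, hc₀, hp₀, chartMap]
  have hκs : ContMDiffOn 𝓘(ℝ, 𝔼) (𝓡 (2 * n + 1)) ∞ κ T := hV.contMDiffOn_chartMap x₀
  obtain ⟨U, hU, hpU, Z, hZs, hZm, hZi⟩ := S.exists_local_frame p₀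
  have hZs' : ∀ q ∈ U, ∀ i, (Z i).re.SmoothAt q ∧ (Z i).im.SmoothAt q := fun q hq i =>
    ⟨(hZs i).1.smoothAt hU hq, (hZs i).2.smoothAt hU hq⟩
  set U₁ := U ∩ φ.source with hU₁
  have hU₁o : IsOpen U₁ := hU.inter (isOpen_extChartAt_source p₀)
  have hpU₁ : p₀ ∈ U₁ := ⟨hpU, mem_extChartAt_source p₀⟩
  have hT₁o : IsOpen (T ∩ κ ⁻¹' U₁) := hκs.continuousOn.isOpen_inter_preimage hTo hU₁o
  have hκa : ∀ y ∈ T, ContMDiffAt 𝓘(ℝ, 𝔼) (𝓡 (2 * n + 1)) ∞ κ y := fun y hy =>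
    hκs.contMDiffAt (hTo.mem_nhds hy)
  have hA : ContDiffOn ℝ ∞ (fun y => frameMap p₀ Z (κ y)) (T ∩ κ ⁻¹' U₁) := fun y hy =>
    (((contMDiffAt_frameMap hy.2.2 (hZs' _ hy.2.1)).comp y
      (hκa y hy.1)).contDiffAt).contDiffWithinAt
  have hF : ContDiffOn ℝ ∞ (φ ∘ κ) (T ∩ κ ⁻¹' U₁) := fun y hy =>
    (contDiffAt_extChartAt_comp hy.2.2 (hκa y hy.1)).contDiffWithinAt
  have hDF : ∀ y ∈ T ∩ κ ⁻¹' U₁, ∀ v : 𝔼, fderiv ℝ (φ ∘ κ) y v = mvfderiv (𝓡 (2 * n + 1)) φ (κ y)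
      (mfderiv 𝓘(ℝ, 𝔼) (𝓡 (2 * n + 1)) κ y v) := fun y hy v =>
    (mvfderiv_extChartAt_mfderiv hy.2.2 ((hκa y hy.1).mdifferentiableAt (by simp)) v).symm
  have hDFi : ∀ y ∈ T ∩ κ ⁻¹' U₁, Function.Injective (fderiv ℝ (φ ∘ κ) y) := by
    intro y hy a b hab
    rw [hDF y hy, hDF y hy] at hab
    exact hV.injective_mfderiv_chartMap hy.1 (injective_mvfderiv_extChartAt hy.2.2 hab)
  have hc₁ : c₀ ∈ T ∩ κ ⁻¹' U₁ := ⟨hcT, by rw [mem_preimage, hκc]; exact hpU₁⟩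
  obtain ⟨O₁, hO₁, hO₁o, hcO₁, C, hC, hCA⟩ := exists_contDiffOn_leftInverse hT₁o hA hc₁
    (frameMap_injective hc₁.2.2 (hZm _ hc₁.2.1) (hZi _ hc₁.2.1))
  have hDFs : ContDiffOn ℝ ∞ (fderiv ℝ (φ ∘ κ)) O₁ :=
    (hF.mono hO₁).fderiv_of_isOpen hO₁o (by simp)
  obtain ⟨O₂, hO₂, hO₂o, hcO₂, Λ, hΛ, hΛF⟩ := exists_contDiffOn_leftInverse hO₁o hDFs hcO₁
    (hDFi c₀ hc₁)
  obtain ⟨O₃, hO₃, hO₃o, hcO₃, W, π, hW, hπ, hπO, hπF⟩ := exists_contDiffOn_retraction hO₂o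
    ((hF.mono hO₁).mono hO₂) hcO₂ (hDFi c₀ hc₁)
  -- `C` inverts the frame, `Λ` inverts the differential of the submanifold, and `π` retracts onto
  -- the submanifold. So `J` reads off the coefficients of a tangent vector in the frame, multiplies
  -- them by `i`, and returns to the chart of the submanifold.
  let iC : (Fin n → ℂ) →L[ℝ] (Fin n → ℂ) := ContinuousLinearMap.lsmul ℝ ℂ Complex.I
  let J : 𝔼 → 𝔼 →L[ℝ] 𝔼 := fun y =>
    (Λ y).comp ((frameMap p₀ Z (κ y)).comp (iC.comp ((C y).comp (fderiv ℝ (φ ∘ κ) y))))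
  have hJs : ContDiffOn ℝ ∞ J O₂ := hΛ.clm_comp (((hA.mono hO₁).mono hO₂).clm_comp
    (contDiffOn_const.clm_comp ((hC.mono hO₂).clm_comp (hDFs.mono hO₂))))
  have hJ : ∀ y ∈ O₂, ∀ v : 𝔼, ∑ i, C y (fderiv ℝ (φ ∘ κ) y v) i • Z i (κ y) =
      Complexified.mk (mfderiv 𝓘(ℝ, 𝔼) (𝓡 (2 * n + 1)) κ y v)
        (-mfderiv 𝓘(ℝ, 𝔼) (𝓡 (2 * n + 1)) κ y (J y v)) := by
    intro y hy v
    have hy₁ := hO₁ (hO₂ hy)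
    obtain ⟨w, hw⟩ := hV.exists_isJb_chartMap hy₁.1 v
    obtain ⟨c, hc⟩ := exists_frame_coefficients hn (hZm _ hy₁.2.1) (hZi _ hy₁.2.1) hw
    have h1 : frameMap p₀ Z (κ y) c = fderiv ℝ (φ ∘ κ) y v := by
      rw [frameMap_apply, hc, hDF y hy₁]
      rfl
    have h2 : frameMap p₀ Z (κ y) (Complex.I • c) = fderiv ℝ (φ ∘ κ) y w := by
      rw [frameMap_I_smul, hc, hDF y hy₁, Complexified.im_mk, map_neg, neg_neg]
    have h3 : C y (fderiv ℝ (φ ∘ κ) y v) = c := by rw [← h1, hCA y (hO₂ hy)]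
    have h4 : J y v = w := by
      change Λ y (frameMap p₀ Z (κ y) (Complex.I • C y (fderiv ℝ (φ ∘ κ) y v))) = w
      rw [h3, h2, hΛF y hy]
    rw [h3, h4, hc]
  -- the cutoff function
  have hU₂o : IsOpen (U₁ ∩ φ ⁻¹' W) := by
    have := (continuousOn_extChartAt (I := 𝓡 (2 * n + 1)) p₀).isOpen_inter_preimage
      (isOpen_extChartAt_source p₀) hW
    rw [hU₁, inter_assoc]
    exact hU.inter this
  have hpU₂ : p₀ ∈ U₁ ∩ φ ⁻¹' W := ⟨hpU₁, by
    have := (hπF c₀ hcO₃).1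
    rwa [Function.comp_apply, hκc] at this⟩
  obtain ⟨ψ, hψ, hψ1, hψU⟩ := exists_smooth_cutoff (d := 2 * n + 1) (hU₂o.mem_nhds hpU₂)
  obtain ⟨N, hN, hNo, hpN⟩ := mem_nhds_iff.1 hψ1
  refine ⟨O₃ ∩ (T ∩ κ ⁻¹' N), fun y hy => hy.2.1,
    hO₃o.inter (hκs.continuousOn.isOpen_inter_preimage hTo hNo),
    ⟨hcO₃, hcT, by rw [mem_preimage, hκc]; exact hpN⟩, J,
    hJs.mono fun y hy => hO₃ hy.1, fun v => ?_⟩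
  -- the coefficients of the section, extended off the submanifold by the retraction
  let c : M → Fin n → ℂ := fun q => C (π (φ q)) (fderiv ℝ (φ ∘ κ) (π (φ q)) v)
  have hcs : ∀ q ∈ U₁ ∩ φ ⁻¹' W,
      ContMDiffAt (𝓡 (2 * n + 1)) 𝓘(ℝ, Fin n → ℂ) ∞ c q := by
    intro q hq
    have h1 : ContDiffOn ℝ ∞ (fun y => C y (fderiv ℝ (φ ∘ κ) y v)) O₂ :=
      (hC.mono hO₂).clm_apply ((hDFs.mono hO₂).clm_apply contDiffOn_const)
    have h2 := (h1.comp hπ hπO).contDiffAt (hW.mem_nhds hq.2)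
    exact h2.contMDiffAt.comp q (contMDiffAt_extChartAt_of_mem hq.1.2)
  refine ⟨_, isSection_smul_sum hU₂o (fun q hq => hq.1.2) (fun q hq => hZs' q hq.1.1)
    (fun q hq => hZm q hq.1.1) hcs hψ hψU, fun y hy => ?_⟩
  have h1 : ψ (κ y) = 1 := hN hy.2.2
  have h2 : c (κ y) = C y (fderiv ℝ (φ ∘ κ) y v) := by
    change C (π ((φ ∘ κ) y)) (fderiv ℝ (φ ∘ κ) (π ((φ ∘ κ) y)) v) = _
    rw [(hπF y hy.1).2]
  change (ψ (κ y) : ℂ) • ∑ i, c (κ y) i • Z i (κ y) = _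
  rw [h1, h2, Complex.ofReal_one, one_smul]
  exact hJ y (hO₃ hy.1) v

end Sections

/-! ### The exterior derivative of a one-form -/

section ExteriorDerivative

variable {d : ℕ} {M : Type*} [TopologicalSpace M] [ChartedSpace (EuclideanSpace ℝ (Fin d)) M]
  [IsManifold (𝓡 d) ∞ M]

/-- The exterior derivative `dη (v, w)` of a one-form, computed in the preferred chart at `p`. -/
def OneForm.extDeriv (η : OneForm d M) (p : M) (v w : TangentSpace (𝓡 d) p) : ℝ :=
  fderiv ℝ (η.inChart p) (extChartAt (𝓡 d) p p) (mvfderiv (𝓡 d) (extChartAt (𝓡 d) p) p v)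
      (mvfderiv (𝓡 d) (extChartAt (𝓡 d) p) p w) -
    fderiv ℝ (η.inChart p) (extChartAt (𝓡 d) p p) (mvfderiv (𝓡 d) (extChartAt (𝓡 d) p) p w)
      (mvfderiv (𝓡 d) (extChartAt (𝓡 d) p) p v)

theorem OneForm.extDeriv_swap (η : OneForm d M) (p : M) (v w : TangentSpace (𝓡 d) p) :
    η.extDeriv p v w = -η.extDeriv p w v := by
  unfold OneForm.extDeriv; ring

theorem OneForm.extDeriv_add_right (η : OneForm d M) (p : M) (v w w' : TangentSpace (𝓡 d) p) :
    η.extDeriv p v (w + w') = η.extDeriv p v w + η.extDeriv p v w' := by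
  unfold OneForm.extDeriv
  simp only [map_add, add_apply]; ring

theorem OneForm.extDeriv_smul_right (η : OneForm d M) (p : M) (c : ℝ)
    (v w : TangentSpace (𝓡 d) p) : η.extDeriv p v (c • w) = c * η.extDeriv p v w := by
  unfold OneForm.extDeriv
  simp only [map_smul, smul_apply, smul_eq_mul]; ring

theorem OneForm.extDeriv_neg_right (η : OneForm d M) (p : M)
    (v w : TangentSpace (𝓡 d) p) : η.extDeriv p v (-w) = -η.extDeriv p v w := by
  unfold OneForm.extDeriv
  simp only [map_neg, neg_apply]; ring

theorem OneForm.extDeriv_add_left (η : OneForm d M) (p : M) (v v' w : TangentSpace (𝓡 d) p) :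
    η.extDeriv p (v + v') w = η.extDeriv p v w + η.extDeriv p v' w := by
  rw [η.extDeriv_swap, η.extDeriv_add_right, η.extDeriv_swap p v w, η.extDeriv_swap p v' w]; ring

theorem OneForm.extDeriv_smul_left (η : OneForm d M) (p : M) (c : ℝ)
    (v w : TangentSpace (𝓡 d) p) : η.extDeriv p (c • v) w = c * η.extDeriv p v w := by
  rw [η.extDeriv_swap, η.extDeriv_smul_right, η.extDeriv_swap p v w]; ring

theorem OneForm.Smooth.differentiableAt_inChart [T2Space M] {η : OneForm d M} (hη : η.Smooth)
    (p : M) : DifferentiableAt ℝ (η.inChart p) (extChartAt (𝓡 d) p p) :=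
  ((hη.contDiffOn_inChart p).contDiffAt ((isOpen_extChartAt_target p).mem_nhds
    (mem_extChartAt_target p))).differentiableAt (by simp)

/-- The product rule for the function `η(B)`, in the preferred chart at `p`. -/
theorem OneForm.Smooth.mvfderiv_apply [T2Space M] {η : OneForm d M} (hη : η.Smooth)
    {B : VField d M} {p : M} (hB : B.SmoothAt p) (v : TangentSpace (𝓡 d) p) :
    mvfderiv (𝓡 d) (fun q => η q (B q)) p v =
      fderiv ℝ (η.inChart p) (extChartAt (𝓡 d) p p) (mvfderiv (𝓡 d) (extChartAt (𝓡 d) p) p v)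
        (mvfderiv (𝓡 d) (extChartAt (𝓡 d) p) p (B p)) +
      η.inChart p (extChartAt (𝓡 d) p p) (fderiv ℝ (B.coord p ∘ (extChartAt (𝓡 d) p).symm)
        (extChartAt (𝓡 d) p p) (mvfderiv (𝓡 d) (extChartAt (𝓡 d) p) p v)) := by
  have hp := mem_extChartAt_source (I := 𝓡 d) p
  rw [mvfderiv_eq_fderiv_chart hp ((hη.contMDiffAt' hB).mdifferentiableAt (by simp))]
  have h1 : (fun q => η q (B q)) ∘ (extChartAt (𝓡 d) p).symm =ᶠ[𝓝 (extChartAt (𝓡 d) p p)]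
      fun y => η.inChart p y ((B.coord p ∘ (extChartAt (𝓡 d) p).symm) y) := by
    filter_upwards [(isOpen_extChartAt_target p).mem_nhds (mem_extChartAt_target p)] with y hy
    have h2 := η.inChart_mvfderiv ((extChartAt (𝓡 d) p).map_target hy)
      (B ((extChartAt (𝓡 d) p).symm y))
    rw [(extChartAt (𝓡 d) p).right_inv hy] at h2
    exact h2.symm
  have h3 : DifferentiableAt ℝ (B.coord p ∘ (extChartAt (𝓡 d) p).symm) (extChartAt (𝓡 d) p p) :=
    (contDiffAt_comp_extChartAt_symm hp ((VField.smoothAt_iff hp).1 hB)).differentiableAt (by simp)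
  rw [h1.fderiv_eq, fderiv_clm_apply (hη.differentiableAt_inChart p) h3]
  simp only [add_apply, ContinuousLinearMap.comp_apply,
    ContinuousLinearMap.flip_apply, Function.comp_apply, extChartAt_to_inv]
  rw [add_comm]
  rfl

/-- Cartan's formula for the exterior derivative of a one-form. -/
theorem OneForm.Smooth.extDeriv_eq [T2Space M] {η : OneForm d M} (hη : η.Smooth)
    {A B : VField d M} {p : M} (hA : A.SmoothAt p) (hB : B.SmoothAt p) :
    η.extDeriv p (A p) (B p) = mvfderiv (𝓡 d) (fun q => η q (B q)) p (A p) -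
      mvfderiv (𝓡 d) (fun q => η q (A q)) p (B p) - η p (VectorField.mlieBracket (𝓡 d) A B p) := by
  rw [hη.mvfderiv_apply hB, hη.mvfderiv_apply hA,
    ← η.inChart_mvfderiv (mem_extChartAt_source (I := 𝓡 d) p), mvfderiv_extChartAt_mlieBracket,
    VectorField.lieBracket_eq, map_sub, OneForm.extDeriv]
  simp only [Function.comp_apply, extChartAt_to_inv]
  simp only [VField.coord]
  ring

/-- The product rule `d(g η) = dg ∧ η + g dη`. -/
theorem OneForm.Smooth.extDeriv_smul [T2Space M] {η : OneForm d M} (hη : η.Smooth) {g : M → ℝ}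
    (hg : ContMDiff (𝓡 d) 𝓘(ℝ, ℝ) ∞ g) (p : M) (v w : TangentSpace (𝓡 d) p) :
    OneForm.extDeriv (fun q => g q • η q : OneForm d M) p v w =
      mvfderiv (𝓡 d) g p v * η p w - mvfderiv (𝓡 d) g p w * η p v + g p * η.extDeriv p v w := by
  have hp := mem_extChartAt_source (I := 𝓡 d) p
  have h1 : OneForm.inChart (fun q => g q • η q : OneForm d M) p =
      fun y => (g ∘ (extChartAt (𝓡 d) p).symm) y • η.inChart p y := rfl
  have h2 : DifferentiableAt ℝ (g ∘ (extChartAt (𝓡 d) p).symm) (extChartAt (𝓡 d) p p) :=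
    (contDiffAt_comp_extChartAt_symm hp (hg p)).differentiableAt (by simp)
  have h3 := η.inChart_mvfderiv hp
  unfold OneForm.extDeriv
  rw [h1, fderiv_fun_smul h2 (hη.differentiableAt_inChart p),
    mvfderiv_eq_fderiv_chart hp ((hg p).mdifferentiableAt (by simp)),
    mvfderiv_eq_fderiv_chart hp ((hg p).mdifferentiableAt (by simp)), ← h3, ← h3]
  simp only [add_apply, smul_apply, ContinuousLinearMap.smulRight_apply, smul_eq_mul,
    Function.comp_apply, extChartAt_to_inv]
  ring

variable {m : ℕ}

local notation "𝔼" => EuclideanSpace ℝ (Fin m)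

/-- The exterior derivative commutes with pull-backs. -/
theorem OneForm.Smooth.extDeriv_mfderiv [T2Space M] {η : OneForm d M} (hη : η.Smooth)
    {κ : 𝔼 → M} {U : Set 𝔼} (hU : IsOpen U) (hκ : ContMDiffOn 𝓘(ℝ, 𝔼) (𝓡 d) ∞ κ U)
    {y : 𝔼} (hy : y ∈ U) {β : 𝔼 → 𝔼 →L[ℝ] ℝ}
    (hβ : ∀ z ∈ U, ∀ v, β z v = η (κ z) (mfderiv 𝓘(ℝ, 𝔼) (𝓡 d) κ z v)) (v w : 𝔼) :
    η.extDeriv (κ y) (mfderiv 𝓘(ℝ, 𝔼) (𝓡 d) κ y v) (mfderiv 𝓘(ℝ, 𝔼) (𝓡 d) κ y w) =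
      fderiv ℝ β y v w - fderiv ℝ β y w v := by
  have hp := mem_extChartAt_source (I := 𝓡 d) (κ y)
  have hκy := hκ.contMDiffAt (hU.mem_nhds hy)
  set F := extChartAt (𝓡 d) (κ y) ∘ κ with hF
  have hFs : ContDiffAt ℝ ∞ F y := contDiffAt_extChartAt_comp hp hκy
  have hF1 : DifferentiableAt ℝ F y := hFs.differentiableAt (by simp)
  have hF2 : DifferentiableAt ℝ (fderiv ℝ F) y :=
    (hFs.fderiv_right (m := ∞) (by simp)).differentiableAt (by simp)
  have h1 : β =ᶠ[𝓝 y] fun z => ((η.inChart (κ y) ∘ F) z).comp (fderiv ℝ F z) := by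
    filter_upwards [hU.mem_nhds hy, hκy.continuousAt.preimage_mem_nhds
      ((isOpen_extChartAt_source (κ y)).mem_nhds hp)] with z hz hz'
    ext v
    rw [hβ z hz, ← η.inChart_mvfderiv hz', mvfderiv_extChartAt_mfderiv hz'
      ((hκ.contMDiffAt (hU.mem_nhds hz)).mdifferentiableAt (by simp))]
    rfl
  have h2 : DifferentiableAt ℝ (η.inChart (κ y)) (F y) := hη.differentiableAt_inChart (κ y)
  have h3 : IsSymmSndFDerivAt ℝ F y :=
    hFs.isSymmSndFDerivAt (by simpa using WithTop.coe_le_coe.2 (le_top (a := (2 : ℕ∞))))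
  have h4 : ∀ v, mvfderiv (𝓡 d) (extChartAt (𝓡 d) (κ y)) (κ y) (mfderiv 𝓘(ℝ, 𝔼) (𝓡 d) κ y v) =
      fderiv ℝ F y v := mvfderiv_extChartAt_mfderiv hp (hκy.mdifferentiableAt (by simp))
  rw [h1.fderiv_eq, fderiv_clm_comp (h2.comp y hF1) hF2, fderiv_comp y h2 hF1]
  refine (congrArg₂ (fun a b : EuclideanSpace ℝ (Fin d) =>
    fderiv ℝ (η.inChart (κ y)) (F y) a b - fderiv ℝ (η.inChart (κ y)) (F y) b a)
    (h4 v) (h4 w)).trans ?_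
  simp only [add_apply, ContinuousLinearMap.comp_apply, ContinuousLinearMap.compL_apply,
    ContinuousLinearMap.flip_apply, h3.eq v w]
  simp only [Function.comp_apply]
  ring

end ExteriorDerivative

/-! ### The Levi form and the exterior derivative of a pseudo-Hermitian structure -/

section PseudoHermitian

variable {n : ℕ} {M : Type*} [TopologicalSpace M] [T2Space M]
  [ChartedSpace (EuclideanSpace ℝ (Fin (2 * n + 1))) M] [IsManifold (𝓡 (2 * n + 1)) ∞ M]
  {S : CRStructure n M} {θ θ' : OneForm (2 * n + 1) M}

local notation "𝔼M" => EuclideanSpace ℝ (Fin (2 * n + 1))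

omit [T2Space M] in
theorem CRStructure.IsPseudoHermitian.apply_re (hθ : S.IsPseudoHermitian θ) {p : M}
    {z : Complexified (TangentSpace (𝓡 (2 * n + 1)) p)} (hz : z ∈ S.T10 p) : θ p z.re = 0 := by
  have := congrArg Complex.re (hθ.vanishes p z hz)
  simpa [cext] using this

omit [T2Space M] in
theorem CRStructure.IsPseudoHermitian.apply_im (hθ : S.IsPseudoHermitian θ) {p : M}
    {z : Complexified (TangentSpace (𝓡 (2 * n + 1)) p)} (hz : z ∈ S.T10 p) : θ p z.im = 0 := by
  have := congrArg Complex.im (hθ.vanishes p z hz)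
  simpa [cext] using this

omit [T2Space M] in
/-- The kernel of a pseudo-Hermitian structure consists of the real parts of the vectors of
`T^{1,0}M`, by a dimension count. -/
theorem CRStructure.IsPseudoHermitian.exists_re_eq (hθ : S.IsPseudoHermitian θ) {p : M}
    {X : TangentSpace (𝓡 (2 * n + 1)) p} (hX : θ p X = 0) : ∃ z ∈ S.T10 p, z.re = X := by
  obtain ⟨U, hU, hpU, Z, hZs, hZm, hZi⟩ := S.exists_local_frame p
  have hp := mem_extChartAt_source (I := 𝓡 (2 * n + 1)) p
  let η : 𝔼M →ₗ[ℝ] ℝ := (θ.inChart p (extChartAt (𝓡 (2 * n + 1)) p p) : 𝔼M →ₗ[ℝ] ℝ)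
  let L : (Fin n → ℂ) →ₗ[ℝ] 𝔼M := (frameMap p Z p : (Fin n → ℂ) →ₗ[ℝ] 𝔼M)
  have hη : ∀ v : TangentSpace (𝓡 (2 * n + 1)) p,
      η (mvfderiv (𝓡 (2 * n + 1)) (extChartAt (𝓡 (2 * n + 1)) p) p v) = θ p v := fun v =>
    θ.inChart_mvfderiv hp v
  have hmem : ∀ c : Fin n → ℂ, ∑ i, c i • Z i p ∈ S.T10 p := fun c =>
    Submodule.sum_mem _ fun i _ => Submodule.smul_mem _ (c i) (hZm p hpU i)
  have hle : LinearMap.range L ≤ LinearMap.ker η := by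
    rintro _ ⟨c, rfl⟩
    change η (frameMap p Z p c) = 0
    rw [frameMap_apply, hη, hθ.apply_re (hmem c)]
  have hη0 : η ≠ 0 := by
    intro h0
    refine hθ.ne_zero p ?_
    ext v
    rw [← hη v, h0]
    rfl
  have h1 : Module.finrank ℝ (LinearMap.range L) = 2 * n := by
    rw [LinearMap.finrank_range_of_inj (frameMap_injective hp (hZm p hpU) (hZi p hpU)),
      Module.finrank_pi_fintype]
    simp [mul_comm]
  have h2 : Module.finrank ℝ (LinearMap.ker η) + 1 = 2 * n + 1 := by
    rw [Module.Dual.finrank_ker_add_one_of_ne_zero hη0]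
    simp
  have h3 := Submodule.eq_of_le_of_finrank_eq hle (h1.trans (Nat.succ_injective h2).symm)
  have h4 : (mvfderiv (𝓡 (2 * n + 1)) (extChartAt (𝓡 (2 * n + 1)) p) p X : 𝔼M) ∈
      LinearMap.ker η := by
    rw [LinearMap.mem_ker, hη, hX]
  rw [← h3] at h4
  obtain ⟨c, hc⟩ := h4
  refine ⟨_, hmem c, injective_mvfderiv_extChartAt hp ?_⟩
  rw [← frameMap_apply]
  exact hc

omit [T2Space M] in
/-- A covector that vanishes on the real parts of the vectors of `T^{1,0}M` is a multiple of `θ`; so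
any two pseudo-Hermitian structures are proportional. -/
theorem CRStructure.IsPseudoHermitian.eq_smul (hθ : S.IsPseudoHermitian θ)
    {p : M} {η : TangentSpace (𝓡 (2 * n + 1)) p →L[ℝ] ℝ} (hη : ∀ z ∈ S.T10 p, η z.re = 0)
    {T : TangentSpace (𝓡 (2 * n + 1)) p} (hT : θ p T = 1) : η = η T • θ p := by
  ext v
  obtain ⟨z, hz, hzv⟩ := hθ.exists_re_eq (X := v - θ p v • T)
    (by rw [map_sub, map_smul, hT, smul_eq_mul, mul_one, sub_self])
  have h1 := hη z hz
  rw [hzv, map_sub, map_smul, sub_eq_zero] at h1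
  rw [h1, smul_apply, smul_eq_mul, smul_eq_mul, mul_comm]

/-- Cartan's formula on vector fields in the kernel of `θ`. -/
theorem CRStructure.IsPseudoHermitian.apply_mlieBracket (hθ : S.IsPseudoHermitian θ)
    {A B : VField (2 * n + 1) M} (hA : A.Smooth) (hB : B.Smooth) (hA0 : ∀ q, θ q (A q) = 0)
    (hB0 : ∀ q, θ q (B q) = 0) (p : M) :
    θ p (VectorField.mlieBracket (𝓡 (2 * n + 1)) A B p) = -θ.extDeriv p (A p) (B p) := by
  have h := hθ.smooth.extDeriv_eq (hA.smoothAt p) (hB.smoothAt p)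
  have h0 : ∀ v : TangentSpace (𝓡 (2 * n + 1)) p,
      mvfderiv (𝓡 (2 * n + 1)) (fun _ : M => (0 : ℝ)) p v = 0 := fun v => by
    rw [mvfderiv_const]; rfl
  simp only [hA0, hB0, h0] at h
  linarith

variable {p : M} {z w : Complexified (TangentSpace (𝓡 (2 * n + 1)) p)}

/-- By formal integrability, `dθ` is of type `(1,1)` on the kernel of `θ`: it vanishes on pairs of
vectors of `T^{1,0}M`. -/
theorem CRStructure.IsPseudoHermitian.extDeriv_integrable (hn : 1 ≤ n)
    (hθ : S.IsPseudoHermitian θ) (hz : z ∈ S.T10 p) (hw : w ∈ S.T10 p) :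
    θ.extDeriv p z.re w.re = θ.extDeriv p z.im w.im ∧
      θ.extDeriv p z.re w.im = -θ.extDeriv p z.im w.re := by
  obtain ⟨Z, hZ, rfl⟩ := S.exists_section hn hz
  obtain ⟨W, hW, rfl⟩ := S.exists_section hn hw
  have h := S.integrable Z W hZ.1 hW.1 hZ.2 hW.2 p
  have hr := hθ.apply_re h
  have hi := hθ.apply_im h
  have hre : ∀ {Z : CVField (2 * n + 1) M}, S.IsSection Z → ∀ q, θ q (Z.re q) = 0 :=
    fun hZ q => hθ.apply_re (hZ.2 q)
  have him : ∀ {Z : CVField (2 * n + 1) M}, S.IsSection Z → ∀ q, θ q (Z.im q) = 0 :=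
    fun hZ q => hθ.apply_im (hZ.2 q)
  simp only [CVField.bracket, Complexified.re_mk, Complexified.im_mk, map_sub, map_add] at hr hi
  rw [hθ.apply_mlieBracket hZ.1.1 hW.1.1 (hre hZ) (hre hW),
    hθ.apply_mlieBracket hZ.1.2 hW.1.2 (him hZ) (him hW)] at hr
  rw [hθ.apply_mlieBracket hZ.1.1 hW.1.2 (hre hZ) (him hW),
    hθ.apply_mlieBracket hZ.1.2 hW.1.1 (him hZ) (hre hW)] at hi
  simp only [CVField.re, CVField.im] at hr hi
  constructor <;> linarith

/-- The Levi form at a point is given by the exterior derivative of the pseudo-Hermitian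
structure. -/
theorem CRStructure.IsPseudoHermitian.leviForm_eq (hn : 1 ≤ n) (hθ : S.IsPseudoHermitian θ)
    {Z W : CVField (2 * n + 1) M} (hZ : S.IsSection Z) (hW : S.IsSection W) (p : M) :
    CRStructure.leviForm θ Z W p = -(1 / 2) * (θ.extDeriv p (Z p).re (W p).im +
      Complex.I * θ.extDeriv p (Z p).re (W p).re) := by
  have hre : ∀ {Z : CVField (2 * n + 1) M}, S.IsSection Z → ∀ q, θ q (Z.re q) = 0 :=
    fun hZ q => hθ.apply_re (hZ.2 q)
  have him : ∀ {Z : CVField (2 * n + 1) M}, S.IsSection Z → ∀ q, θ q (Z.im q) = 0 :=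
    fun hZ q => hθ.apply_im (hZ.2 q)
  have hc1 : W.conj.re.Smooth := hW.1.1
  have hc2 : W.conj.im.Smooth := by
    have := hW.1.2.const_smul (-1)
    have h2 : W.conj.im = (-1 : ℝ) • W.im := by
      funext q
      change -(W q).im = (-1 : ℝ) • (W q).im
      rw [neg_one_smul]
    rwa [h2]
  have hc3 : ∀ q, θ q (W.conj.re q) = 0 := fun q => (hθ.apply_re (hW.2 q) : θ q (W q).re = 0)
  have hc4 : ∀ q, θ q (W.conj.im q) = 0 := fun q => by
    change θ q (-(W q).im) = 0
    rw [map_neg, hθ.apply_im (hW.2 q), neg_zero]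
  obtain ⟨h1, h2⟩ := hθ.extDeriv_integrable hn (hZ.2 p) (hW.2 p)
  have e1 : W.conj.im p = -(W p).im := rfl
  have e2 : W.conj.re p = (W p).re := rfl
  unfold CRStructure.leviForm cext
  simp only [CVField.bracket, Complexified.re_mk, Complexified.im_mk, map_sub, map_add]
  rw [hθ.apply_mlieBracket hZ.1.1 hc1 (hre hZ) hc3, hθ.apply_mlieBracket hZ.1.2 hc2 (him hZ) hc4,
    hθ.apply_mlieBracket hZ.1.1 hc2 (hre hZ) hc4, hθ.apply_mlieBracket hZ.1.2 hc1 (him hZ) hc3,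
    e1, e2, OneForm.extDeriv_neg_right, OneForm.extDeriv_neg_right]
  simp only [CVField.re, CVField.im]
  have h3 : θ.extDeriv p (Z p).im (W p).re = -θ.extDeriv p (Z p).re (W p).im := by linarith
  rw [← h1, h3]
  apply Complex.ext <;> simp <;> ring

/-- The Levi distribution consists of the vectors whose real parts are in the kernel of the
restriction of `dθ` to the kernel of `θ`. -/
theorem CRStructure.IsPseudoHermitian.mem_leviDistribution_iff (hn : 1 ≤ n)
    (hθ : S.IsPseudoHermitian θ) : z ∈ S.leviDistribution p ↔
      z ∈ S.T10 p ∧ ∀ X, θ p X = 0 → θ.extDeriv p z.re X = 0 := by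
  constructor
  · rintro ⟨Z, hZ, rfl, h⟩
    refine ⟨hZ.2 p, fun X hX => ?_⟩
    obtain ⟨w, hw, rfl⟩ := hθ.exists_re_eq hX
    obtain ⟨W, hW, rfl⟩ := S.exists_section hn hw
    have h1 := h θ hθ W hW
    rw [hθ.leviForm_eq hn hZ hW] at h1
    have := congrArg Complex.im h1
    simpa using this
  · rintro ⟨hz, h⟩
    obtain ⟨Z, hZ, rfl⟩ := S.exists_section hn hz
    refine ⟨Z, hZ, rfl, fun θ' hθ' W hW => ?_⟩
    have h0 : CRStructure.leviForm θ Z W p = 0 := by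
      rw [hθ.leviForm_eq hn hZ hW, h _ (hθ.apply_re (hW.2 p)), h _ (hθ.apply_im (hW.2 p))]
      simp
    obtain ⟨T, hT⟩ : ∃ T, θ p T = 1 := by
      have h1 : ∃ v, θ p v ≠ 0 := by
        by_contra! h2
        exact hθ.ne_zero p (by ext v; exact h2 v)
      obtain ⟨v, hv⟩ := h1
      exact ⟨(θ p v)⁻¹ • v, by rw [map_smul, smul_eq_mul, inv_mul_cancel₀ hv]⟩
    have h2 := hθ.eq_smul (η := θ' p) (fun z hz => hθ'.apply_re hz) hT
    have h3 : CRStructure.leviForm θ' Z W p = θ' p T * CRStructure.leviForm θ Z W p := by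
      unfold CRStructure.leviForm cext
      rw [h2]
      simp only [smul_apply, smul_eq_mul, hT]
      push_cast
      ring
    rw [h3, h0, mul_zero]

omit [T2Space M] in
/-- The product `i z`, in real and imaginary parts. -/
theorem I_smul_mem_T10 (hz : z ∈ S.T10 p) :
    Complexified.mk (-z.im) z.re ∈ S.T10 p := by
  have := Submodule.smul_mem _ Complex.I hz
  convert this using 1
  ext1 <;> simp

/-- On a pseudoconvex manifold, a vector on which the Levi form vanishes is in the null space of the
Levi form. -/
theorem CRStructure.IsPseudoHermitian.mem_leviDistribution_of_extDeriv_eq_zero (hn : 1 ≤ n)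
    (hθ : S.IsPseudoHermitian θ)
    (hpos : ∀ Z, S.IsSection Z → ∀ p, 0 ≤ (CRStructure.leviForm θ Z Z p).re)
    (hz : z ∈ S.T10 p) (h0 : θ.extDeriv p z.re z.im = 0) : z ∈ S.leviDistribution p := by
  have hQ : ∀ {w}, w ∈ S.T10 p → θ.extDeriv p w.re w.im ≤ 0 := by
    intro w hw
    obtain ⟨W, hW, rfl⟩ := S.exists_section hn hw
    have := hpos W hW p
    rw [hθ.leviForm_eq hn hW hW] at this
    simp only [one_div, neg_mul, Complex.neg_re, Complex.mul_re, Complex.inv_re, Complex.re_ofNat,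
      Complex.normSq_ofNat, Complex.add_re, Complex.ofReal_re, Complex.I_re, zero_mul,
      Complex.I_im, Complex.ofReal_im, mul_zero, sub_self, add_zero, Complex.inv_im,
      Complex.im_ofNat, neg_zero, zero_div, Complex.add_im, Complex.mul_im, zero_add] at this
    linarith
  have hP : ∀ {w}, w ∈ S.T10 p → θ.extDeriv p z.re w.im = 0 := by
    intro w hw
    -- the Levi form of `z + t w`, a quadratic polynomial in `t` of constant sign and without
    -- constant term; its linear term must vanish
    have h1 : ∀ t : ℝ, 2 * t * θ.extDeriv p z.re w.im + t ^ 2 * θ.extDeriv p w.re w.im ≤ 0 := by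
      intro t
      have h2 := hQ (Submodule.add_mem _ hz (Submodule.smul_mem _ (t : ℂ) hw))
      simp only [Complexified.re_add, Complexified.im_add, Complexified.re_smul,
        Complexified.im_smul, Complex.ofReal_re, Complex.ofReal_im, zero_smul, sub_zero,
        add_zero, OneForm.extDeriv_add_left, OneForm.extDeriv_add_right,
        OneForm.extDeriv_smul_left, OneForm.extDeriv_smul_right, h0] at h2
      have h3 := (hθ.extDeriv_integrable hn hz hw).2
      rw [θ.extDeriv_swap p w.re z.im, ← h3] at h2
      linarith
    have h2 := hQ hw
    by_contra hne
    set a := θ.extDeriv p z.re w.im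
    set b := θ.extDeriv p w.re w.im
    rcases eq_or_lt_of_le h2 with hb | hb
    · have := h1 a
      have : 0 < a ^ 2 := by positivity
      nlinarith
    · have h3 := h1 (-a / b)
      have h4 : 2 * (-a / b) * a + (-a / b) ^ 2 * b = -(a ^ 2 / b) := by
        field_simp; ring
      rw [h4] at h3
      have : a ^ 2 / b < 0 := div_neg_of_pos_of_neg (by positivity) hb
      linarith
  refine (hθ.mem_leviDistribution_iff hn).2 ⟨hz, fun X hX => ?_⟩
  obtain ⟨w, hw, rfl⟩ := hθ.exists_re_eq hX
  exact hP (I_smul_mem_T10 hw)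

end PseudoHermitian

/-! ### Complex submanifolds and the Levi core -/

section Core

variable {n : ℕ} {M : Type*} [TopologicalSpace M] [T2Space M]
  [ChartedSpace (EuclideanSpace ℝ (Fin (2 * n + 1))) M] [IsManifold (𝓡 (2 * n + 1)) ∞ M]
  {S : CRStructure n M} {θ θ' : OneForm (2 * n + 1) M}
  {m : ℕ} {V : Type*} [TopologicalSpace V] [ChartedSpace (EuclideanSpace ℝ (Fin m)) V]
  [IsManifold (𝓡 m) ∞ V] {ι : V → M}

local notation "𝔼M" => EuclideanSpace ℝ (Fin (2 * n + 1))
local notation "𝔼" => EuclideanSpace ℝ (Fin m)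

/-- The vectors of type `(1,0)` tangent to a complex submanifold are Levi-null. -/
theorem CRStructure.IsComplexSubmanifold.mem_leviDistribution (hn : 1 ≤ n)
    (hS : S.IsPseudoconvex) (hV : S.IsComplexSubmanifold m ι) {x : V} {v w : TangentSpace (𝓡 m) x}
    (h : S.IsJb (ι x) (mfderiv (𝓡 m) (𝓡 (2 * n + 1)) ι x v)
      (mfderiv (𝓡 m) (𝓡 (2 * n + 1)) ι x w)) :
    Complexified.mk (mfderiv (𝓡 m) (𝓡 (2 * n + 1)) ι x v)
      (-mfderiv (𝓡 m) (𝓡 (2 * n + 1)) ι x w) ∈ S.leviDistribution (ι x) := by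
  obtain ⟨θ, hθ, hpos⟩ := hS
  refine hθ.mem_leviDistribution_of_extDeriv_eq_zero hn hpos h ?_
  have hx := mem_extChartAt_target (I := 𝓡 m) x
  have hinv := isInvertible_mfderiv_extChartAt_symm' hx
  have e0 : (extChartAt (𝓡 m) x).symm (extChartAt (𝓡 m) x x) = x := extChartAt_to_inv x
  have key : ∀ {x' : V} (e : x' = x) (v w : TangentSpace (𝓡 m) x'),
      (∀ v w : TangentSpace (𝓡 m) x', θ.extDeriv (ι x') (mfderiv (𝓡 m) (𝓡 (2 * n + 1)) ι x' v)
        (mfderiv (𝓡 m) (𝓡 (2 * n + 1)) ι x' w) = 0) →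
      ∀ v w : TangentSpace (𝓡 m) x, θ.extDeriv (ι x) (mfderiv (𝓡 m) (𝓡 (2 * n + 1)) ι x v)
        (mfderiv (𝓡 m) (𝓡 (2 * n + 1)) ι x w) = 0 := by
    rintro x' rfl _ _ h
    exact h
  rw [Complexified.re_mk, Complexified.im_mk, OneForm.extDeriv_neg_right, neg_eq_zero]
  -- the pull-back of `θ` to the submanifold is zero, and so is that of `dθ`
  refine key e0 (0 : 𝔼) (0 : 𝔼) (fun v w => ?_) v w
  obtain ⟨v, rfl⟩ := hinv.bijective.2 v
  obtain ⟨w, rfl⟩ := hinv.bijective.2 w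
  have h1 := hθ.smooth.extDeriv_mfderiv (isOpen_extChartAt_target x) (hV.contMDiffOn_chartMap x)
    hx (β := fun _ => 0) (fun z hz v => ?_) v w
  · rw [mfderiv_chartMap hV.contMDiff hx] at h1
    have h2 : fderiv ℝ (fun _ : 𝔼 => (0 : 𝔼 →L[ℝ] ℝ)) (extChartAt (𝓡 m) x x) = 0 :=
      fderiv_const_apply _
    simp only [h2] at h1
    refine Eq.trans h1 (sub_self _)
  · obtain ⟨w, hw⟩ := hV.exists_isJb_chartMap hz v
    exact (hθ.apply_re hw).symm

omit [T2Space M] in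
/-- A subdistribution `K` of `D` is contained in all the derived distributions if it is tangent to
the support of every distribution that contains it: by transfinite induction. -/
theorem CDistribution.le_iterDerived {D K : CDistribution (2 * n + 1) M}
    (hK : ∀ p, K p ≤ D p) (hKt : ∀ E : CDistribution (2 * n + 1) M, (∀ p, K p ≤ E p) →
      ∀ p, K p ≤ complexZariskiTangent E.support p) (o : Ordinal.{0}) (p : M) :
    K p ≤ D.iterDerived o p := by
  induction o using Ordinal.limitRecOn generalizing p with
  | zero =>
    rw [CDistribution.iterDerived, Ordinal.limitRecOn_zero]
    exact hK p
  | add_one o ih =>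
    rw [CDistribution.iterDerived, Ordinal.limitRecOn_add_one]
    exact le_inf (ih p) (hKt _ ih p)
  | limit o ho ih =>
    rw [CDistribution.iterDerived, Ordinal.limitRecOn_limit _ _ _ _ ho]
    exact le_iInf₂ fun b hb => ih b hb p

/-- The vectors of type `(1,0)` tangent to a complex submanifold are in the Levi core, since the
submanifold is contained in all the successive supports. -/
theorem CRStructure.IsComplexSubmanifold.mem_leviCore (hn : 1 ≤ n)
    (hS : S.IsPseudoconvex) (hV : S.IsComplexSubmanifold m ι) {x : V} {v w : TangentSpace (𝓡 m) x}
    (h : S.IsJb (ι x) (mfderiv (𝓡 m) (𝓡 (2 * n + 1)) ι x v)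
      (mfderiv (𝓡 m) (𝓡 (2 * n + 1)) ι x w)) :
    Complexified.mk (mfderiv (𝓡 m) (𝓡 (2 * n + 1)) ι x v)
      (-mfderiv (𝓡 m) (𝓡 (2 * n + 1)) ι x w) ∈ S.leviCore (ι x) := by
  -- the span of the `(1,0)`-vectors tangent to the submanifold; it is zero off the submanifold
  let K : CDistribution (2 * n + 1) M := fun p => Submodule.span ℂ
    {z | ∃ (x : V) (e : ι x = p) (v w : TangentSpace (𝓡 m) x),
      S.IsJb (ι x) (mfderiv (𝓡 m) (𝓡 (2 * n + 1)) ι x v) (mfderiv (𝓡 m) (𝓡 (2 * n + 1)) ι x w) ∧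
      z = e ▸ Complexified.mk (mfderiv (𝓡 m) (𝓡 (2 * n + 1)) ι x v)
        (-mfderiv (𝓡 m) (𝓡 (2 * n + 1)) ι x w)}
  have hKmem : ∀ {x : V} {v w : TangentSpace (𝓡 m) x},
      S.IsJb (ι x) (mfderiv (𝓡 m) (𝓡 (2 * n + 1)) ι x v) (mfderiv (𝓡 m) (𝓡 (2 * n + 1)) ι x w) →
      Complexified.mk (mfderiv (𝓡 m) (𝓡 (2 * n + 1)) ι x v)
        (-mfderiv (𝓡 m) (𝓡 (2 * n + 1)) ι x w) ∈ K (ι x) := fun {x v w} h =>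
    Submodule.subset_span ⟨x, rfl, v, w, h, rfl⟩
  refine CDistribution.le_iterDerived (K := K) (fun p => Submodule.span_le.2 ?_)
    (fun E hE p => Submodule.span_le.2 ?_) _ _ (hKmem h)
  · rintro _ ⟨x, rfl, v, w, h, rfl⟩
    exact hV.mem_leviDistribution hn hS h
  · rintro _ ⟨x, rfl, v, w, h, rfl⟩
    have hz : ∀ u : TangentSpace (𝓡 m) x,
        mfderiv (𝓡 m) (𝓡 (2 * n + 1)) ι x u ∈ zariskiTangent E.support (ι x) := by
      intro u f hf hf0
      by_cases hu : u = 0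
      · rw [hu, map_zero, map_zero]
      -- the submanifold has a nonzero tangent space, which is modelled on the same vector space at
      -- all of its points; so it is contained in the support of `E`
      have hsupp : ∀ x', f (ι x') = 0 := by
        intro x'
        refine hf0 _ fun hbot => ?_
        obtain ⟨w', hw'⟩ := hV.jb_invariant x' (u : 𝔼)
        have h1 := hE _ (hKmem hw')
        rw [hbot, Submodule.mem_bot] at h1
        have h2 : mfderiv (𝓡 m) (𝓡 (2 * n + 1)) ι x' (u : 𝔼) = 0 :=
          congrArg Complexified.re h1
        exact hu (hV.mfderiv_injective x' (h2.trans (map_zero _).symm))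
      have h3 : f ∘ ι = fun _ => 0 := funext hsupp
      have h4 := mfderiv_comp x (hf.mdifferentiableAt (by simp) : MDifferentiableAt _ _ f (ι x))
        (hV.contMDiff.mdifferentiableAt (by simp))
      rw [h3, mfderiv_const] at h4
      exact (congrArg (fun L => L u) h4).symm
    exact ⟨hz v, Submodule.neg_mem _ (hz w)⟩

end Core

/-! ### D'Angelo forms as contractions of the exterior derivative -/

section DAngelo

variable {n : ℕ} {M : Type*} [TopologicalSpace M] [T2Space M]
  [ChartedSpace (EuclideanSpace ℝ (Fin (2 * n + 1))) M] [IsManifold (𝓡 (2 * n + 1)) ∞ M]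
  {S : CRStructure n M} {θ θ' : OneForm (2 * n + 1) M}

/-- The D'Angelo form of `(θ, T)` is the contraction `-dθ (T, ·)` on the kernel of `θ`. -/
theorem CRStructure.IsPseudoHermitian.extDeriv_eq_of_dangelo (hn : 1 ≤ n)
    (hθ : S.IsPseudoHermitian θ)
    {T : VField (2 * n + 1) M} (hT : T.Smooth) (hT1 : ∀ p, θ p (T p) = 1)
    {α : OneForm (2 * n + 1) M} (hα : ∀ X : VField (2 * n + 1) M, X.Smooth → ∀ p,
      α p (X p) = θ p (VectorField.mlieBracket (𝓡 (2 * n + 1)) T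
        (fun q => X q - θ q (X q) • T q) p)) {p : M} {X : TangentSpace (𝓡 (2 * n + 1)) p}
    (hX : θ p X = 0) : α p X = θ.extDeriv p X (T p) := by
  obtain ⟨z, hz, rfl⟩ := hθ.exists_re_eq hX
  obtain ⟨Z, hZ, rfl⟩ := S.exists_section hn hz
  have h0 : ∀ q, θ q (Z.re q) = 0 := fun q => hθ.apply_re (hZ.2 q)
  have h1 := hα Z.re hZ.1.1 p
  have h2 : (fun q => Z.re q - θ q (Z.re q) • T q) = Z.re := by
    funext q
    rw [h0, zero_smul, sub_zero]
  rw [h2] at h1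
  have h3 := hθ.smooth.extDeriv_eq (hT.smoothAt p) (hZ.1.1.smoothAt p)
  have hc : ∀ (c : ℝ) (v : TangentSpace (𝓡 (2 * n + 1)) p),
      mvfderiv (𝓡 (2 * n + 1)) (fun _ : M => c) p v = 0 := fun c v => by
    rw [mvfderiv_const]; rfl
  simp only [h0, hT1, hc] at h3
  rw [θ.extDeriv_swap]
  change α p (Z.re p) = -θ.extDeriv p (T p) (Z.re p)
  rw [h1]
  linarith

/-- If `θ' = g θ` and `θ' (T') = τ ≠ 0`, the logarithmic contraction of `dθ'` with `T'` differs from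
that of `dθ` by `d log |g|`, on Levi-null vectors. -/
theorem CRStructure.IsPseudoHermitian.extDeriv_smul_div (hθ : S.IsPseudoHermitian θ)
    {g : M → ℝ} (hg : ContMDiff (𝓡 (2 * n + 1)) 𝓘(ℝ, ℝ) ∞ g) {p : M} (hgp : g p ≠ 0)
    {X T T' : TangentSpace (𝓡 (2 * n + 1)) p} (hX : θ p X = 0)
    (hnull : ∀ Y, θ p Y = 0 → θ.extDeriv p X Y = 0) (hT : θ p T = 1) (hT' : θ p T' ≠ 0) :
    OneForm.extDeriv (fun q => g q • θ q : OneForm (2 * n + 1) M) p X T' / (g p * θ p T') =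
      θ.extDeriv p X T + mvfderiv (𝓡 (2 * n + 1)) g p X / g p := by
  have h1 := hnull (T' - θ p T' • T) (by rw [map_sub, map_smul, hT, smul_eq_mul]; ring)
  rw [sub_eq_add_neg, OneForm.extDeriv_add_right, OneForm.extDeriv_neg_right,
    OneForm.extDeriv_smul_right] at h1
  rw [hθ.smooth.extDeriv_smul hg, hX]
  have h2 : θ.extDeriv p X T' = θ p T' * θ.extDeriv p X T := by linarith
  rw [h2]
  field_simp
  ring

end DAngelo

/-! ### Vector fields along a submanifold -/

section Along

variable {d : ℕ} {M : Type*} [TopologicalSpace M] [ChartedSpace (EuclideanSpace ℝ (Fin d)) M]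
  {m : ℕ}

local notation "𝔼" => EuclideanSpace ℝ (Fin m)

theorem mvfderiv_mfderiv {F : Type*} [NormedAddCommGroup F] [NormedSpace ℝ F] {f : M → F}
    {κ : 𝔼 → M} {y : 𝔼} (hf : MDifferentiableAt (𝓡 d) 𝓘(ℝ, F) f (κ y))
    (hκ : MDifferentiableAt 𝓘(ℝ, 𝔼) (𝓡 d) κ y) (v : 𝔼) :
    mvfderiv (𝓡 d) f (κ y) (mfderiv 𝓘(ℝ, 𝔼) (𝓡 d) κ y v) = fderiv ℝ (f ∘ κ) y v := by
  have h1 := mfderiv_comp y hf hκ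
  rw [← mfderiv_eq_fderiv]
  exact (congrArg (fun L => L v) h1).symm

variable [IsManifold (𝓡 d) ∞ M]

/-- The Lie bracket of vector fields tangent to an immersed submanifold. -/
theorem mlieBracket_mfderiv {κ : 𝔼 → M} {O : Set 𝔼} (hO : IsOpen O)
    (hκ : ContMDiffOn 𝓘(ℝ, 𝔼) (𝓡 d) ∞ κ O) {y : 𝔼} (hy : y ∈ O) {A B : VField d M}
    (hA : A.SmoothAt (κ y)) (hB : B.SmoothAt (κ y)) {a b : 𝔼 → 𝔼} (ha : DifferentiableAt ℝ a y)
    (hb : DifferentiableAt ℝ b y) (hAa : ∀ z ∈ O, A (κ z) = mfderiv 𝓘(ℝ, 𝔼) (𝓡 d) κ z (a z))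
    (hBb : ∀ z ∈ O, B (κ z) = mfderiv 𝓘(ℝ, 𝔼) (𝓡 d) κ z (b z)) :
    VectorField.mlieBracket (𝓡 d) A B (κ y) =
      mfderiv 𝓘(ℝ, 𝔼) (𝓡 d) κ y (fderiv ℝ b y (a y) - fderiv ℝ a y (b y)) := by
  have hp := mem_extChartAt_source (I := 𝓡 d) (κ y)
  have hκa : ∀ z ∈ O, ContMDiffAt 𝓘(ℝ, 𝔼) (𝓡 d) ∞ κ z := fun z hz => hκ.contMDiffAt (hO.mem_nhds hz)
  have hκd : MDifferentiableAt 𝓘(ℝ, 𝔼) (𝓡 d) κ y := (hκa y hy).mdifferentiableAt (by simp)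
  refine injective_mvfderiv_extChartAt hp ?_
  set F := extChartAt (𝓡 d) (κ y) ∘ κ with hF
  have hFs : ContDiffAt ℝ ∞ F y := contDiffAt_extChartAt_comp hp (hκa y hy)
  have hF2 : DifferentiableAt ℝ (fderiv ℝ F) y :=
    (hFs.fderiv_right (m := ∞) (by simp)).differentiableAt (by simp)
  have hs : IsSymmSndFDerivAt ℝ F y :=
    hFs.isSymmSndFDerivAt (by simpa using WithTop.coe_le_coe.2 (le_top (a := (2 : ℕ∞))))
  have key : ∀ {A B : VField d M}, B.SmoothAt (κ y) → ∀ {a b : 𝔼 → 𝔼}, DifferentiableAt ℝ b y →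
      (∀ z ∈ O, A (κ z) = mfderiv 𝓘(ℝ, 𝔼) (𝓡 d) κ z (a z)) →
      (∀ z ∈ O, B (κ z) = mfderiv 𝓘(ℝ, 𝔼) (𝓡 d) κ z (b z)) →
      mvfderiv (𝓡 d) (fun q => mvfderiv (𝓡 d) (extChartAt (𝓡 d) (κ y)) q (B q)) (κ y) (A (κ y)) =
        fderiv ℝ (fderiv ℝ F) y (a y) (b y) + fderiv ℝ F y (fderiv ℝ b y (a y)) := by
    intro A B hB a b hb hAa hBb
    rw [hAa y hy, mvfderiv_mfderiv ((hB.contMDiffAt_mvfderiv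
      (contMDiffAt_extChartAt_of_mem hp)).mdifferentiableAt (by simp)) hκd]
    have h1 : (fun q => mvfderiv (𝓡 d) (extChartAt (𝓡 d) (κ y)) q (B q)) ∘ κ =ᶠ[𝓝 y]
        fun z => fderiv ℝ F z (b z) := by
      filter_upwards [hO.mem_nhds hy, (hκa y hy).continuousAt.preimage_mem_nhds
        ((isOpen_extChartAt_source (κ y)).mem_nhds hp)] with z hz hz'
      rw [Function.comp_apply, hBb z hz]
      exact mvfderiv_extChartAt_mfderiv hz' ((hκa z hz).mdifferentiableAt (by simp)) _
    rw [h1.fderiv_eq, fderiv_clm_apply hF2 hb]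
    simp only [add_apply, ContinuousLinearMap.comp_apply, ContinuousLinearMap.flip_apply]
    rw [add_comm]
  rw [mvfderiv_mlieBracket (contMDiffAt_extChartAt_of_mem hp) hA hB, key hB hb hAa hBb,
    key hA ha hBb hAa, hs.eq (a y)]
  refine Eq.trans ?_ (mvfderiv_extChartAt_mfderiv hp hκd _).symm
  rw [map_sub]
  abel

end Along

/-! ### The D'Angelo class on Levi-null vectors -/

section DAngeloClass

variable {n : ℕ} {M : Type*} [TopologicalSpace M] [T2Space M]
  [ChartedSpace (EuclideanSpace ℝ (Fin (2 * n + 1))) M] [IsManifold (𝓡 (2 * n + 1)) ∞ M]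
  {S : CRStructure n M} {θ θ' : OneForm (2 * n + 1) M}

/-- On Levi-null vectors, a D'Angelo form differs by an exact form from the logarithmic contraction
of `dθ'` with `T'`, for any other pseudo-Hermitian structure `θ'`. -/
theorem CRStructure.IsDAngeloForm.exists_add_mvfderiv_eq (hn : 1 ≤ n)
    {α : OneForm (2 * n + 1) M} (hα : S.IsDAngeloForm α) (hθ' : S.IsPseudoHermitian θ') :
    ∃ f : M → ℝ, ContMDiff (𝓡 (2 * n + 1)) 𝓘(ℝ, ℝ) ∞ f ∧ ∀ p, ∀ z ∈ S.leviDistribution p,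
      ∀ T', θ' p T' ≠ 0 →
        α p z.re + mvfderiv (𝓡 (2 * n + 1)) f p z.re = θ'.extDeriv p z.re T' / θ' p T' := by
  obtain ⟨θ, T, hθ, hT, hT1, hα⟩ := hα
  -- `θ' = g θ`, and `Real.log ∘ g` is `log |g|`, whatever the sign of `g`
  let g : M → ℝ := fun q => θ' q (T q)
  have hg : ContMDiff (𝓡 (2 * n + 1)) 𝓘(ℝ, ℝ) ∞ g := hθ'.smooth T hT
  have hgθ : ∀ q, θ' q = g q • θ q := fun q =>
    hθ.eq_smul (fun z hz => hθ'.apply_re hz) (hT1 q)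
  have hg0 : ∀ q, g q ≠ 0 := fun q h => hθ'.ne_zero q (by rw [hgθ, h, zero_smul])
  have hf : ∀ q, ContMDiffAt (𝓡 (2 * n + 1)) 𝓘(ℝ, ℝ) ∞ (Real.log ∘ g) q := fun q =>
    (Real.contDiffAt_log.2 (hg0 q)).contMDiffAt.comp q (hg q)
  refine ⟨Real.log ∘ g, hf, fun p z hz T' hT' => ?_⟩
  have h1 : θ' = (fun q => g q • θ q : OneForm (2 * n + 1) M) := funext hgθ
  obtain ⟨hz1, hz2⟩ := (hθ.mem_leviDistribution_iff hn).1 hz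
  have hz0 := hθ.apply_re hz1
  have hT'0 : θ p T' ≠ 0 := fun h => hT' (by rw [hgθ, smul_apply, h, smul_zero])
  have h2 := hθ.extDeriv_smul_div hg (hg0 p) hz0 hz2 (hT1 p) hT'0
  rw [← h1] at h2
  have h3 : θ' p T' = g p * θ p T' := by rw [hgθ]; rfl
  rw [h3, h2, hθ.extDeriv_eq_of_dangelo hn hT hT1 hα hz0]
  congr 1
  have h4 := mfderiv_comp p ((Real.differentiableAt_log (hg0 p)).mdifferentiableAt)
    ((hg p).mdifferentiableAt (by simp))
  have h5 : mvfderiv (𝓡 (2 * n + 1)) (Real.log ∘ g) p z.re =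
      fderiv ℝ Real.log (g p) (mvfderiv (𝓡 (2 * n + 1)) g p z.re) := by
    rw [mfderiv_eq_fderiv] at h4
    exact congrArg (fun L : TangentSpace (𝓡 (2 * n + 1)) p →L[ℝ] ℝ => L z.re) h4
  rw [h5, (Real.hasDerivAt_log (hg0 p)).hasFDerivAt.fderiv, div_eq_mul_inv]
  rfl

end DAngeloClass

/-! ### The form `∂bar α_{1,0}` along a complex submanifold -/

section OneZeroPart

variable {n : ℕ} {M : Type*} [TopologicalSpace M]
  [ChartedSpace (EuclideanSpace ℝ (Fin (2 * n + 1))) M] [IsManifold (𝓡 (2 * n + 1)) ∞ M]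
  {S : CRStructure n M}

/-- The `(1,0)`-part of a vector is unique, because `T^{1,0}M` meets its conjugate trivially. -/
theorem CRStructure.oneZeroPart_eq {p : M}
    {z a : Complexified (TangentSpace (𝓡 (2 * n + 1)) p)} (ha : a ∈ S.T10 p)
    (hza : (z - a).conj ∈ S.T10 p) : S.oneZeroPart p z = a := by
  have h : ∃ a ∈ S.T10 p, (z - a).conj ∈ S.T10 p := ⟨a, ha, hza⟩
  rw [CRStructure.oneZeroPart, dif_pos h]
  obtain ⟨h1, h2⟩ := h.choose_spec
  set b := h.choose
  rw [← sub_eq_zero]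
  refine S.eq_zero_of_conj_mem p _ (Submodule.sub_mem _ h1 ha) ?_
  have h3 : (b - a).conj = (z - a).conj - (z - b).conj := by
    simp only [sub_eq_add_neg]
    ext1
    · change b.re + -a.re = z.re + -a.re + -(z.re + -b.re)
      abel
    · change -(b.im + -a.im) = -(z.im + -a.im) + - -(z.im + -b.im)
      abel
  rw [h3]
  exact Submodule.sub_mem _ hza h2

end OneZeroPart

section DbarForm

variable {n : ℕ} {M : Type*} [TopologicalSpace M] [T2Space M]
  [ChartedSpace (EuclideanSpace ℝ (Fin (2 * n + 1))) M] [IsManifold (𝓡 (2 * n + 1)) ∞ M]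
  {S : CRStructure n M} {m : ℕ}

local notation "𝔼" => EuclideanSpace ℝ (Fin m)

omit [T2Space M] in
theorem re_mvfderiv {f : M → ℂ} {p : M} (hf : MDifferentiableAt (𝓡 (2 * n + 1)) 𝓘(ℝ, ℂ) f p)
    (v : TangentSpace (𝓡 (2 * n + 1)) p) :
    (mvfderiv (𝓡 (2 * n + 1)) f p v).re = mvfderiv (𝓡 (2 * n + 1)) (fun q => (f q).re) p v := by
  have h := mfderiv_comp p (Complex.reCLM.differentiableAt (x := f p)).mdifferentiableAt hf
  rw [mfderiv_eq_fderiv, ContinuousLinearMap.fderiv] at h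
  exact (congrArg (fun L : TangentSpace (𝓡 (2 * n + 1)) p →L[ℝ] ℝ => L v) h).symm

omit [T2Space M] in
theorem im_mvfderiv {f : M → ℂ} {p : M} (hf : MDifferentiableAt (𝓡 (2 * n + 1)) 𝓘(ℝ, ℂ) f p)
    (v : TangentSpace (𝓡 (2 * n + 1)) p) :
    (mvfderiv (𝓡 (2 * n + 1)) f p v).im = mvfderiv (𝓡 (2 * n + 1)) (fun q => (f q).im) p v := by
  have h := mfderiv_comp p (Complex.imCLM.differentiableAt (x := f p)).mdifferentiableAt hf
  rw [mfderiv_eq_fderiv, ContinuousLinearMap.fderiv] at h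
  exact (congrArg (fun L : TangentSpace (𝓡 (2 * n + 1)) p →L[ℝ] ℝ => L v) h).symm

/-- The real part of `∂bar α_{1,0} (Z, conj Z)` for a section `Z` extending the vector field
`v - i J v` of a complex submanifold. -/
theorem CRStructure.re_dbarForm {κ : 𝔼 → M} {O : Set 𝔼} (hO : IsOpen O)
    (hκ : ContMDiffOn 𝓘(ℝ, 𝔼) (𝓡 (2 * n + 1)) ∞ κ O) {J : 𝔼 → 𝔼 →L[ℝ] 𝔼}
    (hJ : ContDiffOn ℝ ∞ J O)
    (hT : ∀ z ∈ O, ∀ v, Complexified.mk (mfderiv 𝓘(ℝ, 𝔼) (𝓡 (2 * n + 1)) κ z v)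
      (-mfderiv 𝓘(ℝ, 𝔼) (𝓡 (2 * n + 1)) κ z (J z v)) ∈ S.T10 (κ z))
    {α : OneForm (2 * n + 1) M} (hα : α.Smooth) {β : 𝔼 → 𝔼 →L[ℝ] ℝ}
    (hβ : ∀ z ∈ O, ∀ v, β z v = α (κ z) (mfderiv 𝓘(ℝ, 𝔼) (𝓡 (2 * n + 1)) κ z v))
    {Z : CVField (2 * n + 1) M} (hZ : S.IsSection Z) {v : 𝔼}
    (hZv : ∀ z ∈ O, Z (κ z) = Complexified.mk (mfderiv 𝓘(ℝ, 𝔼) (𝓡 (2 * n + 1)) κ z v)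
      (-mfderiv 𝓘(ℝ, 𝔼) (𝓡 (2 * n + 1)) κ z (J z v))) {y : 𝔼} (hy : y ∈ O) :
    (S.dbarForm α Z Z (κ y)).re = -(1 / 2) * (fderiv ℝ (fun z => β z v) y v +
      fderiv ℝ (fun z => β z (J z v)) y (J y v) +
      β y (J y (fderiv ℝ (fun z => J z v) y v))) := by
  have hκd : MDifferentiableAt 𝓘(ℝ, 𝔼) (𝓡 (2 * n + 1)) κ y :=
    (hκ.contMDiffAt (hO.mem_nhds hy)).mdifferentiableAt (by simp)
  have hJd : DifferentiableAt ℝ (fun z => J z v) y :=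
    ((hJ.contDiffAt (hO.mem_nhds hy)).differentiableAt (by simp)).clm_apply
      (differentiableAt_const v)
  set f : M → ℂ := fun q => cext (α q) (Z q) with hf
  have h1s : ContMDiff (𝓡 (2 * n + 1)) 𝓘(ℝ, ℝ) ∞ (fun q => α q (Z.re q)) := hα _ hZ.1.1
  have h2s : ContMDiff (𝓡 (2 * n + 1)) 𝓘(ℝ, ℝ) ∞ (fun q => α q (Z.im q)) := hα _ hZ.1.2
  have hfre : (fun q => (f q).re) = fun q => α q (Z.re q) := by
    funext q; simp [hf, cext, CVField.re]
  have hfim : (fun q => (f q).im) = fun q => α q (Z.im q) := by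
    funext q; simp [hf, cext, CVField.im]
  have hfs : MDifferentiableAt (𝓡 (2 * n + 1)) 𝓘(ℝ, ℂ) f (κ y) := by
    have hG : ContDiff ℝ ∞ (fun x : ℝ × ℝ => (x.1 : ℂ) + Complex.I * (x.2 : ℂ)) :=
      (Complex.ofRealCLM.contDiff.comp contDiff_fst).add
        (contDiff_const.mul (Complex.ofRealCLM.contDiff.comp contDiff_snd))
    exact ((hG.contMDiff.comp (h1s.prodMk_space h2s)) (κ y)).mdifferentiableAt (by simp)
  -- the derivative term
  have hZre : ∀ z ∈ O, Z.re (κ z) = mfderiv 𝓘(ℝ, 𝔼) (𝓡 (2 * n + 1)) κ z v := fun z hz =>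
    congrArg Complexified.re (hZv z hz)
  have hZim : ∀ z ∈ O, Z.im (κ z) = mfderiv 𝓘(ℝ, 𝔼) (𝓡 (2 * n + 1)) κ z (-J z v) := fun z hz =>
    (congrArg Complexified.im (hZv z hz)).trans (map_neg _ _).symm
  have e1 : mvfderiv (𝓡 (2 * n + 1)) (fun q => α q (Z.re q)) (κ y) (Z.re (κ y)) =
      fderiv ℝ (fun z => β z v) y v := by
    rw [hZre y hy, mvfderiv_mfderiv ((h1s _).mdifferentiableAt (by simp)) hκd]
    refine congrArg (fun L : 𝔼 →L[ℝ] ℝ => L v) (Filter.EventuallyEq.fderiv_eq ?_)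
    filter_upwards [hO.mem_nhds hy] with z hz
    rw [Function.comp_apply, hZre z hz, hβ z hz]
  have e2 : mvfderiv (𝓡 (2 * n + 1)) (fun q => α q (Z.im q)) (κ y) (Z.im (κ y)) =
      fderiv ℝ (fun z => β z (J z v)) y (J y v) := by
    rw [hZim y hy, mvfderiv_mfderiv ((h2s _).mdifferentiableAt (by simp)) hκd]
    have h3 : (fun q => α q (Z.im q)) ∘ κ =ᶠ[𝓝 y] fun z => -β z (J z v) := by
      filter_upwards [hO.mem_nhds hy] with z hz
      rw [Function.comp_apply, hZim z hz, ← hβ z hz, map_neg]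
    rw [h3.fderiv_eq, fderiv_fun_neg, map_neg, neg_apply, neg_neg]
  have e3 : (Z.conj.deriv f (κ y)).re = fderiv ℝ (fun z => β z v) y v +
      fderiv ℝ (fun z => β z (J z v)) y (J y v) := by
    have hc : Z.conj.im (κ y) = -Z.im (κ y) := rfl
    unfold CVField.deriv
    rw [hc, map_neg, Complex.add_re, Complex.mul_re, Complex.I_re, Complex.I_im, Complex.neg_im,
      re_mvfderiv hfs, im_mvfderiv hfs, hfre, hfim, e2]
    change mvfderiv (𝓡 (2 * n + 1)) (fun q => α q (Z.re q)) (κ y) (Z.re (κ y)) + _ = _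
    rw [e1]
    ring
  -- the bracket term
  set w := fderiv ℝ (fun z => J z v) y v with hw
  have hbr : VectorField.mlieBracket (𝓡 (2 * n + 1)) Z.re Z.im (κ y) =
      -mfderiv 𝓘(ℝ, 𝔼) (𝓡 (2 * n + 1)) κ y w := by
    have h := mlieBracket_mfderiv hO hκ hy (hZ.1.1.smoothAt _) (hZ.1.2.smoothAt _)
      (a := fun _ => v) (b := fun z => -J z v) (differentiableAt_const v) hJd.neg hZre hZim
    have h' : fderiv ℝ (fun z => -J z v) y v - fderiv ℝ (fun _ : 𝔼 => v) y (-J y v) = -w := by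
      rw [fderiv_const_apply, fderiv_fun_neg, zero_apply, sub_zero, neg_apply]
    rw [h, h']
    exact map_neg _ _
  have hbr2 : Z.bracket Z.conj (κ y) = Complexified.mk 0
      ((2 : ℝ) • mfderiv 𝓘(ℝ, 𝔼) (𝓡 (2 * n + 1)) κ y w) := by
    have hcim : Z.conj.im = (-1 : ℝ) • Z.im := by
      funext q
      change -(Z q).im = (-1 : ℝ) • (Z q).im
      rw [neg_one_smul]
    have hcre : Z.conj.re = Z.re := rfl
    have h1 := VectorField.mlieBracket_const_smul_right (c := (-1 : ℝ)) (V := Z.im)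
      (hZ.1.2.mdiffAt (κ y))
    have h2 := VectorField.mlieBracket_const_smul_right (c := (-1 : ℝ)) (V := Z.re)
      (hZ.1.2.mdiffAt (κ y))
    have h3 : VectorField.mlieBracket (𝓡 (2 * n + 1)) Z.im Z.re (κ y) =
        -VectorField.mlieBracket (𝓡 (2 * n + 1)) Z.re Z.im (κ y) :=
      VectorField.mlieBracket_swap_apply
    unfold CVField.bracket
    rw [hcim, hcre, h1, h2, h3, hbr]
    simp only [VectorField.mlieBracket_self, Pi.zero_apply, smul_zero, sub_zero]
    congr 1
    module
  have hoz : S.oneZeroPart (κ y) (Z.bracket Z.conj (κ y)) = Complexified.mk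
      (mfderiv 𝓘(ℝ, 𝔼) (𝓡 (2 * n + 1)) κ y (J y w)) (mfderiv 𝓘(ℝ, 𝔼) (𝓡 (2 * n + 1)) κ y w) := by
    have ha := I_smul_mem_T10 (hT y hy w)
    simp only [Complexified.re_mk, Complexified.im_mk, neg_neg] at ha
    refine CRStructure.oneZeroPart_eq ha ?_
    have hb := Submodule.neg_mem _ ha
    convert hb using 1
    rw [hbr2, sub_eq_add_neg]
    ext1
    · change (0 : TangentSpace (𝓡 (2 * n + 1)) (κ y)) + -_ = -_
      rw [zero_add]
    · have h4 : ∀ u : TangentSpace (𝓡 (2 * n + 1)) (κ y), -((2 : ℝ) • u + -u) = -u := fun u => by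
        module
      exact h4 _
  unfold CRStructure.dbarForm
  rw [hoz]
  have e4 : ((1 / 2 : ℂ) * (-(Z.conj.deriv f (κ y)) - cext (α (κ y)) (Complexified.mk
      (mfderiv 𝓘(ℝ, 𝔼) (𝓡 (2 * n + 1)) κ y (J y w))
      (mfderiv 𝓘(ℝ, 𝔼) (𝓡 (2 * n + 1)) κ y w)))).re = (1 / 2) * (-(Z.conj.deriv f (κ y)).re -
      α (κ y) (mfderiv 𝓘(ℝ, 𝔼) (𝓡 (2 * n + 1)) κ y (J y w))) := by
    have : (1 / 2 : ℂ) = ((1 / 2 : ℝ) : ℂ) := by norm_num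
    rw [this, Complex.re_ofReal_mul]
    simp [cext]
  refine e4.trans ?_
  rw [e3, ← hβ y hy]
  ring

variable {V : Type*} [TopologicalSpace V] [ChartedSpace (EuclideanSpace ℝ (Fin m)) V]
  [IsManifold (𝓡 m) ∞ V] {ι : V → M}

/-- If the logarithmic contractions of `dθ_k` with transverse vectors `T`, which represent members
of the D'Angelo class, satisfy `DbarIneqAt` along a complex submanifold with summable constants,
then the restriction of the D'Angelo class to the submanifold is exact. The charts, and the almost
complex structures `J` on them, are those of `CRStructure.IsComplexSubmanifold.exists_sections`. -/
theorem CRStructure.IsComplexSubmanifold.isExact_pullback (hn : 1 ≤ n) (hS : S.IsPseudoconvex)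
    (hV : S.IsComplexSubmanifold m ι) {α : OneForm (2 * n + 1) M} (hα : S.IsDAngeloForm α)
    {θ : ℕ → OneForm (2 * n + 1) M} (hθ : ∀ k, S.IsPseudoHermitian (θ k)) {t : ℕ → ℝ}
    (ht : ∀ k, 0 < t k) (hts : Summable t)
    (h : ∀ k (x₀ : V) (O : Set 𝔼), O ⊆ (extChartAt (𝓡 m) x₀).target → IsOpen O →
      ∀ J : 𝔼 → 𝔼 →L[ℝ] 𝔼, ContDiffOn ℝ ∞ J O →
      (∀ v : 𝔼, ∃ Z : CVField (2 * n + 1) M, S.IsSection Z ∧ ∀ y ∈ O, Z (chartMap ι x₀ y) =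
          Complexified.mk (mfderiv 𝓘(ℝ, 𝔼) (𝓡 (2 * n + 1)) (chartMap ι x₀) y v)
            (-mfderiv 𝓘(ℝ, 𝔼) (𝓡 (2 * n + 1)) (chartMap ι x₀) y (J y v))) →
      ∀ β : 𝔼 → 𝔼 →L[ℝ] ℝ, ContDiffOn ℝ ∞ β O →
      (∀ y ∈ O, ∀ v : 𝔼, ∀ T, θ k (chartMap ι x₀ y) T ≠ 0 → β y v = (θ k).extDeriv (chartMap ι x₀ y)
        (mfderiv 𝓘(ℝ, 𝔼) (𝓡 (2 * n + 1)) (chartMap ι x₀) y v) T / θ k (chartMap ι x₀ y) T) →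
      ∀ y ∈ O, DbarIneqAt J β (t k) y) :
    (α.pullback ι : OneForm m V).IsExact := by
  choose f hf hfα using fun k => hα.exists_add_mvfderiv_eq hn (hθ k)
  refine OneForm.isExact_of_dbarIneqAt _ (f := fun k => f k ∘ ι)
    (fun k => (hf k).comp hV.contMDiff) ht hts fun x₀ => ?_
  obtain ⟨O, hO, hOo, hcO, J, hJ, hZ⟩ := hV.exists_sections hn x₀
  have hκ : ContMDiffOn 𝓘(ℝ, 𝔼) (𝓡 (2 * n + 1)) ∞ (chartMap ι x₀) O :=
    (hV.contMDiffOn_chartMap x₀).mono hO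
  have hαs : ContDiffOn ℝ ∞ ((α.pullback ι : OneForm m V).inChart x₀) O := fun y hy =>
    ((hα.smooth.contDiffAt_comp_mfderiv hOo hκ hy).congr_of_eventuallyEq (by
      filter_upwards [hOo.mem_nhds hy] with z hz
      exact α.inChart_pullback hV.contMDiff (hO hz))).contDiffWithinAt
  have hfs : ∀ k, ContDiffOn ℝ ∞ ((f k ∘ ι) ∘ (extChartAt (𝓡 m) x₀).symm) O := fun k =>
    (contMDiffOn_iff_contDiffOn.1 ((hf k).comp_contMDiffOn hκ))
  refine ⟨O, hO, hOo, hcO, J, hJ, hαs, fun k y hy => ?_⟩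
  refine h k x₀ O hO hOo J hJ hZ _ (hαs.add ((hfs k).fderiv_of_isOpen hOo (by simp))) ?_ y hy
  intro y hy v T hT
  obtain ⟨Z, hZs, hZv⟩ := hZ v
  have hjb : S.IsJb (chartMap ι x₀ y)
      (mfderiv 𝓘(ℝ, 𝔼) (𝓡 (2 * n + 1)) (chartMap ι x₀) y v)
      (mfderiv 𝓘(ℝ, 𝔼) (𝓡 (2 * n + 1)) (chartMap ι x₀) y (J y v)) := by
    have := hZs.2 (chartMap ι x₀ y)
    rwa [hZv y hy] at this
  have hnull : Complexified.mk (mfderiv 𝓘(ℝ, 𝔼) (𝓡 (2 * n + 1)) (chartMap ι x₀) y v)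
      (-mfderiv 𝓘(ℝ, 𝔼) (𝓡 (2 * n + 1)) (chartMap ι x₀) y (J y v)) ∈
      S.leviDistribution (chartMap ι x₀ y) := by
    rw [mfderiv_chartMap hV.contMDiff (hO hy)] at hjb ⊢
    exact hV.mem_leviDistribution hn hS hjb
  have h1 := hfα k _ _ hnull T hT
  rw [Complexified.re_mk] at h1
  rw [← h1, add_apply, α.inChart_pullback hV.contMDiff (hO hy)]
  congr 1
  exact (mvfderiv_mfderiv ((hf k _).mdifferentiableAt (by simp))
    ((hκ.contMDiffAt (hOo.mem_nhds hy)).mdifferentiableAt (by simp)) v).symm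

end DbarForm

/-! ### Positivity of the norm of the Levi core -/

section CorePositivity

variable {n : ℕ} {M : Type*} [TopologicalSpace M] [T2Space M]
  [ChartedSpace (EuclideanSpace ℝ (Fin (2 * n + 1))) M] [IsManifold (𝓡 (2 * n + 1)) ∞ M]
  {S : CRStructure n M} {m : ℕ}
  {V : Type*} [TopologicalSpace V] [ChartedSpace (EuclideanSpace ℝ (Fin m)) V]
  [IsManifold (𝓡 m) ∞ V] {ι : V → M}

local notation "𝔼" => EuclideanSpace ℝ (Fin m)

theorem CRStructure.exists_formIneq_of_dangeloNorm_lt {D : CDistribution (2 * n + 1) M} {ε : ℝ}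
    (h : S.dangeloNorm D < ENNReal.ofReal ε) :
    ∃ α, S.IsDAngeloForm α ∧ ∃ t, 0 < t ∧ t < ε ∧ S.FormIneq α D t := by
  simp only [CRStructure.dangeloNorm, CRStructure.formNorm, iInf_lt_iff] at h
  obtain ⟨α, hα, t, ht, hI, hlt⟩ := h
  exact ⟨α, hα, t, ht, (ENNReal.ofReal_lt_ofReal_iff_of_nonneg ht.le).1 hlt, hI⟩

/-- The norm of the Levi core is positive if the D'Angelo class is nontrivial on some complex
submanifold. -/
theorem CRStructure.IsComplexSubmanifold.dangeloNorm_leviCore_pos (hn : 1 ≤ n)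
    (hS : S.IsPseudoconvex) (hV : S.IsComplexSubmanifold m ι) {α : OneForm (2 * n + 1) M}
    (hα : S.IsDAngeloForm α) (hαV : ¬ (α.pullback ι : OneForm m V).IsExact) :
    0 < S.dangeloNorm S.leviCore := by
  by_contra h0
  rw [not_lt, nonpos_iff_eq_zero] at h0
  -- constants smaller than `2^(-k)`, which are summable
  have hε : ∀ k : ℕ, S.dangeloNorm S.leviCore < ENNReal.ofReal ((1 / 2 : ℝ) ^ k) := fun k => by
    rw [h0, ENNReal.ofReal_pos]
    positivity
  choose a ha t ht0 ht1 hI using fun k => S.exists_formIneq_of_dangeloNorm_lt (hε k)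
  have hts : Summable t := Summable.of_nonneg_of_le (fun k => (ht0 k).le) (fun k => (ht1 k).le)
    summable_geometric_two
  have has := fun k => (ha k).smooth
  choose θ T hθ hT hT1 haT using ha
  refine hαV (hV.isExact_pullback hn hS hα hθ ht0 hts ?_)
  intro k x₀ O hO hOo J hJ hZ β hβs hβ y hy v
  have hκ : ContMDiffOn 𝓘(ℝ, 𝔼) (𝓡 (2 * n + 1)) ∞ (chartMap ι x₀) O :=
    (hV.contMDiffOn_chartMap x₀).mono hO
  have hT10 : ∀ z ∈ O, ∀ v, Complexified.mk (mfderiv 𝓘(ℝ, 𝔼) (𝓡 (2 * n + 1)) (chartMap ι x₀) z v)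
      (-mfderiv 𝓘(ℝ, 𝔼) (𝓡 (2 * n + 1)) (chartMap ι x₀) z (J z v)) ∈ S.T10 (chartMap ι x₀ z) := by
    intro z hz v
    obtain ⟨Z, hZs, hZv⟩ := hZ v
    rw [← hZv z hz]
    exact hZs.2 _
  have hβ' : ∀ z ∈ O, ∀ v, β z v = a k (chartMap ι x₀ z)
      (mfderiv 𝓘(ℝ, 𝔼) (𝓡 (2 * n + 1)) (chartMap ι x₀) z v) := by
    intro z hz v
    have h1 := hT1 k (chartMap ι x₀ z)
    rw [hβ z hz v (T k _) (by rw [h1]; exact one_ne_zero), h1, div_one]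
    exact ((hθ k).extDeriv_eq_of_dangelo hn (hT k) (hT1 k) (haT k)
      ((hθ k).apply_re (hT10 z hz v))).symm
  by_cases hv : v = 0
  · subst hv
    simp
  obtain ⟨Z, hZs, hZv⟩ := hZ v
  have hre := CRStructure.re_dbarForm hOo hκ hJ hT10 (has k) hβ' hZs hZv hy
  have hcore : Z (chartMap ι x₀ y) ∈ S.leviCore (chartMap ι x₀ y) := by
    have h1 := hT10 y hy v
    rw [hZv y hy]
    rw [mfderiv_chartMap hV.contMDiff (hO hy)] at h1 ⊢
    exact hV.mem_leviCore hn hS h1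
  have hne : Z (chartMap ι x₀ y) ≠ 0 := by
    intro h1
    rw [hZv y hy] at h1
    exact hv (hV.injective_mfderiv_chartMap (hO hy)
      ((congrArg Complexified.re h1).trans (map_zero _).symm))
  have hlt := hI k Z hZs _ hcore hne
  rw [hre] at hlt
  have hnorm : ‖cext (a k (chartMap ι x₀ y)) (Z (chartMap ι x₀ y))‖ ^ 2 =
      β y v ^ 2 + β y (J y v) ^ 2 := by
    rw [hZv y hy, ← Complex.normSq_eq_norm_sq, Complex.normSq_apply, hβ' y hy v, hβ' y hy (J y v)]
    simp only [cext, Complexified.re_mk, Complexified.im_mk, map_neg, Complex.add_re,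
      Complex.ofReal_re, Complex.mul_re, Complex.I_re, Complex.I_im, Complex.ofReal_im,
      Complex.add_im, Complex.mul_im, Complex.ofReal_neg, Complex.neg_re, Complex.neg_im]
    ring
  rw [hnorm] at hlt
  linarith

theorem CRStructure.dangeloNorm_le_dangeloNormK (h : HermitianMetric (2 * n + 1) M) (K : ℝ≥0∞)
    (D : CDistribution (2 * n + 1) M) : S.dangeloNorm D ≤ S.dangeloNormK h K D :=
  le_iInf fun α => le_iInf fun hα => le_iInf fun _ => iInf₂_le α hα

end CorePositivity

/-! ### The complex Hessian -/

section ComplexHessian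

variable {E H : Type*} [NormedAddCommGroup E] [NormedSpace ℝ E]
  [NormedAddCommGroup H] [NormedSpace ℝ H]

/-- The operator `v (β(v)) + Jv (β(Jv)) + β(J [v, Jv])` on one-forms `β`, for a constant vector
field `v`; if `β = dw`, it is four times the complex Hessian of `w`. -/
def dbarOp (J : E → E →L[ℝ] E) (β : E → E →L[ℝ] ℝ) (y v : E) : ℝ :=
  fderiv ℝ (fun z => β z v) y v + fderiv ℝ (fun z => β z (J z v)) y (J y v) +
    β y (J y (fderiv ℝ (fun z => J z v) y v))

/-- Four times the complex Hessian of `u` for a constant complex structure `j`. -/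
def cHess (j : H →L[ℝ] H) (u : H → ℝ) (z v : H) : ℝ :=
  fderiv ℝ (fderiv ℝ u) z v v + fderiv ℝ (fderiv ℝ u) z (j v) (j v)

theorem isSymmSndFDerivAt_of_contDiffAt {F : E → H} {y : E} (hF : ContDiffAt ℝ ∞ F y) :
    IsSymmSndFDerivAt ℝ F y :=
  hF.isSymmSndFDerivAt (by simpa using WithTop.coe_le_coe.2 (le_top (a := (2 : ℕ∞))))

theorem differentiableAt_fderiv {F : E → H} {y : E} (hF : ContDiffAt ℝ ∞ F y) :
    DifferentiableAt ℝ (fderiv ℝ F) y :=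
  (hF.fderiv_right (m := ∞) (by simp)).differentiableAt (by simp)

theorem eventually_differentiableAt {F : E → H} {y : E} (hF : ContDiffAt ℝ ∞ F y) :
    ∀ᶠ z in 𝓝 y, DifferentiableAt ℝ F z := by
  have h1 : ContDiffAt ℝ 1 F y := hF.of_le (by simp)
  filter_upwards [h1.eventually (by simp)] with z hz
  exact hz.differentiableAt (by simp)

theorem fderiv_clm_apply_apply {G : Type*} [NormedAddCommGroup G] [NormedSpace ℝ G]
    {F : E → H →L[ℝ] G} {a : E → H} {y : E}
    (hF : DifferentiableAt ℝ F y) (ha : DifferentiableAt ℝ a y) (u : E) :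
    fderiv ℝ (fun z => F z (a z)) y u = fderiv ℝ F y u (a y) + F y (fderiv ℝ a y u) := by
  rw [fderiv_clm_apply hF ha]
  simp [add_comm]

/-- The complex Hessian is invariant under pseudo-holomorphic maps. -/
theorem dbarOp_fderiv_comp {j : H →L[ℝ] H} (hj : ∀ v, j (j v) = -v) {J : E → E →L[ℝ] E}
    {F : E → H} {u : H → ℝ} {y : E} (hJ : DifferentiableAt ℝ J y) (hF : ContDiffAt ℝ ∞ F y)
    (hu : ContDiffAt ℝ ∞ u (F y))
    (hFJ : ∀ᶠ z in 𝓝 y, ∀ v, fderiv ℝ F z (J z v) = j (fderiv ℝ F z v)) (v : E) :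
    dbarOp J (fderiv ℝ (u ∘ F)) y v = cHess j u (F y) (fderiv ℝ F y v) := by
  have hF1 : DifferentiableAt ℝ F y := hF.differentiableAt (by simp)
  have hF2 := differentiableAt_fderiv hF
  have hu2 := differentiableAt_fderiv hu
  have hc : ∀ᶠ z in 𝓝 y, fderiv ℝ (u ∘ F) z = (fderiv ℝ u (F z)).comp (fderiv ℝ F z) := by
    filter_upwards [eventually_differentiableAt hF,
      hF.continuousAt.eventually (eventually_differentiableAt hu)] with z h1 h2
    exact fderiv_comp z h2 h1
  have hDu : DifferentiableAt ℝ (fun z => fderiv ℝ u (F z)) y := hu2.comp y hF1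
  have hDu' : fderiv ℝ (fun z => fderiv ℝ u (F z)) y =
      (fderiv ℝ (fderiv ℝ u) (F y)).comp (fderiv ℝ F y) := fderiv_comp y hu2 hF1
  have hA : DifferentiableAt ℝ (fun z => fderiv ℝ F z v) y :=
    hF2.clm_apply (differentiableAt_const v)
  have hA' : ∀ w, fderiv ℝ (fun z => fderiv ℝ F z v) y w = fderiv ℝ (fderiv ℝ F) y w v := by
    intro w
    rw [fderiv_clm_apply_apply hF2 (differentiableAt_const v)]
    simp
  have hY : DifferentiableAt ℝ (fun z => J z v) y := hJ.clm_apply (differentiableAt_const v)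
  have e1 : fderiv ℝ (fun z => fderiv ℝ (u ∘ F) z v) y v =
      fderiv ℝ (fderiv ℝ u) (F y) (fderiv ℝ F y v) (fderiv ℝ F y v) +
      fderiv ℝ u (F y) (fderiv ℝ (fderiv ℝ F) y v v) := by
    have h1 : (fun z => fderiv ℝ (u ∘ F) z v) =ᶠ[𝓝 y] fun z => fderiv ℝ u (F z) (fderiv ℝ F z v) :=
      hc.mono fun z hz => congrArg (fun L => L v) hz
    rw [h1.fderiv_eq, fderiv_clm_apply_apply hDu hA, hDu', hA']
    rfl
  have e2 : fderiv ℝ (fun z => fderiv ℝ (u ∘ F) z (J z v)) y (J y v) =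
      fderiv ℝ (fderiv ℝ u) (F y) (j (fderiv ℝ F y v)) (j (fderiv ℝ F y v)) +
      fderiv ℝ u (F y) (j (fderiv ℝ (fderiv ℝ F) y (J y v) v)) := by
    have h1 : (fun z => fderiv ℝ (u ∘ F) z (J z v)) =ᶠ[𝓝 y]
        fun z => fderiv ℝ u (F z) (j (fderiv ℝ F z v)) := by
      filter_upwards [hc, hFJ] with z hz hz'
      rw [hz, ContinuousLinearMap.comp_apply, hz']
    have h2 : fderiv ℝ (fun z => j (fderiv ℝ F z v)) y =
        j.comp (fderiv ℝ (fun z => fderiv ℝ F z v) y) :=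
      (j.hasFDerivAt.comp y hA.hasFDerivAt).fderiv
    rw [h1.fderiv_eq, fderiv_clm_apply_apply (a := fun z => j (fderiv ℝ F z v)) hDu
      (j.differentiableAt.comp y hA), hDu']
    have h3 := hFJ.self_of_nhds v
    rw [ContinuousLinearMap.comp_apply, h3]
    rw [h2, ContinuousLinearMap.comp_apply, hA']
  have e3 : fderiv ℝ F y (fderiv ℝ (fun z => J z v) y v) =
      j (fderiv ℝ (fderiv ℝ F) y v v) - fderiv ℝ (fderiv ℝ F) y v (J y v) := by
    have h1 : (fun z => fderiv ℝ F z (J z v)) =ᶠ[𝓝 y] fun z => j (fderiv ℝ F z v) :=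
      hFJ.mono fun z hz => hz v
    have h2 := Filter.EventuallyEq.fderiv_eq (𝕜 := ℝ) h1
    have h3 : fderiv ℝ (fun z => j (fderiv ℝ F z v)) y =
        j.comp (fderiv ℝ (fun z => fderiv ℝ F z v) y) :=
      (j.hasFDerivAt.comp y hA.hasFDerivAt).fderiv
    rw [h3] at h2
    have h4 := congrArg (fun L => L v) h2
    simp only [fderiv_clm_apply_apply hF2 hY, ContinuousLinearMap.comp_apply, hA'] at h4
    rw [← h4]
    abel
  unfold dbarOp cHess
  rw [e1, e2, hc.self_of_nhds, ContinuousLinearMap.comp_apply, hFJ.self_of_nhds, e3, map_sub, hj,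
    (isSymmSndFDerivAt_of_contDiffAt hF).eq (J y v) v]
  simp only [map_sub, map_neg]
  ring

theorem cHess_congr {j : H →L[ℝ] H} {u u' : H → ℝ} {z : H} (h : u =ᶠ[𝓝 z] u') (v : H) :
    cHess j u z v = cHess j u' z v := by
  unfold cHess
  rw [h.fderiv.fderiv_eq]

theorem dbarOp_const_fderiv {j : H →L[ℝ] H} {u : H → ℝ} {z : H} (hu : ContDiffAt ℝ ∞ u z) (v : H) :
    dbarOp (fun _ => j) (fderiv ℝ u) z v = cHess j u z v := by
  have hu2 := differentiableAt_fderiv hu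
  unfold dbarOp cHess
  rw [fderiv_clm_apply_apply hu2 (differentiableAt_const v),
    fderiv_clm_apply_apply hu2 (differentiableAt_const (j v))]
  simp

/-- The derivative of the complex Hessian in a direction is the complex Hessian of the
derivative. -/
theorem fderiv_cHess {j : H →L[ℝ] H} {r : H → ℝ} {W : Set H} (hW : IsOpen W)
    (hr : ContDiffOn ℝ ∞ r W) {z : H} (hz : z ∈ W) (v w : H) :
    fderiv ℝ (fun x => cHess j r x v) z w = cHess j (fun x => fderiv ℝ r x w) z v := by
  have hra : ∀ x ∈ W, ContDiffAt ℝ ∞ r x := fun x hx => hr.contDiffAt (hW.mem_nhds hx)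
  have hs : ∀ a, ContDiffOn ℝ ∞ (fun x => fderiv ℝ r x a) W := fun a =>
    (hr.fderiv_of_isOpen hW (m := ∞) (by simp)).clm_apply contDiffOn_const
  have hsa : ∀ a, ∀ x ∈ W, ContDiffAt ℝ ∞ (fun x => fderiv ℝ r x a) x := fun a x hx =>
    (hs a).contDiffAt (hW.mem_nhds hx)
  have h1 : ∀ a b, ∀ x ∈ W, fderiv ℝ (fun x => fderiv ℝ r x a) x b =
      fderiv ℝ (fderiv ℝ r) x b a := by
    intro a b x hx
    rw [fderiv_clm_apply_apply (differentiableAt_fderiv (hra x hx)) (differentiableAt_const a)]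
    simp
  have hd : ∀ a b, DifferentiableAt ℝ (fun x => fderiv ℝ (fderiv ℝ r) x b a) z := by
    intro a b
    have : (fun x => fderiv ℝ (fderiv ℝ r) x b a) =ᶠ[𝓝 z]
        fun x => fderiv ℝ (fun x => fderiv ℝ r x a) x b := by
      filter_upwards [hW.mem_nhds hz] with x hx
      rw [h1 a b x hx]
    exact ((differentiableAt_fderiv (hsa a z hz)).clm_apply
      (differentiableAt_const b)).congr_of_eventuallyEq this
  have h2 : ∀ a, fderiv ℝ (fun x => fderiv ℝ (fderiv ℝ r) x a a) z w =
      fderiv ℝ (fderiv ℝ (fun x => fderiv ℝ r x w)) z a a := by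
    intro a
    have e1 : (fun x => fderiv ℝ (fderiv ℝ r) x a a) =ᶠ[𝓝 z]
        fun x => fderiv ℝ (fun x => fderiv ℝ r x a) x a := by
      filter_upwards [hW.mem_nhds hz] with x hx
      rw [h1 a a x hx]
    have e2 : (fun x => fderiv ℝ (fun x => fderiv ℝ r x a) x w) =ᶠ[𝓝 z]
        fun x => fderiv ℝ (fun x => fderiv ℝ r x w) x a := by
      filter_upwards [hW.mem_nhds hz] with x hx
      rw [h1 a w x hx, h1 w a x hx, (isSymmSndFDerivAt_of_contDiffAt (hra x hx)).eq]
    have e3 : ∀ b c, fderiv ℝ (fun x => fderiv ℝ (fun x => fderiv ℝ r x b) x c) z =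
        (fderiv ℝ (fderiv ℝ (fun x => fderiv ℝ r x b)) z).flip c := by
      intro b c
      ext d
      rw [fderiv_clm_apply_apply (differentiableAt_fderiv (hsa b z hz)) (differentiableAt_const c)]
      simp
    have e4 := Filter.EventuallyEq.fderiv_eq (𝕜 := ℝ) e2
    rw [e3, e3] at e4
    rw [e1.fderiv_eq, e3, ContinuousLinearMap.flip_apply,
      (isSymmSndFDerivAt_of_contDiffAt (hsa a z hz)).eq]
    exact congrArg (fun L : H →L[ℝ] ℝ => L a) e4
  unfold cHess
  rw [fderiv_fun_add (hd _ _) (hd _ _), add_apply, h2, h2]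

end ComplexHessian

/-! ### The limit of plurisubharmonicity at a boundary point -/

section BoundaryLimit

variable {E H : Type*} [NormedAddCommGroup E] [NormedSpace ℝ E]
  [NormedAddCommGroup H] [NormedSpace ℝ H]

/-- The derivative as a limit of difference quotients from the side of `-N`. -/
theorem tendsto_div_of_differentiableAt {g : H → ℝ} {z N : H} (hg : DifferentiableAt ℝ g z)
    (h0 : g z = 0) : Tendsto (fun ε : ℝ => g (z - ε • N) / ε) (𝓝[>] 0) (𝓝 (-fderiv ℝ g z N)) := by
  have h1 : HasDerivAt (fun ε : ℝ => z - ε • N) (-N) 0 := by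
    have := ((hasDerivAt_id (0 : ℝ)).smul_const N).const_sub z
    simpa using this
  have h2 : HasFDerivAt g (fderiv ℝ g z) (z - (0 : ℝ) • N) := by simpa using hg.hasFDerivAt
  have h3 := (h2.comp_hasDerivAt 0 h1).tendsto_slope.mono_left
    (nhdsWithin_mono 0 (fun x (hx : 0 < x) => hx.ne'))
  rw [map_neg] at h3
  refine h3.congr fun ε => ?_
  simp [slope_def_field, h0]

/-- The infinitesimal form at a boundary point of the inequality expressing that `-(-r)^δ` is
plurisubharmonic, obtained by rescaling along the inner normal direction `-N` and the vectors
`A + ε (c₁ + i c₂) N`. -/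
theorem boundary_inequality {j : H →L[ℝ] H} (hj : ∀ v, j (j v) = -v) {r : H → ℝ} {W : Set H}
    (hW : IsOpen W) (hr : ContDiffOn ℝ ∞ r W) {z N A : H} (hz : z ∈ W) (h0 : r z = 0)
    (hN : fderiv ℝ r z N = 1) (hjN : fderiv ℝ r z (j N) = 0) (hA : fderiv ℝ r z A = 0)
    (hjA : fderiv ℝ r z (j A) = 0) (hL : cHess j r z A = 0) {τ : ℝ}
    (hpsh : ∀ x ∈ W, r x < 0 → ∀ v, 0 ≤ -r x * cHess j r x v +
      τ * (fderiv ℝ r x v ^ 2 + fderiv ℝ r x (j v) ^ 2)) (c₁ c₂ : ℝ) :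
    0 ≤ -fderiv ℝ (fun x => cHess j r x A) z N +
      2 * (c₁ * (fderiv ℝ (fderiv ℝ r) z A N + fderiv ℝ (fderiv ℝ r) z (j A) (j N)) +
        c₂ * (fderiv ℝ (fderiv ℝ r) z A (j N) - fderiv ℝ (fderiv ℝ r) z (j A) N)) +
      τ * ((c₁ - fderiv ℝ (fderiv ℝ r) z N A) ^ 2 +
        (c₂ + fderiv ℝ (fderiv ℝ r) z N (j A)) ^ 2) := by
  -- the hypothesis at the point `z - ε N` and the vector `A + ε B` is divided by `ε²`
  set B := c₁ • N + c₂ • j N with hB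
  have hD : ContDiffOn ℝ ∞ (fderiv ℝ r) W := hr.fderiv_of_isOpen hW (by simp)
  have hD2 : ContDiffOn ℝ ∞ (fderiv ℝ (fderiv ℝ r)) W := hD.fderiv_of_isOpen hW (by simp)
  have hsym : ∀ x ∈ W, ∀ a b, fderiv ℝ (fderiv ℝ r) x a b = fderiv ℝ (fderiv ℝ r) x b a :=
    fun x hx a b => (isSymmSndFDerivAt_of_contDiffAt (hr.contDiffAt (hW.mem_nhds hx))).eq a b
  have hzε : Tendsto (fun ε : ℝ => z - ε • N) (𝓝[>] 0) (𝓝 z) := by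
    have : ContinuousAt (fun ε : ℝ => z - ε • N) 0 := by fun_prop
    have h2 := this.tendsto
    rw [zero_smul, sub_zero] at h2
    exact h2.mono_left nhdsWithin_le_nhds
  have hε : Tendsto (fun ε : ℝ => ε) (𝓝[>] 0) (𝓝 0) := tendsto_id.mono_left nhdsWithin_le_nhds
  have hc2 : ∀ a b, Tendsto (fun ε : ℝ => fderiv ℝ (fderiv ℝ r) (z - ε • N) a b) (𝓝[>] 0)
      (𝓝 (fderiv ℝ (fderiv ℝ r) z a b)) := fun a b =>
    Tendsto.comp (((hD2.clm_apply contDiffOn_const).clm_apply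
      contDiffOn_const).continuousOn.continuousAt (hW.mem_nhds hz)).tendsto hzε
  have hc1 : ∀ a, Tendsto (fun ε : ℝ => fderiv ℝ r (z - ε • N) a) (𝓝[>] 0)
      (𝓝 (fderiv ℝ r z a)) := fun a =>
    Tendsto.comp ((hD.clm_apply contDiffOn_const).continuousOn.continuousAt
      (hW.mem_nhds hz)).tendsto hzε
  have hDd : DifferentiableAt ℝ (fderiv ℝ r) z :=
    (hD.contDiffAt (hW.mem_nhds hz)).differentiableAt (by simp)
  -- the limits of `-r`, of the complex Hessian and of the derivatives of `r`, each divided by `ε`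
  have t1 : Tendsto (fun ε : ℝ => -r (z - ε • N) / ε) (𝓝[>] 0) (𝓝 1) := by
    have := (tendsto_div_of_differentiableAt (N := N)
      ((hr.contDiffAt (hW.mem_nhds hz)).differentiableAt (by simp)) h0).neg
    rw [hN, neg_neg] at this
    exact this.congr fun ε => by ring
  have t2 : Tendsto (fun ε : ℝ => cHess j r (z - ε • N) (A + ε • B) / ε) (𝓝[>] 0)
      (𝓝 (-fderiv ℝ (fun x => cHess j r x A) z N + (2 * (fderiv ℝ (fderiv ℝ r) z A B +
        fderiv ℝ (fderiv ℝ r) z (j A) (j B)) + 0 * (fderiv ℝ (fderiv ℝ r) z B B +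
        fderiv ℝ (fderiv ℝ r) z (j B) (j B))))) := by
    have hcd : DifferentiableAt ℝ (fun x => cHess j r x A) z :=
      ((((hD2.clm_apply contDiffOn_const).clm_apply contDiffOn_const).add
        ((hD2.clm_apply contDiffOn_const).clm_apply contDiffOn_const)).contDiffAt
        (hW.mem_nhds hz)).differentiableAt (by simp)
    have h1 := (tendsto_div_of_differentiableAt (N := N) hcd hL).add
      ((((hc2 A B).add (hc2 (j A) (j B))).const_mul 2).add
        (hε.mul ((hc2 B B).add (hc2 (j B) (j B)))))
    refine h1.congr' ?_
    filter_upwards [self_mem_nhdsWithin, hzε.eventually (hW.mem_nhds hz)] with ε hε hzε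
    have hε0 : ε ≠ 0 := (show (0 : ℝ) < ε from hε).ne'
    unfold cHess
    simp only [map_add, map_smul, add_apply, smul_apply, smul_eq_mul]
    rw [hsym _ hzε B A, hsym _ hzε (j B) (j A)]
    field_simp
    ring
  have t3 : ∀ {A : H}, fderiv ℝ r z A = 0 → ∀ B,
      Tendsto (fun ε : ℝ => fderiv ℝ r (z - ε • N) (A + ε • B) / ε) (𝓝[>] 0)
      (𝓝 (-fderiv ℝ (fderiv ℝ r) z N A + fderiv ℝ r z B)) := by
    intro A hA B
    have h1 := (tendsto_div_of_differentiableAt (g := fun x => fderiv ℝ r x A) (N := N)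
      (hDd.clm_apply (differentiableAt_const A)) hA).add (hc1 B)
    rw [fderiv_clm_apply_apply hDd (differentiableAt_const A)] at h1
    simp only [fderiv_fun_const, Pi.zero_apply, zero_apply, map_zero, add_zero] at h1
    refine h1.congr' ?_
    filter_upwards [self_mem_nhdsWithin] with ε hε
    have hε0 : ε ≠ 0 := (show (0 : ℝ) < ε from hε).ne'
    simp only [map_add, map_smul, smul_eq_mul]
    field_simp
  have hlim := (t1.mul t2).add (((t3 hA B).pow 2).add ((t3 hjA (j B)).pow 2) |>.const_mul τ)
  have hpos : ∀ᶠ ε : ℝ in 𝓝[>] 0, 0 ≤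
      -r (z - ε • N) / ε * (cHess j r (z - ε • N) (A + ε • B) / ε) +
      τ * ((fderiv ℝ r (z - ε • N) (A + ε • B) / ε) ^ 2 +
        (fderiv ℝ r (z - ε • N) (j A + ε • j B) / ε) ^ 2) := by
    filter_upwards [self_mem_nhdsWithin, hzε.eventually (hW.mem_nhds hz),
      t1.eventually (lt_mem_nhds one_pos)] with ε hε hzε hrε
    have hε0 : (0 : ℝ) < ε := hε
    have h1 : r (z - ε • N) < 0 := by
      rw [div_pos_iff_of_pos_right hε0] at hrε
      linarith
    have h2 := hpsh _ hzε h1 (A + ε • B)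
    rw [map_add j, map_smul j] at h2
    have h3 : -r (z - ε • N) / ε * (cHess j r (z - ε • N) (A + ε • B) / ε) +
      τ * ((fderiv ℝ r (z - ε • N) (A + ε • B) / ε) ^ 2 +
        (fderiv ℝ r (z - ε • N) (j A + ε • j B) / ε) ^ 2) =
      (-r (z - ε • N) * cHess j r (z - ε • N) (A + ε • B) +
      τ * ((fderiv ℝ r (z - ε • N) (A + ε • B)) ^ 2 +
        (fderiv ℝ r (z - ε • N) (j A + ε • j B)) ^ 2)) / ε ^ 2 := by
      field_simp
    rw [h3]
    positivity
  have := ge_of_tendsto hlim hpos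
  refine this.trans_eq ?_
  rw [hB]
  simp only [map_add, map_smul, hj, map_neg, smul_eq_mul, smul_neg, hN, hjN]
  ring

/-- The algebraic part of the argument: the boundary inequality, optimised over `c₁, c₂`, is the
inequality `DbarIneqAt`. -/
theorem sq_add_sq_le_of_boundary_inequality {av aY bv bY La τ : ℝ} (hτ : 0 < τ) (hτ1 : τ < 1)
    (h : ∀ c₁ c₂ : ℝ, 0 ≤ -La + 2 * (c₁ * (av - bY) - c₂ * (bv + aY)) +
      τ * ((c₁ - av) ^ 2 + (c₂ + aY) ^ 2)) :
    (av - bY) ^ 2 + (aY + bv) ^ 2 ≤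
      -(τ / (1 - τ)) * (La - (av ^ 2 + aY ^ 2) + (bv ^ 2 + bY ^ 2)) := by
  -- the minimum of the quadratic polynomial in `c₁, c₂`
  have h1 := h (av - (av - bY) / τ) (-aY + (aY + bv) / τ)
  have h2 : τ * ((av - (av - bY) / τ - av) ^ 2 + (-aY + (aY + bv) / τ + aY) ^ 2) =
      ((av - bY) ^ 2 + (aY + bv) ^ 2) / τ := by
    field_simp
    ring
  have h3 : 2 * ((av - (av - bY) / τ) * (av - bY) - (-aY + (aY + bv) / τ) * (bv + aY)) =
      2 * (av * (av - bY) + aY * (aY + bv)) - 2 * (((av - bY) ^ 2 + (aY + bv) ^ 2) / τ) := by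
    field_simp
    ring
  rw [h2, h3] at h1
  have h4 : ((av - bY) ^ 2 + (aY + bv) ^ 2) / τ ≤
      -La + 2 * (av * (av - bY) + aY * (aY + bv)) := by linarith
  rw [div_le_iff₀ hτ] at h4
  have h5 : 0 < 1 - τ := by linarith
  rw [neg_mul, div_mul_eq_mul_div, ← neg_div, le_div_iff₀ h5]
  nlinarith

/-- The operator `dbarOp` on a one-form which is, near `y`, the combination
`d log |h| - (d arg h) ∘ J` of the derivatives of a function `h = a + i b` with `h y = 1`. -/
theorem dbarOp_eq_of_log {J : E → E →L[ℝ] E} {β : E → E →L[ℝ] ℝ} {a b : E → ℝ} {y : E}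
    (hJ : DifferentiableAt ℝ J y) (hJJ : ∀ᶠ z in 𝓝 y, ∀ v, J z (J z v) = -v)
    (hβ : DifferentiableAt ℝ β y) (ha : ContDiffAt ℝ ∞ a y) (hb : ContDiffAt ℝ ∞ b y)
    (ha1 : a y = 1) (hb0 : b y = 0)
    (h : ∀ᶠ z in 𝓝 y, ∀ v, (a z ^ 2 + b z ^ 2) * β z v = a z * fderiv ℝ a z v +
      b z * fderiv ℝ b z v - a z * fderiv ℝ b z (J z v) + b z * fderiv ℝ a z (J z v)) (v : E) :
    dbarOp J β y v = dbarOp J (fderiv ℝ a) y v -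
      (fderiv ℝ a y v ^ 2 + fderiv ℝ a y (J y v) ^ 2) +
      (fderiv ℝ b y v ^ 2 + fderiv ℝ b y (J y v) ^ 2) := by
  have ha1' : DifferentiableAt ℝ a y := ha.differentiableAt (by simp)
  have hb1' : DifferentiableAt ℝ b y := hb.differentiableAt (by simp)
  have ha2 := differentiableAt_fderiv ha
  have hb2 := differentiableAt_fderiv hb
  have hY : DifferentiableAt ℝ (fun z => J z v) y := hJ.clm_apply (differentiableAt_const v)
  have hv := differentiableAt_const (𝕜 := ℝ) (x := y) v
  -- the derivative at `y` of the identity `h`, with `q` for the coefficient of `β`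
  have key : ∀ {q p₁ p₂ p₃ p₄ : E → ℝ}, DifferentiableAt ℝ q y → DifferentiableAt ℝ p₁ y →
      DifferentiableAt ℝ p₂ y → DifferentiableAt ℝ p₃ y → DifferentiableAt ℝ p₄ y →
      (∀ᶠ z in 𝓝 y, (a z ^ 2 + b z ^ 2) * q z =
        a z * p₁ z + b z * p₂ z - a z * p₃ z + b z * p₄ z) →
      ∀ u, 2 * fderiv ℝ a y u * q y + fderiv ℝ q y u = fderiv ℝ a y u * p₁ y + fderiv ℝ p₁ y u +
        fderiv ℝ b y u * p₂ y - fderiv ℝ a y u * p₃ y - fderiv ℝ p₃ y u +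
        fderiv ℝ b y u * p₄ y := by
    intro q p₁ p₂ p₃ p₄ hq h1 h2 h3 h4 he u
    have e1 := ((ha1'.hasFDerivAt.pow 2).add (hb1'.hasFDerivAt.pow 2)).mul hq.hasFDerivAt
    have e2 := (((ha1'.hasFDerivAt.mul h1.hasFDerivAt).add
      (hb1'.hasFDerivAt.mul h2.hasFDerivAt)).sub
      (ha1'.hasFDerivAt.mul h3.hasFDerivAt)).add (hb1'.hasFDerivAt.mul h4.hasFDerivAt)
    have e3 := e1.unique (e2.congr_of_eventuallyEq he)
    have e4 := congrArg (fun L : E →L[ℝ] ℝ => L u) e3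
    simp only [add_apply, sub_apply, smul_apply, smul_eq_mul, ha1, hb0] at e4
    simp [ha1, hb0] at e4
    linarith
  have k1 := key (q := fun z => β z v) (p₁ := fun z => fderiv ℝ a z v)
    (p₂ := fun z => fderiv ℝ b z v) (p₃ := fun z => fderiv ℝ b z (J z v))
    (p₄ := fun z => fderiv ℝ a z (J z v)) (hβ.clm_apply hv) (ha2.clm_apply hv) (hb2.clm_apply hv)
    (hb2.clm_apply hY) (ha2.clm_apply hY) (h.mono fun z hz => hz v) v
  have k2 := key (q := fun z => β z (J z v)) (p₁ := fun z => fderiv ℝ a z (J z v))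
    (p₂ := fun z => fderiv ℝ b z (J z v)) (p₃ := fun z => -fderiv ℝ b z v)
    (p₄ := fun z => -fderiv ℝ a z v) (hβ.clm_apply hY) (ha2.clm_apply hY) (hb2.clm_apply hY)
    (hb2.clm_apply hv).neg (ha2.clm_apply hv).neg (by
      filter_upwards [h, hJJ] with z hz hz'
      rw [hz, hz', map_neg, map_neg]) (J y v)
  have h1 := h.self_of_nhds
  simp only [ha1, hb0] at h1
  have hv1 := h1 v
  have hv2 := h1 (J y v)
  have hv3 := h1 (J y (fderiv ℝ (fun z => J z v) y v))
  rw [hJJ.self_of_nhds, map_neg] at hv2 hv3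
  have hs := (isSymmSndFDerivAt_of_contDiffAt hb).eq (J y v) v
  unfold dbarOp
  rw [fderiv_fun_neg] at k2
  rw [fderiv_clm_apply_apply hb2 hY] at k1
  rw [neg_apply, fderiv_clm_apply_apply hb2 hv, hs] at k2
  simp only [fderiv_fun_const, Pi.zero_apply, zero_apply, map_zero, add_zero] at k1 k2
  ring_nf at hv1 hv2 hv3
  rw [hv1] at k1
  rw [hv2] at k2
  rw [hv3]
  linarith

end BoundaryLimit

/-! ### The inequality on a complex submanifold of a real hypersurface -/

section BoundaryDbar

variable {E H : Type*} [NormedAddCommGroup E] [NormedSpace ℝ E]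
  [NormedAddCommGroup H] [NormedSpace ℝ H]

/-- A nonzero covector `L` is the real part of a complex linear form, which takes the value one
somewhere. -/
theorem exists_apply_eq_one_and_apply_j_eq_zero {j : H →L[ℝ] H} (hj : ∀ v, j (j v) = -v)
    {L : H →L[ℝ] ℝ} (hL : L ≠ 0) : ∃ N, L N = 1 ∧ L (j N) = 0 := by
  obtain ⟨w, hw⟩ : ∃ w, L w ≠ 0 := by
    by_contra! h
    exact hL (ContinuousLinearMap.ext h)
  have h0 : 0 < L w ^ 2 + L (j w) ^ 2 := by positivity
  refine ⟨(L w ^ 2 + L (j w) ^ 2)⁻¹ • (L w • w + L (j w) • j w), ?_, ?_⟩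
  · simp only [map_add, map_smul, smul_eq_mul]
    field_simp
  · simp only [map_add, map_smul, smul_eq_mul, hj, map_neg]
    ring

/-- Let `F` be a `J`-holomorphic immersion into the boundary `r = 0`, and `β` the restriction of the
D'Angelo form defined by `r`: the contraction of `d (dr ∘ j)` with a transverse vector `T` in the
kernel of `dr`, divided by `dr (j T)`. If `-(-r)^(1 - τ)` is plurisubharmonic on `r < 0`, then `β`
satisfies the inequality with constant `τ / (1 - τ)`. -/
theorem dbarIneqAt_of_psh {j : H →L[ℝ] H} (hj : ∀ v, j (j v) = -v) {r : H → ℝ} {W : Set H}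
    (hW : IsOpen W) (hr : ContDiffOn ℝ ∞ r W) {J : E → E →L[ℝ] E} {F : E → H} {O : Set E}
    (hO : IsOpen O) (hJ : ContDiffOn ℝ ∞ J O) (hF : ContDiffOn ℝ ∞ F O) (hFW : MapsTo F O W)
    (hFJ : ∀ z ∈ O, ∀ v, fderiv ℝ F z (J z v) = j (fderiv ℝ F z v))
    (hFi : ∀ z ∈ O, Function.Injective (fderiv ℝ F z)) (hrF : ∀ z ∈ O, r (F z) = 0)
    {β : E → E →L[ℝ] ℝ} (hβ : ContDiffOn ℝ ∞ β O)
    (hβr : ∀ z ∈ O, ∀ v T, fderiv ℝ r (F z) T = 0 → fderiv ℝ r (F z) (j T) ≠ 0 →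
      fderiv ℝ r (F z) (j T) * β z v = fderiv ℝ (fderiv ℝ r) (F z) (fderiv ℝ F z v) (j T) -
        fderiv ℝ (fderiv ℝ r) (F z) T (j (fderiv ℝ F z v)))
    {τ : ℝ} (hτ : 0 < τ) (hτ1 : τ < 1)
    (hpsh : ∀ x ∈ W, r x < 0 → ∀ v, 0 ≤ -r x * cHess j r x v +
      τ * (fderiv ℝ r x v ^ 2 + fderiv ℝ r x (j v) ^ 2))
    {y : E} (hy : y ∈ O) (hdr : fderiv ℝ r (F y) ≠ 0) : DbarIneqAt J β (τ / (1 - τ)) y := by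
  obtain ⟨N, hN, hjN⟩ := exists_apply_eq_one_and_apply_j_eq_zero hj hdr
  have hOy := hO.mem_nhds hy
  have hra : ∀ x ∈ W, ContDiffAt ℝ ∞ r x := fun x hx => hr.contDiffAt (hW.mem_nhds hx)
  have hFa : ∀ z ∈ O, ContDiffAt ℝ ∞ F z := fun z hz => hF.contDiffAt (hO.mem_nhds hz)
  have hsym : ∀ x ∈ W, ∀ a b, fderiv ℝ (fderiv ℝ r) x a b = fderiv ℝ (fderiv ℝ r) x b a :=
    fun x hx a b => (isSymmSndFDerivAt_of_contDiffAt (hra x hx)).eq a b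
  have hJJ : ∀ z ∈ O, ∀ v, J z (J z v) = -v := fun z hz v =>
    hFi z hz (by rw [hFJ z hz, hFJ z hz, hj, map_neg])
  have hDr : ContDiffOn ℝ ∞ (fderiv ℝ r) W := hr.fderiv_of_isOpen hW (by simp)
  have hrw : ∀ w, ContDiffOn ℝ ∞ (fun x => fderiv ℝ r x w) W := fun w =>
    hDr.clm_apply contDiffOn_const
  have hcomp : ∀ w, ContDiffOn ℝ ∞ (fun z => fderiv ℝ r (F z) w) O := fun w =>
    (hrw w).comp hF hFW
  have hd : ∀ w, ∀ z ∈ O, ∀ v, fderiv ℝ (fun z => fderiv ℝ r (F z) w) z v =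
      fderiv ℝ (fderiv ℝ r) (F z) (fderiv ℝ F z v) w := by
    intro w z hz v
    have h1 := fderiv_comp (g := fun x => fderiv ℝ r x w) z
      (((hrw w).contDiffAt (hW.mem_nhds (hFW hz))).differentiableAt (by simp))
      ((hFa z hz).differentiableAt (by simp))
    have h2 := congrArg (fun L : E →L[ℝ] ℝ => L v) h1
    refine h2.trans ?_
    rw [ContinuousLinearMap.comp_apply,
      fderiv_clm_apply_apply (differentiableAt_fderiv (hra _ (hFW hz))) (differentiableAt_const w)]
    simp
  have htan : ∀ z ∈ O, ∀ v, fderiv ℝ r (F z) (fderiv ℝ F z v) = 0 := by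
    intro z hz v
    have h1 : (r ∘ F) =ᶠ[𝓝 z] fun _ => 0 := by
      filter_upwards [hO.mem_nhds hz] with x hx using hrF x hx
    have h2 := Filter.EventuallyEq.fderiv_eq (𝕜 := ℝ) h1
    rw [fderiv_comp z ((hra _ (hFW hz)).differentiableAt (by simp))
      ((hFa z hz).differentiableAt (by simp))] at h2
    have h3 := congrArg (fun L : E →L[ℝ] ℝ => L v) h2
    simpa using h3
  -- `a + i b` is the derivative of `r` along the complex vector `N - i j N`
  set a : E → ℝ := fun z => fderiv ℝ r (F z) N with ha
  set b : E → ℝ := fun z => -fderiv ℝ r (F z) (j N) with hb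
  have haO : ContDiffOn ℝ ∞ a O := hcomp N
  have hbO : ContDiffOn ℝ ∞ b O := (hcomp (j N)).neg
  have hda : ∀ z ∈ O, ∀ v, fderiv ℝ a z v = fderiv ℝ (fderiv ℝ r) (F z) (fderiv ℝ F z v) N := hd N
  have hdb : ∀ z ∈ O, ∀ v, fderiv ℝ b z v =
      -fderiv ℝ (fderiv ℝ r) (F z) (fderiv ℝ F z v) (j N) := by
    intro z hz v
    rw [hb, fderiv_fun_neg, neg_apply, hd (j N) z hz]
  have hlog : ∀ᶠ z in 𝓝 y, ∀ v, (a z ^ 2 + b z ^ 2) * β z v = a z * fderiv ℝ a z v +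
      b z * fderiv ℝ b z v - a z * fderiv ℝ b z (J z v) + b z * fderiv ℝ a z (J z v) := by
    have hne : ∀ᶠ z in 𝓝 y, a z ^ 2 + b z ^ 2 ≠ 0 := by
      have hc : ContinuousAt (fun z => a z ^ 2 + b z ^ 2) y :=
        ((haO.continuousOn.continuousAt hOy).pow 2).add ((hbO.continuousOn.continuousAt hOy).pow 2)
      refine hc.eventually_ne ?_
      simp [ha, hb, hN, hjN]
    filter_upwards [hOy, hne] with z hz hz0 v
    -- a multiple of the tangential vector whose image under `j` is transversal
    have hT := hβr z hz v (-(a z) • j N - b z • N)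
      (by simp only [map_sub, map_smul, smul_eq_mul, ha, hb]; ring)
    have h1 : fderiv ℝ r (F z) (j (-(a z) • j N - b z • N)) = a z ^ 2 + b z ^ 2 := by
      simp only [map_sub, map_smul, smul_eq_mul, ha, hb, hj, map_neg]; ring
    rw [h1] at hT
    rw [hT hz0, hda z hz, hda z hz, hdb z hz, hdb z hz, hFJ z hz]
    simp only [map_sub, map_smul, smul_eq_mul, hj, map_neg, sub_apply, smul_apply, neg_smul,
      neg_apply, smul_neg]
    rw [hsym _ (hFW hz) (j N), hsym _ (hFW hz) N]
    ring
  have hJy : DifferentiableAt ℝ J y := (hJ.contDiffAt hOy).differentiableAt (by simp)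
  have hJJy : ∀ᶠ z in 𝓝 y, ∀ v, J z (J z v) = -v := by
    filter_upwards [hOy] with z hz using hJJ z hz
  have hFJy : ∀ᶠ z in 𝓝 y, ∀ v, fderiv ℝ F z (J z v) = j (fderiv ℝ F z v) := by
    filter_upwards [hOy] with z hz using hFJ z hz
  have ha1 : a y = 1 := hN
  have hb0 : b y = 0 := by simp [hb, hjN]
  intro v
  -- the Levi form of the boundary vanishes along `F`, as `r ∘ F` is constant
  have hL0 : cHess j r (F y) (fderiv ℝ F y v) = 0 := by
    rw [← dbarOp_fderiv_comp hj hJy (hFa y hy) (hra _ (hFW hy)) hFJy v]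
    have h1 : fderiv ℝ (r ∘ F) =ᶠ[𝓝 y] fun _ => 0 := by
      have h2 : (r ∘ F) =ᶠ[𝓝 y] fun _ => 0 := by
        filter_upwards [hOy] with x hx using hrF x hx
      refine (Filter.EventuallyEq.fderiv (𝕜 := ℝ) h2).trans (.of_eq ?_)
      ext z
      simp
    have h3 : (fun z => fderiv ℝ (r ∘ F) z v) =ᶠ[𝓝 y] fun _ => 0 :=
      h1.mono fun z hz => by simp only [hz]; rfl
    have h4 : (fun z => fderiv ℝ (r ∘ F) z (J z v)) =ᶠ[𝓝 y] fun _ => 0 :=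
      h1.mono fun z hz => by simp only [hz]; rfl
    unfold dbarOp
    rw [h3.fderiv_eq, h4.fderiv_eq, h1.self_of_nhds]
    simp
  have hbd := boundary_inequality hj hW hr (hFW hy) (hrF y hy) hN hjN (htan y hy v)
    (by rw [← hFJ y hy]; exact htan y hy _) hL0 hpsh
  have hLa : dbarOp J (fderiv ℝ a) y v =
      fderiv ℝ (fun x => cHess j r x (fderiv ℝ F y v)) (F y) N := by
    rw [fderiv_cHess hW hr (hFW hy),
      ← dbarOp_fderiv_comp hj hJy (hFa y hy) ((hrw N).contDiffAt (hW.mem_nhds (hFW hy))) hFJy v]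
    rfl
  have hβy := hlog.self_of_nhds
  simp only [ha1, hb0] at hβy
  have hβ1 : β y v = fderiv ℝ a y v - fderiv ℝ b y (J y v) := by have := hβy v; linarith
  have hβ2 : β y (J y v) = fderiv ℝ a y (J y v) + fderiv ℝ b y v := by
    have := hβy (J y v)
    rw [hJJ y hy, map_neg, map_neg] at this
    linarith
  have hfin := sq_add_sq_le_of_boundary_inequality (av := fderiv ℝ a y v)
    (aY := fderiv ℝ a y (J y v)) (bv := fderiv ℝ b y v) (bY := fderiv ℝ b y (J y v))
    (La := dbarOp J (fderiv ℝ a) y v) hτ hτ1 (by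
      intro c₁ c₂
      have h1 := hbd c₁ c₂
      rw [← hLa, hsym _ (hFW hy) N, hsym _ (hFW hy) N, ← hFJ y hy, ← hda y hy, ← hda y hy] at h1
      have h2 := hdb y hy v
      have h3 := hdb y hy (J y v)
      rw [show fderiv ℝ (fderiv ℝ r) (F y) (fderiv ℝ F y (J y v)) (j N) =
        -fderiv ℝ b y (J y v) by linarith, show fderiv ℝ (fderiv ℝ r) (F y) (fderiv ℝ F y v) (j N) =
        -fderiv ℝ b y v by linarith] at h1
      refine h1.trans_eq ?_
      ring)
  rw [← hβ1, ← hβ2, ← dbarOp_eq_of_log hJy hJJy ((hβ.contDiffAt hOy).differentiableAt (by simp))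
    (haO.contDiffAt hOy) (hbO.contDiffAt hOy) ha1 hb0 hlog v] at hfin
  exact hfin

/-- Plurisubharmonicity of `-(-r)^δ` in terms of `r`: the complex Hessian is
`δ (-r)^(δ - 2)` times the expression below. -/
theorem cHess_add_nonneg_of_cHess_rpow {j : H →L[ℝ] H} {r : H → ℝ} {x : H}
    (hr : ContDiffAt ℝ ∞ r x) (hx : r x < 0) {δ : ℝ} (hδ : 0 < δ) {v : H}
    (h : 0 ≤ cHess j (fun z => -((-r z) ^ δ)) x v) :
    0 ≤ -r x * cHess j r x v + (1 - δ) * (fderiv ℝ r x v ^ 2 + fderiv ℝ r x (j v) ^ 2) := by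
  have hr2 := differentiableAt_fderiv hr
  have hrx : DifferentiableAt ℝ r x := hr.differentiableAt (by simp)
  have hd : fderiv ℝ (fun z => -((-r z) ^ δ)) =ᶠ[𝓝 x]
      fun z => (δ * (-r z) ^ (δ - 1)) • fderiv ℝ r z := by
    filter_upwards [eventually_differentiableAt hr, hr.continuousAt.eventually (gt_mem_nhds hx)]
      with z hz hz0
    have h1 : HasFDerivAt (fun z => (-r z) ^ δ) _ z :=
      (hz.hasFDerivAt.neg).rpow_const (p := δ) (Or.inl (by simpa using hz0.ne))
    have h2 := h1.neg.fderiv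
    refine h2.trans ?_
    simp
  have hp : HasFDerivAt (fun z => δ * (-r z) ^ (δ - 1)) _ x :=
    ((hrx.hasFDerivAt.neg).rpow_const (p := δ - 1) (Or.inl (by simpa using hx.ne))).const_mul δ
  have h2 : ∀ a, fderiv ℝ (fderiv ℝ (fun z => -((-r z) ^ δ))) x a a =
      δ * (-r x) ^ (δ - 1 - 1) * (-r x * fderiv ℝ (fderiv ℝ r) x a a +
        (1 - δ) * fderiv ℝ r x a ^ 2) := by
    intro a
    have h1 : HasFDerivAt (fun z => (δ * (-r z) ^ (δ - 1)) • fderiv ℝ r z) _ x :=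
      hp.smul hr2.hasFDerivAt
    rw [hd.fderiv_eq, h1.fderiv]
    have h3 : (-r x) ^ (δ - 1) = (-r x) ^ (δ - 1 - 1) * -r x := by
      rw [← Real.rpow_add_one (by linarith)]
      ring_nf
    simp only [add_apply, smul_apply, ContinuousLinearMap.smulRight_apply, smul_eq_mul, neg_apply,
      Pi.neg_apply]
    rw [h3]
    ring
  unfold cHess at h
  rw [h2, h2, ← mul_add] at h
  have h4 : 0 < δ * (-r x) ^ (δ - 1 - 1) := mul_pos hδ (Real.rpow_pos_of_pos (by linarith) _)
  have h5 := nonneg_of_mul_nonneg_right h h4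
  refine h5.trans_eq ?_
  unfold cHess
  ring

end BoundaryDbar

/-! ### CR manifolds realised as real hypersurfaces -/

section Hypersurface

/-- The complex structure of `ℂ^N`, multiplication by `i`, as a real linear map. -/
def mulI (N : ℕ) : EuclideanSpace ℂ (Fin N) →L[ℝ] EuclideanSpace ℂ (Fin N) :=
  (Complex.I • ContinuousLinearMap.id ℂ (EuclideanSpace ℂ (Fin N))).restrictScalars ℝ

theorem mulI_apply {N : ℕ} (v : EuclideanSpace ℂ (Fin N)) : mulI N v = Complex.I • v := rfl

theorem mulI_mulI {N : ℕ} (v : EuclideanSpace ℂ (Fin N)) : mulI N (mulI N v) = -v := by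
  rw [mulI_apply, mulI_apply, smul_smul, Complex.I_mul_I, neg_one_smul]

/-- The exterior derivative of a one-form which is, near `p`, the pull-back of a one-form `ξ` on a
vector space. -/
theorem OneForm.extDeriv_eq_of_eventually_eq {d : ℕ} {M : Type*} [TopologicalSpace M]
    [ChartedSpace (EuclideanSpace ℝ (Fin d)) M] [IsManifold (𝓡 d) ∞ M] {F : Type*}
    [NormedAddCommGroup F] [NormedSpace ℝ F] {η : OneForm d M} {Ψ : M → F} {ξ : F → F →L[ℝ] ℝ}
    {U : Set M} (hU : IsOpen U) (hΨ : ∀ q ∈ U, ContMDiffAt (𝓡 d) 𝓘(ℝ, F) ∞ Ψ q) {p : M} (hp : p ∈ U)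
    (hξ : DifferentiableAt ℝ ξ (Ψ p))
    (h : ∀ q ∈ U, ∀ v, η q v = ξ (Ψ q) (mvfderiv (𝓡 d) Ψ q v)) (v w : TangentSpace (𝓡 d) p) :
    η.extDeriv p v w = fderiv ℝ ξ (Ψ p) (mvfderiv (𝓡 d) Ψ p v) (mvfderiv (𝓡 d) Ψ p w) -
      fderiv ℝ ξ (Ψ p) (mvfderiv (𝓡 d) Ψ p w) (mvfderiv (𝓡 d) Ψ p v) := by
  set φ := extChartAt (𝓡 d) p with hφ
  have hpφ : p ∈ φ.source := mem_extChartAt_source p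
  set G := Ψ ∘ φ.symm with hG
  have hGs : ContDiffAt ℝ ∞ G (φ p) := contDiffAt_comp_extChartAt_symm hpφ (hΨ p hp)
  have hG0 : G (φ p) = Ψ p := by simp [hG, hφ]
  have hG1 : DifferentiableAt ℝ G (φ p) := hGs.differentiableAt (by simp)
  have h1 : η.inChart p =ᶠ[𝓝 (φ p)] fun y => ((ξ ∘ G) y).comp (fderiv ℝ G y) := by
    have hc : ∀ᶠ y in 𝓝 (φ p), φ.symm y ∈ U :=
      (continuousAt_extChartAt_symm p).eventually (hU.mem_nhds (by simpa [hφ] using hp))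
    filter_upwards [(isOpen_extChartAt_target p).mem_nhds (mem_extChartAt_target p), hc]
      with y hy hyU
    have hq := φ.map_target hy
    ext a
    obtain ⟨b, hb⟩ := (isInvertible_mvfderiv_extChartAt hq).bijective.2 a
    have hb' : mvfderiv (𝓡 d) φ (φ.symm y) b = a := hb
    have h2 := η.inChart_mvfderiv hq b
    have h3 := mvfderiv_eq_fderiv_chart hq ((hΨ _ hyU).mdifferentiableAt (by simp)) b
    rw [← hφ] at h2 h3
    rw [φ.right_inv hy] at h2 h3
    rw [hb'] at h2 h3
    rw [h2, h _ hyU, h3]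
    rfl
  have h2 : DifferentiableAt ℝ (ξ ∘ G) (φ p) :=
    DifferentiableAt.comp (φ p) (by rwa [hG0]) hG1
  have h4 : ∀ v, fderiv ℝ G (φ p) (mvfderiv (𝓡 d) φ p v) = mvfderiv (𝓡 d) Ψ p v := fun v =>
    (mvfderiv_eq_fderiv_chart hpφ ((hΨ p hp).mdifferentiableAt (by simp)) v).symm
  unfold OneForm.extDeriv
  rw [← hφ, h1.fderiv_eq, fderiv_clm_comp h2 (differentiableAt_fderiv hGs),
    fderiv_comp (φ p) (by rwa [hG0]) hG1, hG0]
  simp only [add_apply, ContinuousLinearMap.comp_apply, ContinuousLinearMap.compL_apply,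
    ContinuousLinearMap.flip_apply, h4]
  rw [(isSymmSndFDerivAt_of_contDiffAt hGs).eq (mvfderiv (𝓡 d) φ p v)]
  ring

/-- A hyperplane is the image of any injective linear map into it of the right rank. -/
theorem exists_apply_eq_of_apply_eq_zero {E H : Type*} [AddCommGroup E] [Module ℝ E]
    [TopologicalSpace E] [AddCommGroup H] [Module ℝ H] [TopologicalSpace H]
    [FiniteDimensional ℝ H] {A : E →L[ℝ] H} {L : H →L[ℝ] ℝ}
    (hd : Module.finrank ℝ E + 1 = Module.finrank ℝ H) (hA : Function.Injective A) (hL : L ≠ 0)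
    (hLA : ∀ v, L (A v) = 0) {w : H} (hw : L w = 0) : ∃ v, A v = w := by
  have hAL : LinearMap.range (A : E →ₗ[ℝ] H) ≤ LinearMap.ker (L : H →ₗ[ℝ] ℝ) := by
    rintro _ ⟨v, rfl⟩
    exact hLA v
  have hLt : LinearMap.range (L : H →ₗ[ℝ] ℝ) = ⊤ :=
    LinearMap.range_eq_top.2 (LinearMap.surjective fun h0 =>
      hL (ContinuousLinearMap.coe_injective h0))
  have h1 := LinearMap.finrank_range_add_finrank_ker (L : H →ₗ[ℝ] ℝ)
  have h2 : Module.finrank ℝ (LinearMap.range (A : E →ₗ[ℝ] H)) = Module.finrank ℝ E :=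
    LinearMap.finrank_range_of_inj hA
  rw [hLt, finrank_top, Module.finrank_self] at h1
  have h3 := Submodule.eq_of_le_of_finrank_eq hAL (by omega)
  have h4 : w ∈ LinearMap.range (A : E →ₗ[ℝ] H) := by
    rw [h3]; exact hw
  exact h4

variable {n : ℕ} {M : Type*} [TopologicalSpace M]
  [ChartedSpace (EuclideanSpace ℝ (Fin (2 * n + 1))) M] [IsManifold (𝓡 (2 * n + 1)) ∞ M]

local notation "ℍ" => EuclideanSpace ℂ (Fin (n + 1))

/-- A realisation of an open subset `U` of the CR manifold `M` as a piece of the real hypersurface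
`r = 0` in an open subset `W` of `ℂ^(n+1)`, such that `θ = Ψ^* (dr ∘ i)` and `-(-r)^(1 - τ)` is
plurisubharmonic on `r < 0`. -/
structure HypersurfaceChart (S : CRStructure n M) (θ : OneForm (2 * n + 1) M) (τ : ℝ) (U : Set M)
    (Ψ : M → ℍ) (W : Set ℍ) (r : ℍ → ℝ) : Prop where
  isOpen_source : IsOpen U
  isOpen_target : IsOpen W
  contMDiffAt : ∀ q ∈ U, ContMDiffAt (𝓡 (2 * n + 1)) 𝓘(ℝ, ℍ) ∞ Ψ q
  mapsTo : MapsTo Ψ U W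
  contDiffOn : ContDiffOn ℝ ∞ r W
  eq_zero : ∀ q ∈ U, r (Ψ q) = 0
  fderiv_ne_zero : ∀ q ∈ U, fderiv ℝ r (Ψ q) ≠ 0
  injective : ∀ q ∈ U, Function.Injective (mvfderiv (𝓡 (2 * n + 1)) Ψ q)
  mem_T10_iff : ∀ q ∈ U, ∀ z, z ∈ S.T10 q ↔ mvfderiv (𝓡 (2 * n + 1)) Ψ q z.im =
    -mulI (n + 1) (mvfderiv (𝓡 (2 * n + 1)) Ψ q z.re)
  apply_eq : ∀ q ∈ U, ∀ v, θ q v =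
    fderiv ℝ r (Ψ q) (mulI (n + 1) (mvfderiv (𝓡 (2 * n + 1)) Ψ q v))
  psh : ∀ x ∈ W, r x < 0 → ∀ v, 0 ≤ -r x * cHess (mulI (n + 1)) r x v +
    τ * (fderiv ℝ r x v ^ 2 + fderiv ℝ r x (mulI (n + 1) v) ^ 2)

namespace HypersurfaceChart

variable {S : CRStructure n M} {θ : OneForm (2 * n + 1) M} {τ : ℝ} {U : Set M}
  {Ψ : M → EuclideanSpace ℂ (Fin (n + 1))} {W : Set (EuclideanSpace ℂ (Fin (n + 1)))}
  {r : EuclideanSpace ℂ (Fin (n + 1)) → ℝ}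

theorem contDiffAt (h : HypersurfaceChart S θ τ U Ψ W r) {q : M} (hq : q ∈ U) :
    ContDiffAt ℝ ∞ r (Ψ q) := h.contDiffOn.contDiffAt (h.isOpen_target.mem_nhds (h.mapsTo hq))

theorem fderiv_mvfderiv (h : HypersurfaceChart S θ τ U Ψ W r) {q : M} (hq : q ∈ U)
    (v : TangentSpace (𝓡 (2 * n + 1)) q) :
    fderiv ℝ r (Ψ q) (mvfderiv (𝓡 (2 * n + 1)) Ψ q v) = 0 := by
  have hqφ := mem_extChartAt_source (I := 𝓡 (2 * n + 1)) q
  have hΨ := contDiffAt_comp_extChartAt_symm hqφ (h.contMDiffAt q hq)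
  have hq0 : (extChartAt (𝓡 (2 * n + 1)) q).symm (extChartAt (𝓡 (2 * n + 1)) q q) = q := by simp
  rw [mvfderiv_eq_fderiv_chart hqφ ((h.contMDiffAt q hq).mdifferentiableAt (by simp))]
  set G := Ψ ∘ (extChartAt (𝓡 (2 * n + 1)) q).symm with hG
  have hG0 : G (extChartAt (𝓡 (2 * n + 1)) q q) = Ψ q := by simp [hG]
  have h1 : r ∘ G =ᶠ[𝓝 (extChartAt (𝓡 (2 * n + 1)) q q)] fun _ => 0 := by
    filter_upwards [(continuousAt_extChartAt_symm q).eventually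
      (h.isOpen_source.mem_nhds (by simpa using hq))] with y hy
    exact h.eq_zero _ hy
  have h2 := Filter.EventuallyEq.fderiv_eq (𝕜 := ℝ) h1
  rw [fderiv_comp _ (by rw [hG0]; exact (h.contDiffAt hq).differentiableAt (by simp))
    (hΨ.differentiableAt (by simp)), hG0] at h2
  have h3 := congrArg (fun L : EuclideanSpace ℝ (Fin (2 * n + 1)) →L[ℝ] ℝ =>
    L (mvfderiv (𝓡 (2 * n + 1)) (extChartAt (𝓡 (2 * n + 1)) q) q v)) h2
  simpa using h3

/-- The image of the tangent space of `M` is the kernel of `dr`, by equality of dimensions. -/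
theorem exists_mvfderiv_eq (h : HypersurfaceChart S θ τ U Ψ W r) {q : M} (hq : q ∈ U) {w : ℍ}
    (hw : fderiv ℝ r (Ψ q) w = 0) : ∃ v, mvfderiv (𝓡 (2 * n + 1)) Ψ q v = w := by
  refine exists_apply_eq_of_apply_eq_zero (A := (mvfderiv (𝓡 (2 * n + 1)) Ψ q :)) ?_
    (h.injective q hq) (h.fderiv_ne_zero q hq) (h.fderiv_mvfderiv hq) hw
  change Module.finrank ℝ (EuclideanSpace ℝ (Fin (2 * n + 1))) + 1 = _
  rw [finrank_real_of_complex, finrank_euclideanSpace_fin, finrank_euclideanSpace_fin]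
  ring

/-- The restriction of `dr ∘ i` to a real hypersurface `r = 0` annihilates `T^{1,0}M`, because `dr`
vanishes on tangent vectors, and it is nowhere zero. -/
theorem isPseudoHermitian (h : ∀ p : M, ∃ U Ψ W r, p ∈ U ∧ HypersurfaceChart S θ τ U Ψ W r) :
    S.IsPseudoHermitian θ where
  smooth X hX p := by
    obtain ⟨U, Ψ, W, r, hp, h⟩ := h p
    have h1 : ContMDiffAt (𝓡 (2 * n + 1)) 𝓘(ℝ, ℍ →L[ℝ] ℝ) ∞
        (fun q => (fderiv ℝ r (Ψ q)).comp (mulI (n + 1))) p := by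
      have h2 : ContDiffAt ℝ ∞ (fun z => (fderiv ℝ r z).comp (mulI (n + 1))) (Ψ p) :=
        ((h.contDiffAt hp).fderiv_right (m := ∞) (by simp)).clm_comp contDiffAt_const
      exact h2.contMDiffAt.comp p (h.contMDiffAt p hp)
    refine (h1.clm_apply ((hX.smoothAt p).contMDiffAt_mvfderiv
      (h.contMDiffAt p hp))).congr_of_eventuallyEq ?_
    filter_upwards [h.isOpen_source.mem_nhds hp] with q hq
    exact h.apply_eq q hq _
  ne_zero p h0 := by
    obtain ⟨U, Ψ, W, r, hp, h⟩ := h p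
    obtain ⟨N, hN, hjN⟩ := exists_apply_eq_one_and_apply_j_eq_zero (j := mulI (n + 1)) mulI_mulI
      (h.fderiv_ne_zero p hp)
    obtain ⟨v, hv⟩ := h.exists_mvfderiv_eq hp hjN
    have h1 := h.apply_eq p hp v
    rw [hv, mulI_mulI, map_neg, hN, h0] at h1
    simp at h1
  vanishes p z hz := by
    obtain ⟨U, Ψ, W, r, hp, h⟩ := h p
    have h1 := (h.mem_T10_iff p hp z).1 hz
    have h2 := h.fderiv_mvfderiv hp z.im
    have h3 : fderiv ℝ r (Ψ p) (mulI (n + 1) (mvfderiv (𝓡 (2 * n + 1)) Ψ p z.im)) = 0 := by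
      rw [h1, map_neg, mulI_mulI, neg_neg, h.fderiv_mvfderiv hp]
    rw [h1, map_neg, neg_eq_zero] at h2
    rw [cext, h.apply_eq p hp, h.apply_eq p hp, h2, h3]
    simp

/-- The exterior derivative of `dr ∘ i` is given by the second derivative of `r`. -/
theorem extDeriv_eq (h : HypersurfaceChart S θ τ U Ψ W r) {p : M} (hp : p ∈ U)
    (v w : TangentSpace (𝓡 (2 * n + 1)) p) :
    θ.extDeriv p v w =
      fderiv ℝ (fderiv ℝ r) (Ψ p) (mvfderiv (𝓡 (2 * n + 1)) Ψ p v)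
        (mulI (n + 1) (mvfderiv (𝓡 (2 * n + 1)) Ψ p w)) -
      fderiv ℝ (fderiv ℝ r) (Ψ p) (mvfderiv (𝓡 (2 * n + 1)) Ψ p w)
        (mulI (n + 1) (mvfderiv (𝓡 (2 * n + 1)) Ψ p v)) := by
  have hr2 := differentiableAt_fderiv (h.contDiffAt hp)
  have h1 : ∀ a b, fderiv ℝ (fun z => (fderiv ℝ r z).comp (mulI (n + 1))) (Ψ p) a b =
      fderiv ℝ (fderiv ℝ r) (Ψ p) a (mulI (n + 1) b) := by
    intro a b
    rw [fderiv_clm_comp hr2 (differentiableAt_const _)]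
    simp
  rw [OneForm.extDeriv_eq_of_eventually_eq (ξ := fun z => (fderiv ℝ r z).comp (mulI (n + 1)))
    h.isOpen_source h.contMDiffAt hp (hr2.clm_comp (differentiableAt_const _))
    h.apply_eq, h1, h1]

variable {m : ℕ} {V : Type*} [TopologicalSpace V] [ChartedSpace (EuclideanSpace ℝ (Fin m)) V]
  [IsManifold (𝓡 m) ∞ V] {ι : V → M}

local notation "𝔼" => EuclideanSpace ℝ (Fin m)

/-- The inequality satisfied, on a complex submanifold, by the D'Angelo form defined by `r`. -/
theorem dbarIneqAt (h : HypersurfaceChart S θ τ U Ψ W r) (hτ : 0 < τ) (hτ1 : τ < 1)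
    (hV : S.IsComplexSubmanifold m ι) {x₀ : V} {O : Set 𝔼}
    (hO : O ⊆ (extChartAt (𝓡 m) x₀).target) (hOo : IsOpen O) {J : 𝔼 → 𝔼 →L[ℝ] 𝔼}
    (hJ : ContDiffOn ℝ ∞ J O)
    (hZ : ∀ v : 𝔼, ∃ Z : CVField (2 * n + 1) M, S.IsSection Z ∧ ∀ y ∈ O, Z (chartMap ι x₀ y) =
      Complexified.mk (mfderiv 𝓘(ℝ, 𝔼) (𝓡 (2 * n + 1)) (chartMap ι x₀) y v)
        (-mfderiv 𝓘(ℝ, 𝔼) (𝓡 (2 * n + 1)) (chartMap ι x₀) y (J y v)))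
    {β : 𝔼 → 𝔼 →L[ℝ] ℝ} (hβ : ContDiffOn ℝ ∞ β O)
    (hβθ : ∀ y ∈ O, ∀ v : 𝔼, ∀ T, θ (chartMap ι x₀ y) T ≠ 0 → β y v = θ.extDeriv (chartMap ι x₀ y)
      (mfderiv 𝓘(ℝ, 𝔼) (𝓡 (2 * n + 1)) (chartMap ι x₀) y v) T / θ (chartMap ι x₀ y) T)
    {y : 𝔼} (hy : y ∈ O) (hyU : chartMap ι x₀ y ∈ U) : DbarIneqAt J β (τ / (1 - τ)) y := by
  set κ : 𝔼 → M := chartMap ι x₀ with hκ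
  have hκs : ContMDiffOn 𝓘(ℝ, 𝔼) (𝓡 (2 * n + 1)) ∞ κ O := (hV.contMDiffOn_chartMap x₀).mono hO
  set O' := O ∩ κ ⁻¹' U with hO'
  have hO'o : IsOpen O' := hκs.continuousOn.isOpen_inter_preimage hOo h.isOpen_source
  have hκa : ∀ z ∈ O', ContMDiffAt 𝓘(ℝ, 𝔼) (𝓡 (2 * n + 1)) ∞ κ z := fun z hz =>
    hκs.contMDiffAt (hOo.mem_nhds hz.1)
  have hF : ContDiffOn ℝ ∞ (Ψ ∘ κ) O' := fun z hz =>
    ((h.contMDiffAt _ hz.2).comp z (hκa z hz)).contDiffAt.contDiffWithinAt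
  have hDF : ∀ z ∈ O', ∀ v, fderiv ℝ (Ψ ∘ κ) z v =
      mvfderiv (𝓡 (2 * n + 1)) Ψ (κ z) (mfderiv 𝓘(ℝ, 𝔼) (𝓡 (2 * n + 1)) κ z v) := fun z hz v =>
    (mvfderiv_mfderiv ((h.contMDiffAt _ hz.2).mdifferentiableAt (by simp))
      ((hκa z hz).mdifferentiableAt (by simp)) v).symm
  refine dbarIneqAt_of_psh (j := mulI (n + 1)) (r := r) (W := W) (F := Ψ ∘ κ) (O := O') mulI_mulI
    h.isOpen_target h.contDiffOn hO'o (hJ.mono inter_subset_left) hF (fun z hz => h.mapsTo hz.2)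
    ?_ ?_ (fun z hz => h.eq_zero _ hz.2) (hβ.mono inter_subset_left) ?_ hτ hτ1 h.psh ⟨hy, hyU⟩
    (h.fderiv_ne_zero _ hyU)
  · intro z hz v
    obtain ⟨Z, hZs, hZ⟩ := hZ v
    have h1 := (h.mem_T10_iff _ hz.2 _).1 (hZs.2 (κ z))
    rw [hZ z hz.1, Complexified.im_mk, Complexified.re_mk, map_neg, neg_inj] at h1
    rw [hDF z hz, hDF z hz]
    exact h1
  · intro z hz a b hab
    rw [hDF z hz, hDF z hz] at hab
    exact hV.injective_mfderiv_chartMap (hO hz.1) (h.injective _ hz.2 hab)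
  · intro z hz v T hT hjT
    obtain ⟨T, rfl⟩ := h.exists_mvfderiv_eq hz.2 hT
    have h1 := h.apply_eq _ hz.2 T
    have h2 := hβθ z hz.1 v T (by rw [h1]; exact hjT)
    rw [h2, h1, h.extDeriv_eq hz.2, hDF z hz]
    exact mul_div_cancel₀ _ hjT

end HypersurfaceChart

end Hypersurface

/-! ### Plurisubharmonic functions in charts of a complex manifold -/

section ComplexManifold

variable {N : ℕ} {X : Type*} [TopologicalSpace X] [ChartedSpace (EuclideanSpace ℂ (Fin N)) X]
  [IsManifold 𝓘(ℂ, EuclideanSpace ℂ (Fin N)) ω X]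

local notation "ℍ" => EuclideanSpace ℂ (Fin N)

/-- The transition maps between the charts of a complex manifold are holomorphic. -/
theorem contDiffOn_transition {e e' : OpenPartialHomeomorph X ℍ} (he : e ∈ atlas ℍ X)
    (he' : e' ∈ atlas ℍ X) : ContDiffOn ℂ ω (e' ∘ e.symm) (e.symm.trans e').source := by
  have h1 := (contDiffGroupoid ω 𝓘(ℂ, EuclideanSpace ℂ (Fin N))).compatible he he'
  rw [contDiffGroupoid, mem_groupoid_of_pregroupoid] at h1
  have h2 := h1.1
  simp only [contDiffPregroupoid] at h2
  exact h2.mono (by simp)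

variable (N X) in
/-- The real smooth manifold underlying a complex manifold. -/
theorem isManifold_real : IsManifold 𝓘(ℝ, EuclideanSpace ℂ (Fin N)) ∞ X :=
  isManifold_of_contDiffOn _ _ _ fun _ _ he he' =>
    (((contDiffOn_transition he he').restrict_scalars ℝ).of_le (by simp)).mono (by simp)

/-- The transition map from the preferred chart at `x` to the preferred chart at `x₁`. -/
def transition (x₁ x : X) : ℍ → ℍ :=
  extChartAt 𝓘(ℝ, ℍ) x₁ ∘ (extChartAt 𝓘(ℝ, ℍ) x).symm

theorem isOpen_transition_source (x₁ x : X) :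
    IsOpen ((chartAt ℍ x).symm.trans (chartAt ℍ x₁)).source :=
  OpenPartialHomeomorph.open_source _

omit [IsManifold 𝓘(ℂ, EuclideanSpace ℂ (Fin N)) ω X] in
theorem mem_transition_source {x₁ x : X} (hx : x ∈ (extChartAt 𝓘(ℝ, ℍ) x₁).source) :
    extChartAt 𝓘(ℝ, ℍ) x x ∈ ((chartAt ℍ x).symm.trans (chartAt ℍ x₁)).source := by
  rw [extChartAt_source] at hx
  simp [hx]

theorem contDiffOn_transition_extChartAt (x₁ x : X) :
    ContDiffOn ℂ ω (transition x₁ x) ((chartAt ℍ x).symm.trans (chartAt ℍ x₁)).source :=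
  (contDiffOn_transition (chart_mem_atlas ℍ x) (chart_mem_atlas ℍ x₁)).congr fun z _ => by
    simp [transition]

/-- The differential of a transition map is complex linear. -/
theorem fderiv_transition_mulI (x₁ x : X) {z : ℍ}
    (hz : z ∈ ((chartAt ℍ x).symm.trans (chartAt ℍ x₁)).source) (v : ℍ) :
    fderiv ℝ (transition x₁ x) z (mulI N v) = mulI N (fderiv ℝ (transition x₁ x) z v) := by
  have h1 : DifferentiableAt ℂ (transition x₁ x) z :=
    ((contDiffOn_transition_extChartAt x₁ x).contDiffAt
      ((isOpen_transition_source x₁ x).mem_nhds hz)).differentiableAt (by simp)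
  rw [(h1.hasFDerivAt.restrictScalars ℝ).fderiv, mulI_apply, mulI_apply]
  exact (fderiv ℂ (transition x₁ x) z).map_smul Complex.I v

omit [IsManifold 𝓘(ℂ, EuclideanSpace ℂ (Fin N)) ω X] in
theorem mvfderiv_extChartAt_eq_fderiv_transition {x₁ x : X}
    (hx : MDifferentiableAt 𝓘(ℝ, ℍ) 𝓘(ℝ, ℍ) (extChartAt 𝓘(ℝ, ℍ) x₁) x) (v : ℍ) :
    mvfderiv 𝓘(ℝ, ℍ) (extChartAt 𝓘(ℝ, ℍ) x₁) x v =
      fderiv ℝ (transition x₁ x) (extChartAt 𝓘(ℝ, ℍ) x x) v := by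
  have h1 := hx.mfderiv
  rw [ModelWithCorners.range_eq_univ, fderivWithin_univ] at h1
  exact congrArg (fun L : ℍ →L[ℝ] ℍ => L v) h1

/-- The differential of a chart is complex linear. -/
theorem mvfderiv_extChartAt_mulI {x₁ x : X} (hx : x ∈ (extChartAt 𝓘(ℝ, ℍ) x₁).source) (v : ℍ) :
    mvfderiv 𝓘(ℝ, ℍ) (extChartAt 𝓘(ℝ, ℍ) x₁) x (mulI N v) =
      mulI N (mvfderiv 𝓘(ℝ, ℍ) (extChartAt 𝓘(ℝ, ℍ) x₁) x v) := by
  have := isManifold_real N X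
  have h1 : MDifferentiableAt 𝓘(ℝ, ℍ) 𝓘(ℝ, ℍ) (extChartAt 𝓘(ℝ, ℍ) x₁) x :=
    (contMDiffAt_extChartAt' (n := ∞) (by rwa [extChartAt_source] at hx)).mdifferentiableAt
      (by simp)
  refine (mvfderiv_extChartAt_eq_fderiv_transition h1 _).trans ?_
  rw [fderiv_transition_mulI _ _ (mem_transition_source hx)]
  exact congrArg (mulI N) (mvfderiv_extChartAt_eq_fderiv_transition h1 _).symm

omit [IsManifold 𝓘(ℂ, EuclideanSpace ℂ (Fin N)) ω X] in
/-- A function and its differential, expressed in the preferred chart at another point `x₁`. -/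
theorem contDiffAt_and_mvfderiv_eq_comp_chart [IsManifold 𝓘(ℝ, EuclideanSpace ℂ (Fin N)) ∞ X]
    {u : X → ℝ} {x₁ x : X} (hx : x ∈ (extChartAt 𝓘(ℝ, ℍ) x₁).source)
    (hu : ContMDiffAt 𝓘(ℝ, ℍ) 𝓘(ℝ, ℝ) ∞ u x) :
    ContDiffAt ℝ ∞ (u ∘ (extChartAt 𝓘(ℝ, ℍ) x₁).symm) (extChartAt 𝓘(ℝ, ℍ) x₁ x) ∧
    ∀ v : ℍ, mvfderiv 𝓘(ℝ, ℍ) u x v = fderiv ℝ (u ∘ (extChartAt 𝓘(ℝ, ℍ) x₁).symm)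
      (extChartAt 𝓘(ℝ, ℍ) x₁ x) (mvfderiv 𝓘(ℝ, ℍ) (extChartAt 𝓘(ℝ, ℍ) x₁) x v) := by
  set χ := extChartAt 𝓘(ℝ, ℍ) x₁ with hχ
  have hψ : ContMDiffAt 𝓘(ℝ, ℍ) 𝓘(ℝ, ℍ) ∞ χ.symm (χ x) :=
    (contMDiffOn_extChartAt_symm (n := ∞) x₁).contMDiffAt
      ((isOpen_extChartAt_target x₁).mem_nhds (χ.map_source hx))
  have h1 : ContDiffAt ℝ ∞ (u ∘ χ.symm) (χ x) :=
    (ContMDiffAt.comp _ (by rwa [χ.left_inv hx]) hψ).contDiffAt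
  refine ⟨h1, fun v => ?_⟩
  have hφ : MDifferentiableAt 𝓘(ℝ, ℍ) 𝓘(ℝ, ℍ) χ x :=
    (contMDiffAt_extChartAt' (n := ∞) (by rwa [hχ, extChartAt_source] at hx)).mdifferentiableAt
      (by simp)
  have h2 : u =ᶠ[𝓝 x] (u ∘ χ.symm) ∘ χ := by
    filter_upwards [(isOpen_extChartAt_source x₁).mem_nhds hx] with z hz
    exact congrArg u (χ.left_inv hz).symm
  have h3 := mfderiv_comp x (h1.differentiableAt (by simp)).mdifferentiableAt hφ
  rw [← h2.mfderiv_eq, mfderiv_eq_fderiv] at h3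
  exact congrArg (fun L : ℍ →L[ℝ] ℝ => L v) h3

/-- The complex Hessian, which is defined at each point by the preferred chart there, is nonnegative
in every chart around the point if it is so in one. -/
theorem cHess_nonneg_of_complexHessian_nonneg {u : X → ℝ} {x₁ x : X}
    (hx : x ∈ (extChartAt 𝓘(ℝ, ℍ) x₁).source) (hu : ContMDiffAt 𝓘(ℝ, ℍ) 𝓘(ℝ, ℝ) ∞ u x)
    (h : ∀ v, 0 ≤ complexHessian (N := N) u x v) (w : ℍ) :
    0 ≤ cHess (mulI N) (u ∘ (extChartAt 𝓘(ℝ, ℍ) x₁).symm) (extChartAt 𝓘(ℝ, ℍ) x₁ x) w := by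
  have := isManifold_real N X
  have hφ : MDifferentiableAt 𝓘(ℝ, ℍ) 𝓘(ℝ, ℍ) (extChartAt 𝓘(ℝ, ℍ) x₁) x :=
    (contMDiffAt_extChartAt' (n := ∞) (by rwa [extChartAt_source] at hx)).mdifferentiableAt
      (by simp)
  obtain ⟨v, hv⟩ : ∃ v : ℍ, mvfderiv 𝓘(ℝ, ℍ) (extChartAt 𝓘(ℝ, ℍ) x₁) x v = w :=
    (isInvertible_mfderiv_extChartAt (I := 𝓘(ℝ, ℍ)) hx).bijective.2 w
  have hv' : fderiv ℝ (transition x₁ x) (extChartAt 𝓘(ℝ, ℍ) x x) v = w :=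
    (mvfderiv_extChartAt_eq_fderiv_transition hφ v).symm.trans hv
  have hxs := mem_transition_source hx
  have ho := (isOpen_transition_source x₁ x).mem_nhds hxs
  have hF : ContDiffAt ℝ ∞ (transition x₁ x) (extChartAt 𝓘(ℝ, ℍ) x x) :=
    (((contDiffOn_transition_extChartAt x₁ x).contDiffAt ho).restrict_scalars ℝ).of_le (by simp)
  have hF0 : transition x₁ x (extChartAt 𝓘(ℝ, ℍ) x x) = extChartAt 𝓘(ℝ, ℍ) x₁ x := by
    simp [transition]
  have h1 := dbarOp_fderiv_comp (J := fun _ => mulI N) (j := mulI N)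
    (u := u ∘ (extChartAt 𝓘(ℝ, ℍ) x₁).symm) mulI_mulI (differentiableAt_const _) hF
    (by rw [hF0]; exact (contDiffAt_and_mvfderiv_eq_comp_chart hx hu).1) (by
      filter_upwards [ho] with z hz v
      exact fderiv_transition_mulI x₁ x hz v) v
  have h2 : (u ∘ (extChartAt 𝓘(ℝ, ℍ) x₁).symm) ∘ transition x₁ x =ᶠ[𝓝 (extChartAt 𝓘(ℝ, ℍ) x x)]
      u ∘ (extChartAt 𝓘(ℝ, ℍ) x).symm := by
    filter_upwards [ho] with z hz
    have hz' : (extChartAt 𝓘(ℝ, ℍ) x).symm z ∈ (extChartAt 𝓘(ℝ, ℍ) x₁).source := by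
      rw [extChartAt_source]
      simpa using hz.2
    exact congrArg u ((extChartAt 𝓘(ℝ, ℍ) x₁).left_inv hz')
  rw [hF0, hv'] at h1
  rw [← h1, dbarOp_const_fderiv, cHess_congr h2]
  · exact h v
  · exact ContDiffAt.congr_of_eventuallyEq
      (contDiffAt_and_mvfderiv_eq_comp_chart (mem_extChartAt_source x) hu).1 h2

end ComplexManifold

/-! ### Boundaries of domains and the Diederich–Fornæss index -/

section Boundary

variable {n : ℕ} {M : Type*} [TopologicalSpace M]
  [ChartedSpace (EuclideanSpace ℝ (Fin (2 * n + 1))) M] [IsManifold (𝓡 (2 * n + 1)) ∞ M]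
  {S : CRStructure n M} {X : Type*} [TopologicalSpace X]
  [ChartedSpace (EuclideanSpace ℂ (Fin (n + 1))) X]
  {Ω : Set X} {j : M → X}

local notation "ℍ" => EuclideanSpace ℂ (Fin (n + 1))

/-- The one-form `j^* (dr ∘ J)` on the boundary induced by a defining function `r`. -/
def boundaryForm (j : M → X) (r : X → ℝ) : OneForm (2 * n + 1) M := fun p =>
  ((mvfderiv 𝓘(ℝ, ℍ) r (j p) : ℍ →L[ℝ] ℝ).comp (mulI (n + 1))).comp
    (mfderiv (𝓡 (2 * n + 1)) 𝓘(ℝ, ℍ) j p : EuclideanSpace ℝ (Fin (2 * n + 1)) →L[ℝ] ℍ)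

theorem IsDefiningFunction.eq_zero_of_mem_frontier {U : Set X} {r : X → ℝ}
    (hr : IsDefiningFunction (n + 1) Ω U r) (hΩ : IsOpen Ω) {x : X} (hx : x ∈ frontier Ω) :
    r x = 0 := by
  have hxU : x ∈ U := hr.closure_subset hx.1
  have hrc : ContinuousAt r x := (hr.contMDiffOn.continuousOn).continuousAt (hr.isOpen.mem_nhds hxU)
  have h1 : x ∉ Ω := by
    have := hx.2
    rwa [hΩ.interior_eq] at this
  refine le_antisymm ?_ ?_
  · have h2 : (𝓝[Ω] x).NeBot := mem_closure_iff_nhdsWithin_neBot.1 hx.1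
    refine le_of_tendsto (hrc.tendsto.mono_left nhdsWithin_le_nhds : Tendsto r (𝓝[Ω] x) _) ?_
    filter_upwards [self_mem_nhdsWithin] with z hz
    rw [hr.eq_sublevel] at hz
    exact hz.2.le
  · by_contra h2
    exact h1 (by rw [hr.eq_sublevel]; exact ⟨hxU, not_le.1 h2⟩)

/-- A chart of the ambient complex manifold, restricted to the boundary of a domain on which
`-(-r)^δ` is plurisubharmonic. -/
theorem IsDefiningFunction.exists_hypersurfaceChart
    [IsManifold 𝓘(ℂ, EuclideanSpace ℂ (Fin (n + 1))) ω X] {U : Set X} {r : X → ℝ}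
    (hr : IsDefiningFunction (n + 1) Ω U r) (hΩ : IsOpen Ω) (hj : S.IsBoundary Ω j) {δ τ : ℝ}
    (hδ : 0 < δ) (hδτ : 1 - δ ≤ τ)
    (hpsh : IsSmoothPsh (N := n + 1) (fun x => -((-r x) ^ δ)) Ω) (p : M) :
    ∃ U Ψ W r', p ∈ U ∧ HypersurfaceChart S (boundaryForm j r) τ U Ψ W r' := by
  have := isManifold_real (n + 1) X
  set χ := extChartAt 𝓘(ℝ, ℍ) (j p) with hχ
  have hjf : ∀ q, j q ∈ frontier Ω := fun q => by rw [← hj.range_eq]; exact mem_range_self q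
  have hjU : ∀ q, j q ∈ U := fun q => hr.closure_subset (hjf q).1
  have hra : ∀ x ∈ U, ContMDiffAt 𝓘(ℝ, ℍ) 𝓘(ℝ, ℝ) ∞ r x := fun x hx =>
    hr.contMDiffOn.contMDiffAt (hr.isOpen.mem_nhds hx)
  have hχa : ∀ x ∈ χ.source, ContMDiffAt 𝓘(ℝ, ℍ) 𝓘(ℝ, ℍ) ∞ χ x := fun x hx =>
    contMDiffAt_extChartAt' (by rwa [hχ, extChartAt_source] at hx)
  have hd : ∀ q ∈ j ⁻¹' χ.source, ∀ v, mvfderiv (𝓡 (2 * n + 1)) (χ ∘ j) q v =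
      mvfderiv 𝓘(ℝ, ℍ) χ (j q) (embDeriv (N := n + 1) j q v) := fun q hq v => by
    have h1 := mfderiv_comp q ((hχa _ hq).mdifferentiableAt (by simp))
      ((hj.contMDiff q).mdifferentiableAt (by simp))
    exact congrArg (fun L : EuclideanSpace ℝ (Fin (2 * n + 1)) →L[ℝ] ℍ => L v) h1
  have hi : ∀ x ∈ χ.source, Function.Injective (mvfderiv 𝓘(ℝ, ℍ) χ x) := fun x hx =>
    (isInvertible_mfderiv_extChartAt hx).injective
  have hW : IsOpen (χ.target ∩ χ.symm ⁻¹' U) :=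
    (continuousOn_extChartAt_symm (j p)).isOpen_inter_preimage (isOpen_extChartAt_target _)
      hr.isOpen
  refine ⟨j ⁻¹' χ.source, χ ∘ j, χ.target ∩ χ.symm ⁻¹' U, r ∘ χ.symm,
    mem_extChartAt_source (j p), ?_⟩
  constructor
  · exact (isOpen_extChartAt_source (j p)).preimage hj.contMDiff.continuous
  · exact hW
  · exact fun q hq => (hχa _ hq).comp q (hj.contMDiff q)
  · intro q hq
    refine ⟨χ.map_source hq, ?_⟩
    rw [mem_preimage, Function.comp_apply, χ.left_inv hq]
    exact hjU q
  · rintro z ⟨hz, hzU⟩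
    have h1 := (contDiffAt_and_mvfderiv_eq_comp_chart (χ.map_target hz) (hra _ hzU)).1
    rw [← hχ, χ.right_inv hz] at h1
    exact h1.contDiffWithinAt
  · intro q hq
    rw [Function.comp_apply, Function.comp_apply, χ.left_inv hq]
    exact hr.eq_zero_of_mem_frontier hΩ (hjf q)
  · intro q hq h0
    refine hr.differential_ne_zero _ (hjf q) (ContinuousLinearMap.ext fun v => ?_)
    refine ((contDiffAt_and_mvfderiv_eq_comp_chart hq (hra _ (hjU q))).2 v).trans ?_
    rw [Function.comp_apply] at h0
    rw [← hχ, h0]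
    rfl
  · intro q hq a b hab
    rw [hd q hq, hd q hq] at hab
    exact hj.mfderiv_injective q (hi _ hq hab)
  · intro q hq z
    rw [hj.mem_T10_iff, hd q hq, hd q hq, ← mvfderiv_extChartAt_mulI hq, mulI_apply]
    constructor
    · intro h1
      rw [h1]
      exact map_neg _ _
    · intro h1
      refine hi _ hq (h1.trans (map_neg _ _).symm)
  · intro q hq v
    rw [hd q hq, ← mvfderiv_extChartAt_mulI hq]
    exact (contDiffAt_and_mvfderiv_eq_comp_chart hq (hra _ (hjU q))).2 _
  · rintro z ⟨hz, hzU⟩ hz0 v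
    have hzΩ : χ.symm z ∈ Ω := by rw [hr.eq_sublevel]; exact ⟨hzU, hz0⟩
    have hu := hpsh.1.contMDiffAt (hΩ.mem_nhds hzΩ)
    have h1 := cHess_nonneg_of_complexHessian_nonneg (χ.map_target hz) hu (hpsh.2 _ hzΩ) v
    have h2 := (contDiffAt_and_mvfderiv_eq_comp_chart (χ.map_target hz) (hra _ hzU)).1
    rw [← hχ, χ.right_inv hz] at h1 h2
    have h3 := cHess_add_nonneg_of_cHess_rpow h2 hz0 hδ h1
    refine h3.trans (add_le_add le_rfl (mul_le_mul_of_nonneg_right hδτ (by positivity)))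

variable {m : ℕ} {V : Type*} [TopologicalSpace V] [ChartedSpace (EuclideanSpace ℝ (Fin m)) V]
  [IsManifold (𝓡 m) ∞ V] {ι : V → M}

/-- If the Diederich–Fornæss index is not less than one, D'Angelo forms are exact on complex
submanifolds of the boundary. -/
theorem CRStructure.IsBoundary.isExact_pullback [T2Space M]
    [IsManifold 𝓘(ℂ, EuclideanSpace ℂ (Fin (n + 1))) ω X] (hn : 1 ≤ n) (hS : S.IsPseudoconvex)
    (hΩ : IsOpen Ω) (hj : S.IsBoundary Ω j) (hV : S.IsComplexSubmanifold m ι)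
    {α : OneForm (2 * n + 1) M} (hα : S.IsDAngeloForm α) (hdf : 1 ≤ dfIndex (n + 1) Ω) :
    (α.pullback ι : OneForm m V).IsExact := by
  -- `τ_k = 2^(-(k + 1)) ≤ 1 / 2`, so that `τ_k / (1 - τ_k) ≤ 2^(-k)` is summable
  have hτ0 : ∀ k : ℕ, (0 : ℝ) < (1 / 2) ^ (k + 1) := fun k => by positivity
  have hτ1 : ∀ k : ℕ, ((1 : ℝ) / 2) ^ (k + 1) ≤ 1 / 2 := fun k => by
    rw [pow_succ]
    have := pow_le_one₀ (n := k) (by norm_num : (0 : ℝ) ≤ 1 / 2) (by norm_num)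
    linarith
  have h1 : ∀ k : ℕ, ∃ (δ : ℝ) (U : Set X) (r : X → ℝ), 0 < δ ∧ 1 - δ ≤ (1 / 2) ^ (k + 1) ∧
      IsDefiningFunction (n + 1) Ω U r ∧
      IsSmoothPsh (N := n + 1) (fun x => -((-r x) ^ δ)) Ω := by
    intro k
    unfold dfIndex at hdf
    have hne : {δ : ℝ | 0 < δ ∧ δ ≤ 1 ∧ ∃ (U : Set X) (r : X → ℝ),
        IsDefiningFunction (n + 1) Ω U r ∧
        IsSmoothPsh (N := n + 1) (fun x => -((-r x) ^ δ)) Ω}.Nonempty := by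
      rw [nonempty_iff_ne_empty]
      intro h0
      -- the supremum of the empty set is zero, which is less than one
      rw [h0, Real.sSup_empty] at hdf
      norm_num at hdf
    obtain ⟨δ, ⟨hδ0, -, U, r, hr, hpsh⟩, hδ⟩ := exists_lt_of_lt_csSup hne
      (lt_of_lt_of_le (by linarith [hτ0 k] : 1 - ((1 : ℝ) / 2) ^ (k + 1) < 1) hdf)
    exact ⟨δ, U, r, hδ0, by linarith, hr, hpsh⟩
  choose δ U r hδ0 hδ hr hpsh using h1
  have hc := fun k => (hr k).exists_hypersurfaceChart hΩ hj (hδ0 k) (hδ k) (hpsh k)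
  refine hV.isExact_pullback hn hS hα (θ := fun k => boundaryForm j (r k))
    (t := fun k => (1 / 2) ^ (k + 1) / (1 - (1 / 2) ^ (k + 1)))
    (fun k => HypersurfaceChart.isPseudoHermitian (hc k))
    (fun k => div_pos (hτ0 k) (by linarith [hτ1 k])) ?_ ?_
  · refine Summable.of_nonneg_of_le (fun k => (div_pos (hτ0 k) (by linarith [hτ1 k])).le)
      (fun k => ?_) (summable_geometric_of_lt_one (by norm_num : (0 : ℝ) ≤ 1 / 2) (by norm_num))
    rw [div_le_iff₀ (by linarith [hτ1 k])]
    have h2 : (0 : ℝ) < (1 / 2) ^ k := by positivity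
    have h3 : (1 / 2 : ℝ) ≤ 1 - (1 / 2) ^ (k + 1) := by linarith [hτ1 k]
    calc ((1 : ℝ) / 2) ^ (k + 1) = (1 / 2) ^ k * (1 / 2) := pow_succ _ _
      _ ≤ _ := mul_le_mul_of_nonneg_left h3 h2.le
  · intro k x₀ O hO hOo J hJ hZ β hβ hβθ y hy
    obtain ⟨U', Ψ, W, r', hp, h⟩ := hc k (chartMap ι x₀ y)
    exact h.dbarIneqAt (hτ0 k) (by linarith [hτ1 k]) hV hO hOo hJ hZ hβ hβθ hy hp

end Boundary

end CRGeom

end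

theorem mainTheorem10 (n : ℕ) (hn : 1 ≤ n) (M : Type*) [TopologicalSpace M] [T2Space M]
    [SecondCountableTopology M] [ChartedSpace (EuclideanSpace ℝ (Fin (2 * n + 1))) M]
    [IsManifold (𝓡 (2 * n + 1)) ∞ M] (S : CRGeom.CRStructure n M) (hS : S.IsPseudoconvex)
    (α : CRGeom.OneForm (2 * n + 1) M) (hα : S.IsDAngeloForm α)
    (m : ℕ) (V : Type*) [TopologicalSpace V] [ChartedSpace (EuclideanSpace ℝ (Fin m)) V]
    [IsManifold (𝓡 m) ∞ V] (ι : V → M) (hV : S.IsComplexSubmanifold m ι)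
    (hαV : ¬ (α.pullback ι : CRGeom.OneForm m V).IsExact) :
    0 < S.dangeloNorm S.leviCore ∧
    (∀ (h : CRGeom.HermitianMetric (2 * n + 1) M) (K : ℝ≥0∞), 0 < K →
      0 < S.dangeloNormK h K S.leviCore) ∧
    (∀ (X : Type*) [TopologicalSpace X] [T2Space X] [SecondCountableTopology X]
      [ChartedSpace (EuclideanSpace ℂ (Fin (n + 1))) X]
      [IsManifold 𝓘(ℂ, EuclideanSpace ℂ (Fin (n + 1))) ω X] (Ω : Set X) (j : M → X),
      CRGeom.IsPseudoconvexDomain (n + 1) Ω → S.IsBoundary Ω j →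
      CRGeom.dfIndex (n + 1) Ω < 1) := by 
  have h1 := hV.dangeloNorm_leviCore_pos hn hS hα hαV
  refine ⟨h1, fun h K _ => h1.trans_le (CRGeom.CRStructure.dangeloNorm_le_dangeloNormK h K _), ?_⟩
  intro X _ _ _ _ _ Ω j hΩ hj
  by_contra hdf
  exact hαV (hj.isExact_pullback hn hS hΩ.isOpen hV hα (not_lt.1 hdf))
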